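/- **Setting.** Let either $U=\mathbb T^2=\mathbb R^2/(2\pi\mathbb Z^2)$ (periodic boundary conditions), or let $U\subset\mathbb R^2$ be a bounded domain with $C^2$ boundary (homogeneous Neumann boundary conditions). Write $f(r)=r-r^3$, $H=L^2(U)$, $X=C^0(\overline U)$, and let $H^{-1}$ be the dual of $H^1=H^1(U)$, with $\|w\|_{H^{-1}}=\sup\{|\langle w,\varphi\rangle| : \|\varphi\|_{H^1}\le 1\}$. For $\varepsilon>0$ let $A_\varepsilon=-\varepsilon^2\Delta^2+\Delta$ with these boundary conditions, and let $V_\varepsilon$ be the space of those $\varphi\in H^2(U)$ that satisfy the boundary condition ($\partial_n\varphi=0$ in the Neumann case), with norm $\|\varphi\|_{V_\varepsilon}^2=\|\varphi\|_{L^2}^2+\|\nabla\varphi\|_{L^2}^2+\varepsilon^2\|\Delta\varphi\|_{L^2}^2$. For space-time white noise $\partial_tW$ and $\sigma_\varepsilon\in\mathbb R$ let $$Z_\varepsilon(t)=\int_0^t e^{(t-s)A_\varepsilon}\sigma_\varepsilon\,dW(s)$$ be the stochastic convolution, assumed to belong to $C^0([0,T];X)$ almost surely. A process $u_\varepsilon$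 is a solution of $$\partial_t u_\varepsilon=-\varepsilon^2\Delta^2u_\varepsilon+\Delta u_\varepsilon+f(u_\varepsilon)+\sigma_\varepsilon\partial_tW$$ if, almost surely, $v_\varepsilon=u_\varepsilon-Z_\varepsilon\in L^2([0,T];V_\varepsilon)\cap C^0([0,T];X)$ is a weak solution, in the triple $V_\varepsilon\subset H\subset V_\varepsilon'$, of $\partial_tv_\varepsilon=A_\varepsilon v_\varepsilon+f(v_\varepsilon+Z_\varepsilon)$. **Theorem.** Let $C_0\in\mathbb R$. There are $\varepsilon_0>0$ and $p_0>2$ such that for all $T>0$, for every weak solution $u\in C^0([0,T];H^1)\cap L^2([0,T];H^2)$ of $$\partial_tu=\Delta u+f(u)-3C_0u$$ (tested against all of $H^1$) and for all $p\ge p_0$ there is a constant $\tilde K>0$ such that for all $\varepsilon\in(0,\varepsilon_0)$, all $\gamma\ge\varepsilon$, every space-time white noise on a probability space, every $\sigma_\varepsilon\in\mathbb R$ and every solution $u_\varepsilon$ as above, $$\begin{aligned}\mathbb P\Big(\sup_{[0,T]}\|u_\varepsilon-u-Z_\varepsilon\|_{L^2}^2>\tilde K\gamma\Big)\le{}&\mathbb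 P\big(\|u(0)-u_\varepsilon(0)\|_{L^2}^2>\gamma\big)+\mathbb P\big(\|Z_\varepsilon^2-C_0\|_{L^p([0,T],H^{-1})}^2>\gamma\big)\\&+\mathbb P\big(\|Z_\varepsilon\|_{L^p([0,T],H^{-1})}^2>\gamma\big)+\mathbb P\big(\|Z_\varepsilon^3\|_{L^2([0,T],H^{-1})}^2>\gamma\big).\end{aligned}$$ -/

import Mathlib

open MeasureTheory ProbabilityTheory Set Filter Topology
open scoped ENNReal NNReal

noncomputable section

namespace RegAC

/-- The plane `ℝ²` with its Euclidean norm. -/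
abbrev Plane := EuclideanSpace ℝ (Fin 2)

/-- The classical partial derivative `∂ᵢ φ`. -/
def pderiv (i : Fin 2) (φ : Plane → ℝ) (x : Plane) : ℝ :=
  fderiv ℝ φ x (EuclideanSpace.single i 1)

/-- `2π`-periodicity in each coordinate, i.e. `φ` is a function on `𝕋² = ℝ² / (2πℤ²)`. -/
def IsPeriodic (φ : Plane → ℝ) : Prop :=
  ∀ (i : Fin 2) (x : Plane), φ (x + EuclideanSpace.single i (2 * Real.pi)) = φ x

/-- A bounded domain (open, connected, non-empty) of class `C²`: it is the negativity set of a
`C²` function whose gradient does not vanish on the zero set (which then is the boundary). -/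
structure IsSmoothBoundedDomain (U : Set Plane) : Prop where
  isOpen : IsOpen U
  isConnected : IsConnected U
  isBounded : Bornology.IsBounded U
  boundary : ∃ ρ : Plane → ℝ, ContDiff ℝ 2 ρ ∧ U = {x | ρ x < 0} ∧
    ∀ x, ρ x = 0 → fderiv ℝ ρ x ≠ 0

/-- The two settings: periodic boundary conditions on the flat torus `ℝ² / (2πℤ²)`, and
homogeneous Neumann boundary conditions on a planar domain `U`. -/
inductive Setting where
  | torus : Setting
  | neumann (U : Set Plane) : Setting

namespace Setting

/-- In the Neumann setting the domain has to be bounded and smooth. -/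
def Admissible : Setting → Prop
  | torus => True
  | neumann U => IsSmoothBoundedDomain U

/-- The set over which one integrates: a fundamental cell of the torus, resp. the domain. -/
def region : Setting → Set Plane
  | torus => {x | ∀ i, 0 ≤ x i ∧ x i < 2 * Real.pi}
  | neumann U => U

/-- Lebesgue measure on the torus, resp. on the domain. -/
def μ (D : Setting) : Measure Plane := volume.restrict D.region

/-- `H = L²`. -/
abbrev H (D : Setting) := Lp ℝ 2 D.μ

/-- Test functions for weak derivatives: `C^∞(𝕋²)`, resp. `C_c^∞(U)`. -/
def IsTest : Setting → (Plane → ℝ) → Prop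
  | torus, φ => ContDiff ℝ (⊤ : ℕ∞) φ ∧ IsPeriodic φ
  | neumann U, φ => ContDiff ℝ (⊤ : ℕ∞) φ ∧ HasCompactSupport φ ∧ tsupport φ ⊆ U

/-- `g ∈ L²` is the weak partial derivative `∂ᵢ u` of `u ∈ L²`. -/
def IsWeakPartial (D : Setting) (i : Fin 2) (u g : D.H) : Prop :=
  ∀ φ : Plane → ℝ, D.IsTest φ → ∫ x, u x * pderiv i φ x ∂D.μ = - ∫ x, g x * φ x ∂D.μ

open Classical in
/-- The weak partial derivative `∂ᵢ u` (with value `0` if there is none in `L²`). -/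
def weakPartial (D : Setting) (i : Fin 2) (u : D.H) : D.H :=
  if h : ∃ g : D.H, D.IsWeakPartial i u g then h.choose else 0

/-- The Sobolev space `H¹`. -/
def H1 (D : Setting) : Set D.H := {u | ∀ i, ∃ g : D.H, D.IsWeakPartial i u g}

/-- The Sobolev space `H²`. -/
def H2 (D : Setting) : Set D.H := {u | u ∈ D.H1 ∧ ∀ i, D.weakPartial i u ∈ D.H1}

/-- `⟨∇u, ∇w⟩` in `L²`. -/
def gradInner (D : Setting) (u w : D.H) : ℝ :=
  ∑ i, inner ℝ (D.weakPartial i u) (D.weakPartial i w)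

/-- The `H¹`-norm `(‖u‖² + ‖∇u‖²)^{1/2}`. -/
def h1Norm (D : Setting) (u : D.H) : ℝ := Real.sqrt (‖u‖ ^ 2 + D.gradInner u u)

/-- The Laplacian `Δu = ∑ᵢ ∂ᵢ∂ᵢu` of `u ∈ H²`. -/
def lap (D : Setting) (u : D.H) : D.H := ∑ i, D.weakPartial i (D.weakPartial i u)

/-- The underlying space of `V_ε`: the functions of `H²` satisfying the boundary condition. The
homogeneous Neumann condition `∂ₙu = 0` is expressed by Green's formula
`∫ ∇u·∇w = - ∫ Δu w` for all `w ∈ H¹`. On the torus Green's formula holds for all `u ∈ H²`. -/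
def V (D : Setting) : Set D.H :=
  {u | u ∈ D.H2 ∧ ∀ w ∈ D.H1, D.gradInner u w = - inner ℝ (D.lap u) w}

/-- The domain of the operator `A_ε = -ε²Δ² + Δ` in `L²`. -/
def domA (D : Setting) : Set D.H := {u | u ∈ D.V ∧ D.lap u ∈ D.V}

/-- The operator `A_ε = -ε²Δ² + Δ`. -/
def opA (D : Setting) (ε : ℝ) (u : D.H) : D.H := - ε ^ 2 • D.lap (D.lap u) + D.lap u

/-- The extension `A_ε : V_ε → V_ε'` as a form:
`⟨A_ε u, w⟩ = -ε² ⟨Δu, Δw⟩ - ⟨∇u, ∇w⟩`. -/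
def formA (D : Setting) (ε : ℝ) (u w : D.H) : ℝ :=
  - ε ^ 2 * inner ℝ (D.lap u) (D.lap w) - D.gradInner u w

/-- `(S t)_{t ≥ 0}` is the `C₀`-semigroup on `L²` generated by `A_ε`. -/
structure IsSemigroupOf (D : Setting) (ε : ℝ) (S : ℝ → D.H →L[ℝ] D.H) : Prop where
  zero : S 0 = ContinuousLinearMap.id ℝ D.H
  add : ∀ s t : ℝ, 0 ≤ s → 0 ≤ t → S (s + t) = (S s).comp (S t)
  cont : ∀ x, Tendsto (fun t => S t x) (𝓝[>] 0) (𝓝 x)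
  generator : ∀ x y, Tendsto (fun t : ℝ => t⁻¹ • (S t x - x)) (𝓝[>] 0) (𝓝 y) ↔
    (x ∈ D.domA ∧ y = D.opA ε x)

end Setting

open Classical in
/-- The class in `L²` of a square integrable function (and `0` for all other functions). -/
def toL2 {α E : Type*} [MeasurableSpace α] [NormedAddCommGroup E] (ν : Measure α) (f : α → E) :
    Lp E 2 ν :=
  if h : MemLp f 2 ν then h.toLp f else 0

namespace Setting

/-- Space-time white noise `∂ₜW` over `[0,∞) × 𝕋²`, resp. `[0,∞) × U`, as an isonormal Gaussian
process: a linear isometry from `L²([0,∞); L²)` to a space of centred Gaussian variables. The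
standard cylindrical Wiener process is `W_t(h) = noise (1_{[0,t]} h)`, and `noise F` is the
Wiener integral `∫₀^∞ ⟨F(s), dW(s)⟩`. -/
structure WhiteNoise (D : Setting) {Ω : Type*} [MeasurableSpace Ω] (P : Measure Ω) where
  noise : Lp D.H 2 ((volume : Measure ℝ).restrict (Ici 0)) →ₗᵢ[ℝ] Lp ℝ 2 P
  gaussian : ∀ F, P.map (noise F) = gaussianReal 0 (‖F‖₊ ^ 2)

/-- `Z` is, on `[0,T]`, the stochastic convolution `Z(t) = ∫₀ᵗ e^{(t-s)A_ε} σ dW(s)`, i.e.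
`⟨Z(t), h⟩ = σ ∫₀ᵗ ⟨(e^{(t-s)A_ε})^* h, dW(s)⟩` almost surely, for all `t` and `h`. -/
def IsStochasticConvolution (D : Setting) {Ω : Type*} [MeasurableSpace Ω] {P : Measure Ω}
    (W : D.WhiteNoise P) (ε σ T : ℝ) (Z : ℝ → Ω → Plane → ℝ) : Prop :=
  ∃ S : ℝ → D.H →L[ℝ] D.H, D.IsSemigroupOf ε S ∧
    ∀ t ∈ Icc 0 T, ∀ h : D.H,
      (fun ω => inner ℝ (toL2 D.μ (Z t ω)) h) =ᵐ[P] fun ω =>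
        σ * W.noise (toL2 _ (indicator (Icc 0 t)
          (fun s => ContinuousLinearMap.adjoint (S (t - s)) h))) ω

/-- `z ∈ C⁰([0,T]; X)` with `X = C⁰(𝕋²)`, resp. `X = C⁰(Ū)`; by compactness of `𝕋²`, resp. `Ū`,
this is joint continuity in time and space. -/
def IsC0Path (D : Setting) (T : ℝ) (z : ℝ → Plane → ℝ) : Prop :=
  match D with
  | torus => ContinuousOn (fun q : ℝ × Plane => z q.1 q.2) (Icc 0 T ×ˢ univ) ∧
      ∀ t ∈ Icc 0 T, IsPeriodic (z t)
  | neumann U => ContinuousOn (fun q : ℝ × Plane => z q.1 q.2) (Icc 0 T ×ˢ closure U)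

/-- `u ∈ C⁰([0,T]; H¹)`. -/
def IsC0H1 (D : Setting) (T : ℝ) (u : ℝ → D.H) : Prop :=
  (∀ t ∈ Icc 0 T, u t ∈ D.H1) ∧ ContinuousOn u (Icc 0 T) ∧
    ∀ i, ContinuousOn (fun t => D.weakPartial i (u t)) (Icc 0 T)

/-- `u ∈ L²([0,T]; H²)`. -/
def IsL2H2 (D : Setting) (T : ℝ) (u : ℝ → D.H) : Prop :=
  (∀ᵐ t ∂(volume.restrict (Icc 0 T)), u t ∈ D.H2) ∧
  MemLp u 2 (volume.restrict (Icc 0 T)) ∧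
  (∀ i, MemLp (fun t => D.weakPartial i (u t)) 2 (volume.restrict (Icc 0 T))) ∧
  ∀ i j, MemLp (fun t => D.weakPartial i (D.weakPartial j (u t))) 2 (volume.restrict (Icc 0 T))

/-- `v ∈ L²([0,T]; V_ε)`, where `‖v‖²_{V_ε} = ‖v‖² + ‖∇v‖² + ε²‖Δv‖²` with fixed `ε > 0`. -/
def IsL2V (D : Setting) (T : ℝ) (v : ℝ → D.H) : Prop :=
  (∀ᵐ t ∂(volume.restrict (Icc 0 T)), v t ∈ D.V) ∧
  MemLp v 2 (volume.restrict (Icc 0 T)) ∧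
  (∀ i, MemLp (fun t => D.weakPartial i (v t)) 2 (volume.restrict (Icc 0 T))) ∧
  MemLp (fun t => D.lap (v t)) 2 (volume.restrict (Icc 0 T))

/-- The weak formulation of `∂ₜy = A y + N(t)` on `[0,T]` with test space `E`, where `a y w` is
the pairing `⟨A y, w⟩`: all integrals are well defined, and
`⟨y(t), w⟩ = ⟨y(0), w⟩ + ∫₀ᵗ ⟨A y(s), w⟩ ds + ∫₀ᵗ ⟨N(s), w⟩ ds`. -/
def IsWeakIdentity (D : Setting) (E : Set D.H) (a : D.H → D.H → ℝ) (T : ℝ) (y : ℝ → D.H)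
    (N : ℝ → Plane → ℝ) : Prop :=
  ∀ w ∈ E,
    (∀ᵐ s ∂(volume.restrict (Icc 0 T)), Integrable (fun x => N s x * w x) D.μ) ∧
    IntegrableOn (fun s => a (y s) w) (Icc 0 T) ∧
    IntegrableOn (fun s => ∫ x, N s x * w x ∂D.μ) (Icc 0 T) ∧
    ∀ t ∈ Icc 0 T, inner ℝ (y t) w = inner ℝ (y 0) w + (∫ s in (0 : ℝ)..t, a (y s) w) +
      ∫ s in (0 : ℝ)..t, ∫ x, N s x * w x ∂D.μ

end Setting

/-- The cubic nonlinearity `f(r) = r - r³`. -/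
def cubic (r : ℝ) : ℝ := r - r ^ 3

namespace Setting

/-- `u ∈ C⁰([0,T]; H¹) ∩ L²([0,T]; H²)` is a weak solution of the limiting equation
`∂ₜu = Δu + f(u) - 3 C₀ u`. -/
def IsLimitSolution (D : Setting) (C₀ T : ℝ) (u : ℝ → D.H) : Prop :=
  D.IsC0H1 T u ∧ D.IsL2H2 T u ∧
  D.IsWeakIdentity D.H1 (fun y w => - D.gradInner y w) T u
    (fun t x => cubic (u t x) - 3 * C₀ * u t x)

/-- The path `y` of `u_ε` solves `∂ₜy = -ε²Δ²y + Δy + f(y) + σ ∂ₜW`, given the path `z` of the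
stochastic convolution: `v = y - z ∈ L²([0,T]; V_ε) ∩ C⁰([0,T]; X)` is a weak solution of
`∂ₜv = A_ε v + f(v + z)`. -/
def IsRegularizedSolution (D : Setting) (ε T : ℝ) (z y : ℝ → Plane → ℝ) : Prop :=
  D.IsC0Path T (fun t x => y t x - z t x) ∧
  D.IsL2V T (fun t => toL2 D.μ (fun x => y t x - z t x)) ∧
  D.IsWeakIdentity D.V (D.formA ε) T (fun t => toL2 D.μ (fun x => y t x - z t x))
    (fun t x => cubic (y t x))

/-- `‖w‖²_{L²}`. -/
def l2Sq (D : Setting) (w : Plane → ℝ) : ℝ≥0∞ := eLpNorm w 2 D.μ ^ 2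

/-- The norm of `w` in `H⁻¹ = (H¹)'`: the supremum of `|∫ w φ|` over `‖φ‖_{H¹} ≤ 1`. -/
def hNegNorm (D : Setting) (w : Plane → ℝ) : ℝ≥0∞ :=
  ⨆ φ : D.H, ⨆ _ : φ ∈ D.H1 ∧ D.h1Norm φ ≤ 1, ENNReal.ofReal |∫ x, w x * φ x ∂D.μ|

/-- `‖w‖²_{L^p([0,T]; H⁻¹)}`. -/
def lpNegSq (D : Setting) (p T : ℝ) (w : ℝ → Plane → ℝ) : ℝ≥0∞ :=
  ((∫⁻ t in Icc 0 T, D.hNegNorm (w t) ^ p) ^ (1 / p)) ^ 2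

end Setting

end RegAC

end

open MeasureTheory ProbabilityTheory Set Filter Topology
open scoped ENNReal NNReal

noncomputable section

namespace RegAC

open scoped ContDiff

/-! Put `v = u_ε - Z_ε` and `d = v - u`. The probabilistic inequality is a union bound: when none of
the four events on the right occurs, almost every path satisfies `‖d(t)‖² ≤ L γ` on `[0,T]` with a
deterministic `L` (`exists_pathwise_bound`). Beyond that, randomness enters only through the fact
that `Z_ε(0)` vanishes in `L²` almost surely, which identifies `d(0)` with the difference of the
initial values.

The pathwise bound is an energy estimate. Formally, half the time derivative of `‖d‖²` is `⟨f(d + u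
+ Z) - f(u) + 3 C₀ u, d⟩ - ‖∇d‖² - ε² ⟨Δv, Δd⟩`. Expanding the cube, the part `-d² (d² + 3d(u+Z) +
3(u+Z)²)` has a sign and is dropped. What remains is `d² + Z d - Z³ d - 3 (Z² - C₀)(u d) - 3 Z (u²
d)`, so that `Z`, `Z² - C₀` and `Z³` occur only paired with `d`, `u d` and `u² d`, and their `H⁻¹`
norms suffice. The cost is an `H¹` bound on `u d` and `u² d` (`exists_h1Norm_mul_le`): both squared
norms are at most `K b⁵ ‖d‖²_{H¹}` with `b³ = K (1 + ‖u‖_{H²})`. Young's inequality absorbs the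
gradient of `d` into the dissipation. The fourth order term is harmless, since `-ε² ⟨Δv, Δv - Δu⟩ ≤
ε² ‖Δu‖² / 4` and `ε² ≤ γ` once `ε < 1`. Because `u ∈ L²(H²)`, the weight `b⁶` is integrable in
time, so `b⁵` pairs by Hölder with squares of functions in `L^p` as soon as `p ≥ 12`. Gronwall's
inequality finishes.

Three analytic facts carry this. First, Ladyzhenskaya's inequality (`exists_mul_bound`) and `|u|³ ≤
C ‖u‖²_{H¹} ‖u‖_{H²}` (`exists_cube_bound`); they are the embeddings `W^{1,1} ⊂ L²` and `W^{2,1} ⊂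
L^∞` applied to `u²` and `u³`, and the embeddings come from integrating weak derivatives along small
parallelograms that stay in the domain. Second, `u(t) ∈ V` for almost every `t`
(`IsLimitSolution.ae_mem_V`), so that `d(t)` is an admissible test function in both equations.
Third, an energy inequality that never speaks of a time derivative in a dual space
(`norm_sq_sub_le_integral`): increments over a step `h` are tested with `d(t)` and summed over `t`,
and `h → 0` uses only continuity of translation in `L²`. -/

/-! ### Weak directional derivatives on open subsets of the plane -/

/-- `G` is the weak derivative of `F` in direction `e` on the open set `O`. -/
def HasWeakDeriv (O : Set Plane) (e : Plane) (F G : Plane → ℝ) : Prop :=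
  ∀ ψ : Plane → ℝ, ContDiff ℝ ∞ ψ → HasCompactSupport ψ → tsupport ψ ⊆ O →
    ∫ x, F x * fderiv ℝ ψ x e = - ∫ x, G x * ψ x

theorem integrable_mul_of_hasCompactSupport {F ψ : Plane → ℝ} (hF : LocallyIntegrable F)
    (hψ : Continuous ψ) (hc : HasCompactSupport ψ) : Integrable (fun x => F x * ψ x) := by
  simpa [smul_eq_mul] using hF.integrable_smul_right_of_hasCompactSupport hψ hc

theorem continuous_fderiv_apply_of_smooth {ψ : Plane → ℝ} (h : ContDiff ℝ ∞ ψ) (e : Plane) :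
    Continuous fun x => fderiv ℝ ψ x e :=
  (h.continuous_fderiv (by simp)).clm_apply continuous_const

theorem hasCompactSupport_fderiv_apply {ψ : Plane → ℝ} (h : HasCompactSupport ψ) (e : Plane) :
    HasCompactSupport fun x => fderiv ℝ ψ x e :=
  h.fderiv_apply (𝕜 := ℝ) e

theorem integrable_mul_fderiv {F ψ : Plane → ℝ} (hF : LocallyIntegrable F)
    (hψ : ContDiff ℝ ∞ ψ) (hc : HasCompactSupport ψ) (e : Plane) :
    Integrable (fun x => F x * fderiv ℝ ψ x e) :=
  integrable_mul_of_hasCompactSupport hF (continuous_fderiv_apply_of_smooth hψ e)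
    (hasCompactSupport_fderiv_apply hc e)

theorem fderiv_eq_zero_of_notMem_tsupport {ψ : Plane → ℝ} {x : Plane} (hx : x ∉ tsupport ψ) :
    fderiv ℝ ψ x = 0 := by
  by_contra h
  exact hx (support_fderiv_subset ℝ (by simpa [Function.mem_support] using h))

namespace HasWeakDeriv

variable {O : Set Plane} {e : Plane} {F G F' G' : Plane → ℝ}

theorem mono {O' : Set Plane} (h : HasWeakDeriv O e F G) (hO : O' ⊆ O) : HasWeakDeriv O' e F G :=
  fun ψ h1 h2 h3 => h ψ h1 h2 (h3.trans hO)

theorem congr (h : HasWeakDeriv O e F G) (hF : ∀ᵐ x, x ∈ O → F x = F' x)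
    (hG : ∀ᵐ x, x ∈ O → G x = G' x) : HasWeakDeriv O e F' G' := by
  intro ψ h1 h2 h3
  have := h ψ h1 h2 h3
  convert this using 1
  · apply integral_congr_ae
    filter_upwards [hF] with x hx
    by_cases hxO : x ∈ tsupport ψ
    · rw [hx (h3 hxO)]
    · simp [fderiv_eq_zero_of_notMem_tsupport hxO]
  · congr 1
    apply integral_congr_ae
    filter_upwards [hG] with x hx
    by_cases hxO : x ∈ tsupport ψ
    · rw [hx (h3 hxO)]
    · simp [image_eq_zero_of_notMem_tsupport hxO]

theorem add (h : HasWeakDeriv O e F G) (h' : HasWeakDeriv O e F' G')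
    (hF : LocallyIntegrable F) (hF' : LocallyIntegrable F')
    (hG : LocallyIntegrable G) (hG' : LocallyIntegrable G') :
    HasWeakDeriv O e (fun x => F x + F' x) (fun x => G x + G' x) := by
  intro ψ h1 h2 h3
  simp only [add_mul]
  rw [integral_add (integrable_mul_fderiv hF h1 h2 e) (integrable_mul_fderiv hF' h1 h2 e),
    integral_add (integrable_mul_of_hasCompactSupport hG h1.continuous h2)
      (integrable_mul_of_hasCompactSupport hG' h1.continuous h2), h ψ h1 h2 h3, h' ψ h1 h2 h3]
  ring

theorem const_mul (h : HasWeakDeriv O e F G) (c : ℝ) :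
    HasWeakDeriv O e (fun x => c * F x) (fun x => c * G x) := by
  intro ψ h1 h2 h3
  simp only [mul_assoc]
  rw [integral_const_mul, integral_const_mul, h ψ h1 h2 h3]
  ring

theorem comb_dir {e' : Plane} (h : HasWeakDeriv O e F G) (h' : HasWeakDeriv O e' F G')
    (hF : LocallyIntegrable F)
    (hG : LocallyIntegrable G) (hG' : LocallyIntegrable G') (a b : ℝ) :
    HasWeakDeriv O (a • e + b • e') F (fun x => a * G x + b * G' x) := by
  intro ψ h1 h2 h3
  have e1 : ∀ x, F x * fderiv ℝ ψ x (a • e + b • e')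
      = a * (F x * fderiv ℝ ψ x e) + b * (F x * fderiv ℝ ψ x e') := by
    intro x; simp; ring
  have e2 : ∀ x, (a * G x + b * G' x) * ψ x = a * (G x * ψ x) + b * (G' x * ψ x) := by
    intro x; ring
  simp only [e1, e2]
  rw [integral_add ((integrable_mul_fderiv hF h1 h2 e).const_mul _)
      ((integrable_mul_fderiv hF h1 h2 e').const_mul _),
    integral_add ((integrable_mul_of_hasCompactSupport hG h1.continuous h2).const_mul _)
      ((integrable_mul_of_hasCompactSupport hG' h1.continuous h2).const_mul _)]
  simp only [integral_const_mul]
  rw [h ψ h1 h2 h3, h' ψ h1 h2 h3]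
  ring

theorem unique (hO : IsOpen O) (h : HasWeakDeriv O e F G) (h' : HasWeakDeriv O e F G')
    (hG : LocallyIntegrable G) (hG' : LocallyIntegrable G') : ∀ᵐ x, x ∈ O → G x = G' x := by
  have := hO.ae_eq_zero_of_integral_contDiff_smul_eq_zero (μ := volume) (f := fun x => G x - G' x)
    ((hG.sub hG').locallyIntegrableOn O) ?_
  · filter_upwards [this] with x hx hxO
    exact sub_eq_zero.1 (hx hxO)
  · intro ψ h1 h2 h3
    have e1 := h ψ h1 h2 h3
    have e2 := h' ψ h1 h2 h3
    simp only [smul_eq_mul, mul_sub]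
    rw [integral_sub]
    · simp only [mul_comm (ψ _)]
      linarith
    · simpa [mul_comm] using integrable_mul_of_hasCompactSupport hG h1.continuous h2
    · simpa [mul_comm] using integrable_mul_of_hasCompactSupport hG' h1.continuous h2

/-- Test the hypothesis with `κ ψ`: it is supported in `O` whatever `ψ` is, so the localized
function has a weak derivative on the whole plane. -/
theorem cutoff (h : HasWeakDeriv O e F G) (hF : LocallyIntegrable F) (hG : LocallyIntegrable G)
    {κ : Plane → ℝ} (hκ : ContDiff ℝ ∞ κ) (hs : tsupport κ ⊆ O) :
    HasWeakDeriv univ e (fun x => F x * κ x) (fun x => G x * κ x + F x * fderiv ℝ κ x e) := by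
  intro ψ h1 h2 _
  have hd : ∀ x, fderiv ℝ (fun y => κ y * ψ y) x e
      = κ x * fderiv ℝ ψ x e + ψ x * fderiv ℝ κ x e := by
    intro x
    have := fderiv_mul (hκ.differentiable (by simp) x) (h1.differentiable (by simp) x)
    change fderiv ℝ (κ * ψ) x e = _
    rw [this]; simp
  have hcc : HasCompactSupport (fun y => κ y * ψ y) := h2.mul_left
  have := h (fun y => κ y * ψ y) (hκ.mul h1) hcc
    ((tsupport_mul_subset_left).trans hs)
  simp only [hd] at this
  have i1 : Integrable (fun x => (F x * κ x) * fderiv ℝ ψ x e) := by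
    simpa [mul_assoc] using integrable_mul_of_hasCompactSupport hF
      (hκ.continuous.mul (continuous_fderiv_apply_of_smooth h1 e))
      ((hasCompactSupport_fderiv_apply h2 e).mul_left)
  have i2 : Integrable (fun x => F x * (fderiv ℝ κ x e * ψ x)) :=
    integrable_mul_of_hasCompactSupport hF
      ((continuous_fderiv_apply_of_smooth hκ e).mul h1.continuous) h2.mul_left
  have i3 : Integrable (fun x => G x * (κ x * ψ x)) :=
    integrable_mul_of_hasCompactSupport hG (hκ.continuous.mul h1.continuous) hcc
  have e1 : (∫ x, F x * (κ x * fderiv ℝ ψ x e + ψ x * fderiv ℝ κ x e))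
      = (∫ x, (F x * κ x) * fderiv ℝ ψ x e) + ∫ x, F x * (fderiv ℝ κ x e * ψ x) := by
    rw [← integral_add i1 i2]; congr 1; ext x; ring
  have e2 : (∫ x, (G x * κ x + F x * fderiv ℝ κ x e) * ψ x)
      = (∫ x, G x * (κ x * ψ x)) + ∫ x, F x * (fderiv ℝ κ x e * ψ x) := by
    rw [← integral_add i3 i2]; congr 1; ext x; ring
  rw [e1] at this
  rw [e2]; linarith

end HasWeakDeriv

/-! ### Translates of test functions and the fundamental theorem of calculus -/

theorem tsupport_comp_sub (ψ : Plane → ℝ) (z : Plane) :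
    tsupport (fun x => ψ (x - z)) = {x | x - z ∈ tsupport ψ} := by
  have := tsupport_comp_eq_preimage ψ (Homeomorph.subRight z)
  exact this

/-- Pairings of an integrable function with translates of a test function are differentiable. -/
theorem hasDerivAt_integral_mul_translate {F φ : Plane → ℝ} (hF : LocallyIntegrable F)
    (hφ : ContDiff ℝ ∞ φ) (hc : HasCompactSupport φ) (e : Plane) (r : ℝ) :
    HasDerivAt (fun r : ℝ => ∫ x, F x * φ (x - r • e))
      (-∫ x, F x * fderiv ℝ φ (x - r • e) e) r := by
  -- With the reflected function `g`, the pairing is the convolution of `F` and `g` evaluated at `r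
  -- • e`, so differentiability of convolutions with smooth compactly supported functions applies.
  set g : Plane → ℝ := fun y => φ (-y) with hg
  have hgs : ContDiff ℝ ∞ g := hφ.comp contDiff_neg
  have hgc : HasCompactSupport g := hc.comp_homeomorph (Homeomorph.neg Plane)
  have hd : ∀ y v, fderiv ℝ g y v = - fderiv ℝ φ (-y) v := by
    intro y v
    have : HasFDerivAt g ((fderiv ℝ φ (-y)).comp (-(ContinuousLinearMap.id ℝ Plane))) y :=
      ((hφ.differentiable (by simp)) (-y)).hasFDerivAt.comp y (hasFDerivAt_id y).neg
    rw [this.fderiv]; simp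
  have key := (hgc.hasFDerivAt_convolution_right (ContinuousLinearMap.mul ℝ ℝ) (μ := volume) hF
    (hgs.of_le (by simp)) (r • e))
  have hline : HasDerivAt (fun r : ℝ => r • e) e r := by
    simpa using (hasDerivAt_id r).smul_const e
  have := key.comp_hasDerivAt r hline
  have hint : Integrable (fun t => ((ContinuousLinearMap.mul ℝ ℝ).precompR Plane) (F t)
      (fderiv ℝ g (r • e - t))) := by
    have := HasCompactSupport.convolutionExists_right ((ContinuousLinearMap.mul ℝ ℝ).precompR Plane)
      (hgc.fderiv ℝ) hF (hgs.continuous_fderiv (by simp)) (μ := volume) (r • e)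
    exact this
  have hfun : (fun r : ℝ => ∫ x, F x * φ (x - r • e))
      = (convolution F g (ContinuousLinearMap.mul ℝ ℝ) volume) ∘ fun r : ℝ => r • e := by
    ext r
    simp only [Function.comp, convolution, ContinuousLinearMap.mul_apply', hg, neg_sub]
  rw [hfun]
  refine this.congr_deriv ?_
  unfold convolution
  have h3 := ContinuousLinearMap.integral_comp_comm (ContinuousLinearMap.apply ℝ ℝ e) hint
  rw [ContinuousLinearMap.apply_apply] at h3
  rw [← h3, ← integral_neg]
  congr 1; ext x
  simp [ContinuousLinearMap.precompR_apply, hd]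

theorem continuous_integral_mul_translate {F φ : Plane → ℝ} (hF : LocallyIntegrable F)
    (hφ : Continuous φ) (hc : HasCompactSupport φ) (e : Plane) :
    Continuous (fun r : ℝ => ∫ x, F x * φ (x - r • e)) := by
  set g : Plane → ℝ := fun y => φ (-y) with hg
  have hgc : HasCompactSupport g := hc.comp_homeomorph (Homeomorph.neg Plane)
  have := hgc.continuous_convolution_right (ContinuousLinearMap.mul ℝ ℝ) (μ := volume) hF
    (hφ.comp continuous_neg)
  have h2 := this.comp (show Continuous fun r : ℝ => r • e by fun_prop)
  convert h2 using 1
  ext r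
  simp only [Function.comp, convolution, ContinuousLinearMap.mul_apply', hg, neg_sub]

/-- The shear `(r, x) ↦ (r, x + r • e)` preserves the product measure and turns this function into
one that depends on `x` alone. This justifies the Fubini steps along segments. -/
theorem integrable_translate_prod {G : Plane → ℝ} (hG : Integrable G) (e : Plane) (s : ℝ) :
    Integrable (fun p : Plane × ℝ => G (p.1 + p.2 • e))
      ((volume : Measure Plane).prod (volume.restrict (Ioc 0 s))) := by
  have hmp : MeasurePreserving (fun p : ℝ × Plane => (p.1, p.2 + p.1 • e))
      ((volume.restrict (Ioc 0 s)).prod (volume : Measure Plane))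
      ((volume.restrict (Ioc 0 s)).prod (volume : Measure Plane)) := by
    refine (MeasurePreserving.id (volume.restrict (Ioc 0 s))).skew_product
      (g := fun r x => x + r • e) (by fun_prop) ?_
    exact Eventually.of_forall fun r => (measurePreserving_add_right volume (r • e)).map_eq
  have h1 : Integrable (fun p : ℝ × Plane => G p.2)
      ((volume.restrict (Ioc 0 s)).prod (volume : Measure Plane)) := hG.comp_snd _
  have h2 : Integrable (fun p : ℝ × Plane => G (p.2 + p.1 • e))
      ((volume.restrict (Ioc 0 s)).prod (volume : Measure Plane)) :=
    (hmp.integrable_comp h1.aestronglyMeasurable).2 h1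
  exact h2.swap

/-- The fundamental theorem of calculus for weak derivatives along almost every segment. -/
theorem HasWeakDeriv.sub_eq_integral {O W : Set Plane} {e : Plane} {F G : Plane → ℝ}
    (h : HasWeakDeriv O e F G) (hF : Integrable F) (hG : Integrable G) (hW : IsOpen W)
    {s : ℝ} (hs : 0 ≤ s) (hWO : ∀ x ∈ W, ∀ r ∈ Icc 0 s, x + r • e ∈ O) :
    ∀ᵐ x, x ∈ W → F (x + s • e) - F x = ∫ r in (0 : ℝ)..s, G (x + r • e) := by
  have hGp := integrable_translate_prod hG e s
  have hFs : Integrable (fun x => F (x + s • e)) := hF.comp_add_right (s • e)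
  have hI : Integrable (fun x => ∫ r in (0 : ℝ)..s, G (x + r • e)) := by
    simp only [intervalIntegral.integral_of_le hs]
    exact hGp.integral_prod_left
  have hH : Integrable (fun x => F (x + s • e) - F x - ∫ r in (0 : ℝ)..s, G (x + r • e)) :=
    (hFs.sub hF).sub hI
  have := hW.ae_eq_zero_of_integral_contDiff_smul_eq_zero (μ := volume)
    (hH.locallyIntegrable.locallyIntegrableOn W) ?_
  · filter_upwards [this] with x hx hxW
    linarith [hx hxW]
  intro φ h1 h2 h3
  obtain ⟨C, hC⟩ := h2.exists_bound_of_continuous h1.continuous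
  -- Since segments of length `s` starting in `W` stay in `O`, the translate of `φ` by `r • e` is
  -- still an admissible test function on `O`.
  have htr : ∀ r ∈ Icc 0 s, (∫ x, F x * fderiv ℝ φ (x - r • e) e)
      = -∫ x, G x * φ (x - r • e) := by
    intro r hr
    have hd : ∀ x, fderiv ℝ (fun y => φ (y - r • e)) x e = fderiv ℝ φ (x - r • e) e := by
      intro x; rw [fderiv_comp_sub]
    have := h (fun y => φ (y - r • e)) (h1.comp (contDiff_id.sub contDiff_const))
      (h2.comp_homeomorph (Homeomorph.subRight (r • e))) ?_
    · simpa only [hd] using this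
    · rw [tsupport_comp_sub]
      intro x hx
      have := hWO _ (h3 hx) r hr
      simpa using this
  have hcont : Continuous fun r : ℝ => -∫ x, F x * fderiv ℝ φ (x - r • e) e :=
    (continuous_integral_mul_translate hF.locallyIntegrable
      (continuous_fderiv_apply_of_smooth h1 e) (hasCompactSupport_fderiv_apply h2 e) e).neg
  -- The classical fundamental theorem is applied in `r` to the pairing of `F` with the translated
  -- test function; the weak derivative then replaces the integrand, and the translation is moved
  -- back onto `F` and `G`.
  have ftc := intervalIntegral.integral_eq_sub_of_hasDerivAt (a := 0) (b := s)
    (fun r _ => hasDerivAt_integral_mul_translate hF.locallyIntegrable h1 h2 e r)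
    (hcont.intervalIntegrable _ _)
  have e1 : (∫ r in (0 : ℝ)..s, -∫ x, F x * fderiv ℝ φ (x - r • e) e)
      = ∫ r in (0 : ℝ)..s, ∫ x, G (x + r • e) * φ x := by
    apply intervalIntegral.integral_congr
    intro r hr
    rw [uIcc_of_le hs] at hr
    simp only
    rw [htr r hr, neg_neg, ← integral_add_right_eq_self _ (r • e)]
    simp
  have e2 : (∫ r in (0 : ℝ)..s, ∫ x, G (x + r • e) * φ x)
      = ∫ x, (∫ r in (0 : ℝ)..s, G (x + r • e)) * φ x := by
    simp only [intervalIntegral.integral_of_le hs, ← integral_mul_const]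
    rw [integral_integral_swap]
    have := (hGp.mul_bdd (c := C) (g := fun p : Plane × ℝ => φ p.1)
      (h1.continuous.comp continuous_fst).aestronglyMeasurable
      (Eventually.of_forall fun p => hC p.1))
    exact this.swap
  have e3 : (∫ x, F x * φ (x - s • e)) = ∫ x, F (x + s • e) * φ x := by
    rw [← integral_add_right_eq_self _ (s • e)]; simp
  have b1 : Integrable (fun x => F (x + s • e) * φ x) :=
    integrable_mul_of_hasCompactSupport hFs.locallyIntegrable h1.continuous h2
  have b2 : Integrable (fun x => F x * φ x) :=
    integrable_mul_of_hasCompactSupport hF.locallyIntegrable h1.continuous h2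
  have b3 : Integrable (fun x => (∫ r in (0 : ℝ)..s, G (x + r • e)) * φ x) :=
    integrable_mul_of_hasCompactSupport hI.locallyIntegrable h1.continuous h2
  have : ∀ x, φ x • (F (x + s • e) - F x - ∫ r in (0 : ℝ)..s, G (x + r • e))
      = F (x + s • e) * φ x - F x * φ x - (∫ r in (0 : ℝ)..s, G (x + r • e)) * φ x := by
    intro x; simp only [smul_eq_mul]; ring
  simp only [this]
  have hsub : (∫ x, (F (x + s • e) * φ x - F x * φ x
      - (∫ r in (0 : ℝ)..s, G (x + r • e)) * φ x)) = (∫ x, F (x + s • e) * φ x)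
      - (∫ x, F x * φ x) - ∫ x, (∫ r in (0 : ℝ)..s, G (x + r • e)) * φ x := by
    rw [← integral_sub b1 b2]; exact integral_sub (b1.sub b2) b3
  rw [hsub]
  rw [e1, e2, e3] at ftc
  simp only [zero_smul, sub_zero] at ftc
  linarith

/-! ### Translation in L² and the product rule -/

/-- Translation is continuous in `L²`. -/
theorem tendsto_eLpNorm_translate_sub {V E : Type*} [NormedAddCommGroup V] [NormedSpace ℝ V]
    [FiniteDimensional ℝ V] [MeasurableSpace V] [BorelSpace V] [NormedAddCommGroup E]
    (ν : Measure V) [ν.IsAddHaarMeasure] {f : V → E} (hf : MemLp f 2 ν) :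
    Tendsto (fun z => eLpNorm (fun x => f (x + z) - f x) 2 ν) (𝓝 0) (𝓝 0) := by
  have : ProperSpace V := FiniteDimensional.proper_real V
  -- The translations form a continuous family of continuous measure preserving maps; composition
  -- with such a family is continuous in `L²`.
  let g : C(V, C(V, V)) := (ContinuousMap.mk (fun p : V × V => p.2 + p.1) (by fun_prop)).curry
  have hmp : ∀ z, MeasurePreserving (g z) ν ν := fun z => measurePreserving_add_right ν z
  have hcont : Continuous fun z => Lp.compMeasurePreserving (g z) (hmp z) (hf.toLp f) :=
    continuous_const.compMeasurePreservingLp g.continuous hmp (by simp)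
  have h0 : Lp.compMeasurePreserving (g 0) (hmp 0) (hf.toLp f) = hf.toLp f := by
    rw [Lp.toLp_compMeasurePreserving hf (hmp 0)]
    congr 1; ext x
    simp [g]
  have h1 := (hcont.tendsto 0).sub_const (hf.toLp f)
  rw [h0, sub_self] at h1
  have h2 := h1.enorm
  rw [enorm_zero] at h2
  refine h2.congr fun z => ?_
  rw [Lp.toLp_compMeasurePreserving hf (hmp z), ← MemLp.toLp_sub, Lp.enorm_toLp]
  rfl

theorem memLp_translate {V E : Type*} [NormedAddCommGroup V]
    [MeasurableSpace V] [BorelSpace V] [SecondCountableTopology V] [NormedAddCommGroup E]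
    {ν : Measure V} [ν.IsAddRightInvariant] {f : V → E} (hf : MemLp f 2 ν) (z : V) :
    MemLp (fun x => f (x + z)) 2 ν :=
  hf.comp_measurePreserving (measurePreserving_add_right ν z)

theorem abs_integral_mul_le {α : Type*} [MeasurableSpace α] {ν : Measure α} {f g : α → ℝ}
    (hf : MemLp f 2 ν) (hg : MemLp g 2 ν) :
    |∫ x, f x * g x ∂ν| ≤ (eLpNorm f 2 ν).toReal * (eLpNorm g 2 ν).toReal := by
  have h1 : inner ℝ (hf.toLp f) (hg.toLp g) = ∫ x, f x * g x ∂ν := by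
    rw [L2.inner_def]
    apply integral_congr_ae
    filter_upwards [hf.coeFn_toLp, hg.coeFn_toLp] with x h1 h2
    rw [h1, h2]; simp [mul_comm]
  rw [← h1, ← Lp.norm_toLp f hf, ← Lp.norm_toLp g hg]
  exact abs_real_inner_le_norm _ _

theorem integrable_mul_of_memLp_two {α : Type*} [MeasurableSpace α] {ν : Measure α} {f g : α → ℝ}
    (hf : MemLp f 2 ν) (hg : MemLp g 2 ν) : Integrable (fun x => f x * g x) ν :=
  hf.integrable_mul hg

theorem memLp_mul_of_bounded {α : Type*} [MeasurableSpace α] {ν : Measure α} {f g : α → ℝ}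
    {p : ℝ≥0∞} (hf : MemLp f p ν) (hg : AEStronglyMeasurable g ν) {C : ℝ}
    (hC : ∀ᵐ x ∂ν, ‖g x‖ ≤ C) : MemLp (fun x => f x * g x) p ν := by
  refine hf.of_le_mul (c := C) (hf.1.mul hg) ?_
  filter_upwards [hC] with x hx
  rw [norm_mul, mul_comm]
  gcongr

theorem eLpNorm_translate {V E : Type*} [NormedAddCommGroup V]
    [MeasurableSpace V] [BorelSpace V] [SecondCountableTopology V] [NormedAddCommGroup E]
    {ν : Measure V} [ν.IsAddRightInvariant] {f : V → E} (hf : MemLp f 2 ν) (z : V) :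
    eLpNorm (fun x => f (x + z)) 2 ν = eLpNorm f 2 ν :=
  eLpNorm_comp_measurePreserving hf.1 (measurePreserving_add_right ν z)

theorem integrable_integral_translate_mul {g w : Plane → ℝ} (hg : MemLp g 2) (hw : MemLp w 2)
    (ig : Integrable g) (e : Plane) (s : ℝ) :
    Integrable (fun r : ℝ => ∫ x, g (x + r • e) * w x) (volume.restrict (Ioc 0 s)) := by
  have hm : AEStronglyMeasurable (fun p : Plane × ℝ => g (p.1 + p.2 • e) * w p.1)
      ((volume : Measure Plane).prod (volume.restrict (Ioc 0 s))) :=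
    (integrable_translate_prod ig e s).1.mul hw.1.comp_fst
  refine Integrable.mono' (g := fun _ => (eLpNorm g 2 volume).toReal *
    (eLpNorm w 2 volume).toReal) (integrable_const _) hm.prod_swap.integral_prod_right' ?_
  refine Eventually.of_forall fun r => ?_
  have := abs_integral_mul_le (memLp_translate hg (r • e)) hw
  rwa [eLpNorm_translate hg] at this

theorem integrable_mul_mul_of_bounded {F G φ : Plane → ℝ} (hF : MemLp F 2) (hG : MemLp G 2)
    (hφ : Continuous φ) {C : ℝ} (hC : ∀ x, ‖φ x‖ ≤ C) :
    Integrable fun x => F x * G x * φ x :=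
  (hF.integrable_mul hG).mul_bdd hφ.aestronglyMeasurable (Eventually.of_forall hC)

/-- The two factors are shifted independently, as the discrete product rule requires. The difference
splits into one increment at a time, and Cauchy–Schwarz with continuity of translation handles each.
-/
theorem tendsto_integral_translate_mul {F G φ : Plane → ℝ} (hF : MemLp F 2) (hG : MemLp G 2)
    (hφ : Continuous φ) (hc : HasCompactSupport φ) :
    Tendsto (fun q : Plane × Plane => ∫ x, F (x + q.1) * G (x + q.2) * φ x) (𝓝 0)
      (𝓝 (∫ x, F x * G x * φ x)) := by
  obtain ⟨C, hC⟩ := hc.exists_bound_of_continuous hφ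
  have hGφ : ∀ z, MemLp (fun x => G (x + z) * φ x) 2 := fun z =>
    memLp_mul_of_bounded (memLp_translate hG z) hφ.aestronglyMeasurable (Eventually.of_forall hC)
  have hFφ : MemLp (fun x => F x * φ x) 2 :=
    memLp_mul_of_bounded hF hφ.aestronglyMeasurable (Eventually.of_forall hC)
  have hd1 : ∀ z, MemLp (fun x => F (x + z) - F x) 2 := fun z => (memLp_translate hF z).sub hF
  have hd2 : ∀ z, MemLp (fun x => G (x + z) - G x) 2 := fun z => (memLp_translate hG z).sub hG
  have hb : ∀ z, (eLpNorm (fun x => G (x + z) * φ x) 2 volume).toReal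
      ≤ |C| * (eLpNorm G 2 volume).toReal := by
    intro z
    have h1 : eLpNorm (fun x => G (x + z) * φ x) 2 volume
        ≤ ENNReal.ofReal |C| * eLpNorm (fun x => G (x + z)) 2 volume := by
      apply eLpNorm_le_mul_eLpNorm_of_ae_le_mul
      refine Eventually.of_forall fun x => ?_
      rw [norm_mul, mul_comm]
      gcongr
      exact (hC x).trans (le_abs_self C)
    have h2 : eLpNorm (fun x => G (x + z)) 2 volume = eLpNorm G 2 volume :=
      eLpNorm_comp_measurePreserving hG.1 (measurePreserving_add_right volume z)
    rw [h2] at h1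
    have := ENNReal.toReal_mono (ENNReal.mul_ne_top ENNReal.ofReal_ne_top hG.2.ne) h1
    rwa [ENNReal.toReal_mul, ENNReal.toReal_ofReal (abs_nonneg C)] at this
  have t1 : Tendsto (fun z => (eLpNorm (fun x => F (x + z) - F x) 2 volume).toReal) (𝓝 0) (𝓝 0) :=
    (ENNReal.tendsto_toReal (by simp)).comp (tendsto_eLpNorm_translate_sub volume hF)
  have t2 : Tendsto (fun z => (eLpNorm (fun x => G (x + z) - G x) 2 volume).toReal) (𝓝 0) (𝓝 0) :=
    (ENNReal.tendsto_toReal (by simp)).comp (tendsto_eLpNorm_translate_sub volume hG)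
  rw [tendsto_iff_norm_sub_tendsto_zero]
  have key : ∀ q : Plane × Plane,
      ‖(∫ x, F (x + q.1) * G (x + q.2) * φ x) - ∫ x, F x * G x * φ x‖
      ≤ (eLpNorm (fun x => F (x + q.1) - F x) 2 volume).toReal
          * (|C| * (eLpNorm G 2 volume).toReal)
        + (eLpNorm (fun x => G (x + q.2) - G x) 2 volume).toReal
          * (eLpNorm (fun x => F x * φ x) 2 volume).toReal := by
    intro q
    have e1 : (∫ x, F (x + q.1) * G (x + q.2) * φ x) - (∫ x, F x * G x * φ x)
        = (∫ x, (F (x + q.1) - F x) * (G (x + q.2) * φ x))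
          + ∫ x, (G (x + q.2) - G x) * (F x * φ x) := by
      rw [← integral_sub (integrable_mul_mul_of_bounded (memLp_translate hF _)
        (memLp_translate hG _) hφ hC) (integrable_mul_mul_of_bounded hF hG hφ hC),
        ← integral_add (integrable_mul_of_memLp_two (hd1 _) (hGφ _))
          (integrable_mul_of_memLp_two (hd2 _) hFφ)]
      congr 1; ext x; ring
    rw [e1, Real.norm_eq_abs]
    refine (abs_add_le _ _).trans (add_le_add ?_ (abs_integral_mul_le (hd2 _) hFφ))
    exact (abs_integral_mul_le (hd1 _) (hGφ _)).trans
      (mul_le_mul_of_nonneg_left (hb _) ENNReal.toReal_nonneg)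
  refine squeeze_zero (fun _ => norm_nonneg _) key ?_
  have s1 := (t1.comp (continuous_fst.tendsto (0 : Plane × Plane))).mul_const
    (|C| * (eLpNorm G 2 volume).toReal)
  have s2 := (t2.comp (continuous_snd.tendsto (0 : Plane × Plane))).mul_const
    ((eLpNorm (fun x => F x * φ x) 2 volume).toReal)
  simpa using s1.add s2

/-- The pointwise identity along segments, integrated against `w` and combined with Fubini; square
integrability of `G` and `w` makes the double integral absolutely convergent. -/
theorem HasWeakDeriv.integral_translate_sub_mul {e : Plane} {F G : Plane → ℝ}
    (h : HasWeakDeriv univ e F G) (hF : Integrable F) (hG : Integrable G) (hG2 : MemLp G 2)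
    {w : Plane → ℝ} (hw : MemLp w 2) {s : ℝ} (hs : 0 ≤ s) :
    (∫ x, (F (x + s • e) - F x) * w x) = ∫ r in (0 : ℝ)..s, ∫ x, G (x + r • e) * w x := by
  have h1 := h.sub_eq_integral hF hG isOpen_univ hs (fun _ _ _ _ => mem_univ _)
  have h2 : (∫ x, (F (x + s • e) - F x) * w x)
      = ∫ x, (∫ r in (0 : ℝ)..s, G (x + r • e)) * w x := by
    apply integral_congr_ae
    filter_upwards [h1] with x hx
    rw [hx (mem_univ x)]
  rw [h2]
  simp only [intervalIntegral.integral_of_le hs, ← integral_mul_const]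
  rw [integral_integral_swap]
  have hm : AEStronglyMeasurable (fun p : Plane × ℝ => G (p.1 + p.2 • e) * w p.1)
      ((volume : Measure Plane).prod (volume.restrict (Ioc 0 s))) :=
    (integrable_translate_prod hG e s).1.mul hw.1.comp_fst
  refine (integrable_prod_iff' hm).2 ⟨Eventually.of_forall fun r =>
    integrable_mul_of_memLp_two (memLp_translate hG2 (r • e)) hw, ?_⟩
  refine Integrable.mono' (g := fun _ => (eLpNorm G 2 volume).toReal *
    (eLpNorm w 2 volume).toReal) (integrable_const _) ?_ ?_
  · exact hm.norm.prod_swap.integral_prod_right'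
  · refine Eventually.of_forall fun r => ?_
    rw [Real.norm_of_nonneg (integral_nonneg fun _ => norm_nonneg _)]
    simp only [norm_mul]
    have := abs_integral_mul_le (memLp_translate hG2 (r • e)).norm hw.norm
    rw [eLpNorm_norm, eLpNorm_norm, eLpNorm_translate hG2] at this
    exact (le_abs_self _).trans this

/-- The product rule on the whole plane. -/
theorem HasWeakDeriv.mul_univ {e : Plane} {F G F' G' : Plane → ℝ}
    (h : HasWeakDeriv univ e F G) (h' : HasWeakDeriv univ e F' G')
    (hF : MemLp F 2) (hG : MemLp G 2) (hF' : MemLp F' 2) (hG' : MemLp G' 2)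
    (iF : Integrable F) (iG : Integrable G) (iF' : Integrable F') (iG' : Integrable G') :
    HasWeakDeriv univ e (fun x => F x * F' x) (fun x => G x * F' x + F x * G' x) := by
  intro φ h1 h2 _
  obtain ⟨C, hC⟩ := h2.exists_bound_of_continuous h1.continuous
  have hφm := h1.continuous.aestronglyMeasurable (μ := (volume : Measure Plane))
  have hFF : Integrable (fun x => F x * F' x) := hF.integrable_mul hF'
  -- The function `A` is differentiated at `0` in two ways. Moving the test function gives the left
  -- side of the product rule; moving `F` and `F'` gives the right side. No mollification is needed.
  set A : ℝ → ℝ := fun s => ∫ x, (F x * F' x) * φ (x - s • e) with hA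
  have hder : HasDerivAt A (-∫ x, (F x * F' x) * fderiv ℝ φ x e) 0 := by
    simpa using hasDerivAt_integral_mul_translate hFF.locallyIntegrable h1 h2 e 0
  -- The first parameter is the integration variable along the segment, the second is the full step
  -- by which the other factor has been shifted. Only continuity at the origin matters.
  set B : ℝ × ℝ → ℝ := fun q => (∫ x, G (x + q.1 • e) * F' (x + q.2 • e) * φ x)
    + ∫ x, G' (x + q.1 • e) * F x * φ x with hB
  set b : ℝ := (∫ x, G x * F' x * φ x) + ∫ x, G' x * F x * φ x with hb
  have hBt : Tendsto B (𝓝 0) (𝓝 b) := by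
    have c1 : Tendsto (fun q : ℝ × ℝ => (q.1 • e, q.2 • e)) (𝓝 0) (𝓝 (0 : Plane × Plane)) := by
      have : Continuous (fun q : ℝ × ℝ => (q.1 • e, q.2 • e)) := by fun_prop
      exact this.tendsto' _ _ (by simp)
    have c2 : Tendsto (fun q : ℝ × ℝ => (q.1 • e, (0 : Plane))) (𝓝 0) (𝓝 (0 : Plane × Plane)) := by
      have : Continuous (fun q : ℝ × ℝ => (q.1 • e, (0 : Plane))) := by fun_prop
      exact this.tendsto' _ _ (by simp)
    have d1 := (tendsto_integral_translate_mul hG hF' h1.continuous h2).comp c1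
    have d2 := (tendsto_integral_translate_mul hG' hF h1.continuous h2).comp c2
    have := d1.add d2
    simpa [Function.comp_def] using this
  have hinc : ∀ s, 0 ≤ s → IntervalIntegrable (fun r => B (r, s)) volume 0 s ∧
      A s - A 0 = ∫ r in (0 : ℝ)..s, B (r, s) := by
    intro s hs
    have hw1 : MemLp (fun x => F' (x + s • e) * φ x) 2 :=
      memLp_mul_of_bounded (memLp_translate hF' _) hφm (Eventually.of_forall hC)
    have hw2 : MemLp (fun x => F x * φ x) 2 :=
      memLp_mul_of_bounded hF hφm (Eventually.of_forall hC)
    have e1 := h.integral_translate_sub_mul iF iG hG hw1 hs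
    have e2 := h'.integral_translate_sub_mul iF' iG' hG' hw2 hs
    have e3 : A s = ∫ x, F (x + s • e) * F' (x + s • e) * φ x := by
      rw [hA]; simp only
      rw [← integral_add_right_eq_self _ (s • e)]; simp
    have e4 : A 0 = ∫ x, F x * F' x * φ x := by simp [hA]
    -- Discrete product rule: the increment of `F` meets the shifted `F'`, the increment of `F'`
    -- meets the unshifted `F`.
    have e5 : A s - A 0 = (∫ x, (F (x + s • e) - F x) * (F' (x + s • e) * φ x))
        + ∫ x, (F' (x + s • e) - F' x) * (F x * φ x) := by
      rw [e3, e4, ← integral_sub (integrable_mul_mul_of_bounded (memLp_translate hF _)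
        (memLp_translate hF' _) h1.continuous hC)
        (integrable_mul_mul_of_bounded hF hF' h1.continuous hC),
        ← integral_add (integrable_mul_of_memLp_two (f := fun x => F (x + s • e) - F x)
            ((memLp_translate hF _).sub hF) hw1)
          (integrable_mul_of_memLp_two (f := fun x => F' (x + s • e) - F' x)
            ((memLp_translate hF' _).sub hF') hw2)]
      congr 1; ext x; ring
    have j1 := integrable_integral_translate_mul hG hw1 iG e s
    have j2 := integrable_integral_translate_mul hG' hw2 iG' e s
    rw [← IntegrableOn, ← intervalIntegrable_iff_integrableOn_Ioc_of_le hs] at j1 j2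
    refine ⟨?_, ?_⟩
    · simpa only [hB, mul_assoc] using j1.add j2
    · rw [e5, e1, e2, ← intervalIntegral.integral_add j1 j2]
      simp only [hB, mul_assoc]
  have hlim : Tendsto (fun s => s⁻¹ * (A s - A 0)) (𝓝[>] 0) (𝓝 b) := by
    rw [Metric.tendsto_nhds]
    intro η hη
    rw [Metric.tendsto_nhds_nhds] at hBt
    obtain ⟨δ, hδ, hBδ⟩ := hBt (η / 2) (by positivity)
    filter_upwards [Ioo_mem_nhdsGT hδ] with s hs
    have hs0 : 0 < s := hs.1
    have : ‖∫ r in (0 : ℝ)..s, (B (r, s) - b)‖ ≤ η / 2 * |s - 0| := by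
      apply intervalIntegral.norm_integral_le_of_norm_le_const
      intro r hr
      rw [uIoc_of_le hs0.le] at hr
      have : dist (r, s) (0 : ℝ × ℝ) < δ := by
        simp only [Prod.dist_eq, Prod.fst_zero, Prod.snd_zero, Real.dist_eq, sub_zero]
        rw [abs_of_pos hr.1, abs_of_pos hs0]
        exact max_lt (hr.2.trans_lt hs.2) hs.2
      exact (hBδ this).le
    obtain ⟨hii, hAB⟩ := hinc s hs0.le
    rw [intervalIntegral.integral_sub hii (by simp), ← hAB] at this
    rw [intervalIntegral.integral_const, sub_zero, smul_eq_mul] at this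
    rw [Real.dist_eq]
    have e : s⁻¹ * (A s - A 0) - b = s⁻¹ * ((A s - A 0) - s * b) := by field_simp
    rw [e, abs_mul, abs_of_pos (inv_pos.2 hs0)]
    rw [Real.norm_eq_abs, abs_of_pos hs0] at this
    calc s⁻¹ * |A s - A 0 - s * b| ≤ s⁻¹ * (η / 2 * s) := by gcongr
      _ = η / 2 := by field_simp
      _ < η := by linarith
  have hlim2 : Tendsto (fun s => s⁻¹ * (A s - A 0)) (𝓝[>] 0)
      (𝓝 (-∫ x, (F x * F' x) * fderiv ℝ φ x e)) := by
    have := hder.hasDerivWithinAt (s := Ioi 0)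
    rw [hasDerivWithinAt_iff_tendsto_slope' (by simp)] at this
    refine this.congr fun s => ?_
    simp [slope_def_field, div_eq_inv_mul]
  have := tendsto_nhds_unique hlim2 hlim
  have e : (∫ x, (G x * F' x + F x * G' x) * φ x) = b := by
    rw [hb, ← integral_add (integrable_mul_mul_of_bounded hG hF' h1.continuous hC)
      (integrable_mul_mul_of_bounded hG' hF h1.continuous hC)]
    congr 1; ext x; ring
  rw [e]; linarith

/-- The product rule on an open set. -/
theorem HasWeakDeriv.mul {O : Set Plane} {e : Plane} {F G F' G' : Plane → ℝ}
    (h : HasWeakDeriv O e F G) (h' : HasWeakDeriv O e F' G') (hO : IsOpen O)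
    (hF : ∀ K, IsCompact K → MemLp F 2 (volume.restrict K))
    (hG : ∀ K, IsCompact K → MemLp G 2 (volume.restrict K))
    (hF' : ∀ K, IsCompact K → MemLp F' 2 (volume.restrict K))
    (hG' : ∀ K, IsCompact K → MemLp G' 2 (volume.restrict K)) :
    HasWeakDeriv O e (fun x => F x * F' x) (fun x => G x * F' x + F x * G' x) := by
  intro φ h1 h2 h3
  -- The cutoff equals `1` on a neighbourhood of the support of `φ`, not just on the support, so
  -- that its derivative vanishes there too and drops out at the end.
  obtain ⟨κ, hκ1, hκ2, hκ3, hκ4⟩ : ∃ κ : Plane → ℝ, ContDiff ℝ ∞ κ ∧ HasCompactSupport κ ∧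
      tsupport κ ⊆ O ∧ ∃ N, IsOpen N ∧ tsupport φ ⊆ N ∧ ∀ x ∈ N, κ x = 1 := by
    obtain ⟨K, hK, hφK, hKO⟩ := exists_compact_between h2 hO h3
    obtain ⟨K', hK', hKK', hKO'⟩ := exists_compact_between hK hO hKO
    obtain ⟨κ, hκ1, -, hκ3, hκ4⟩ := exists_contMDiff_support_eq_eq_one_iff (n := (⊤ : ℕ∞))
      (modelWithCornersSelf ℝ Plane) isOpen_interior hK.isClosed hKK'
    have hsub : tsupport κ ⊆ K' := by
      rw [tsupport, hκ3]
      exact closure_minimal interior_subset hK'.isClosed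
    exact ⟨κ, hκ1.contDiff, hK'.of_isClosed_subset (isClosed_tsupport κ) hsub, hsub.trans hKO',
      interior K, isOpen_interior, hφK, fun x hx => (hκ4 x).1 (interior_subset hx)⟩
  obtain ⟨N, hN, hφN, hκN⟩ := hκ4
  have hloc : ∀ {F : Plane → ℝ}, (∀ K, IsCompact K → MemLp F 2 (volume.restrict K)) →
      LocallyIntegrable F := by
    intro F hF
    rw [locallyIntegrable_iff]
    intro K hK
    have : IsFiniteMeasure (volume.restrict K) := ⟨by simpa using hK.measure_lt_top⟩
    exact (hF K hK).integrable (by norm_num)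
  obtain ⟨C, hC⟩ := hκ2.exists_bound_of_continuous hκ1.continuous
  have hmul : ∀ {F θ : Plane → ℝ}, (∀ K, IsCompact K → MemLp F 2 (volume.restrict K)) →
      Continuous θ → HasCompactSupport θ → MemLp (fun x => F x * θ x) 2 := by
    intro F θ hF hθ hc
    obtain ⟨C, hC⟩ := hc.exists_bound_of_continuous hθ
    have h1 : MemLp (fun x => F x * θ x) 2 (volume.restrict (tsupport θ)) :=
      memLp_mul_of_bounded (hF _ hc) hθ.aestronglyMeasurable (Eventually.of_forall hC)
    rw [← memLp_indicator_iff_restrict (isClosed_tsupport θ).measurableSet] at h1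
    convert h1 using 1
    ext x
    by_cases hx : x ∈ tsupport θ
    · simp [hx]
    · simp [hx, image_eq_zero_of_notMem_tsupport hx]
  have c1 := h.cutoff (hloc hF) (hloc hG) hκ1 hκ3
  have c2 := h'.cutoff (hloc hF') (hloc hG') hκ1 hκ3
  have hκd := continuous_fderiv_apply_of_smooth hκ1 e
  have hκdc := hasCompactSupport_fderiv_apply hκ2 e
  have key := c1.mul_univ c2 (hmul hF hκ1.continuous hκ2)
    ((hmul hG hκ1.continuous hκ2).add (hmul hF hκd hκdc)) (hmul hF' hκ1.continuous hκ2)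
    ((hmul hG' hκ1.continuous hκ2).add (hmul hF' hκd hκdc))
    (integrable_mul_of_hasCompactSupport (hloc hF) hκ1.continuous hκ2)
    ((integrable_mul_of_hasCompactSupport (hloc hG) hκ1.continuous hκ2).add
      (integrable_mul_of_hasCompactSupport (hloc hF) hκd hκdc))
    (integrable_mul_of_hasCompactSupport (hloc hF') hκ1.continuous hκ2)
    ((integrable_mul_of_hasCompactSupport (hloc hG') hκ1.continuous hκ2).add
      (integrable_mul_of_hasCompactSupport (hloc hF') hκd hκdc)) φ h1 h2 (subset_univ _)
  have hκ0 : ∀ x ∈ tsupport φ, κ x = 1 ∧ fderiv ℝ κ x e = 0 := by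
    intro x hx
    refine ⟨hκN x (hφN hx), ?_⟩
    have : κ =ᶠ[𝓝 x] fun _ => 1 := by
      filter_upwards [hN.mem_nhds (hφN hx)] with y hy using hκN y hy
    rw [this.fderiv_eq]; simp
  convert key using 1
  · congr 1; ext x
    by_cases hx : x ∈ tsupport φ
    · simp only [(hκ0 x hx).1]; ring
    · simp [fderiv_eq_zero_of_notMem_tsupport hx]
  · congr 2; ext x
    by_cases hx : x ∈ tsupport φ
    · simp only [(hκ0 x hx).1, (hκ0 x hx).2]; ring
    · simp [image_eq_zero_of_notMem_tsupport hx]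

/-! ### Local Sobolev embeddings from orthonormal frames -/

/-- Orthonormal coordinates are an isometry, so Lebesgue measure is a product measure in every frame
and Tonelli's theorem can be used along arbitrary perpendicular directions. -/
theorem measurePreserving_frame (b : OrthonormalBasis (Fin 2) ℝ Plane) :
    MeasurePreserving (fun p : ℝ × ℝ => p.1 • b 0 + p.2 • b 1) := by
  have h := (b.measurePreserving_repr_symm.comp
    (EuclideanSpace.volume_preserving_symm_measurableEquiv_toLp (Fin 2)).symm).comp
      (volume_preserving_finTwoArrow ℝ).symm
  convert! h using 1
  ext1 p
  simp only [Function.comp]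
  rw [← b.sum_repr (b.repr.symm _)]
  simp [MeasurableEquiv.finTwoArrow]

/-- Pointwise control of a function by its weak derivative along segments. -/
theorem HasWeakDeriv.enorm_le_lintegral {O W : Set Plane} {e : Plane} {F G : Plane → ℝ}
    (hd : HasWeakDeriv O e F G) (hF : Integrable F) (hG : Integrable G) (mF : Measurable F)
    (mG : Measurable G) (hW : IsOpen W) {h : ℝ} (hh : 0 < h)
    (hWO : ∀ x ∈ W, ∀ r ∈ Icc 0 h, x + r • e ∈ O) :
    ∀ᵐ x, x ∈ W → ‖F x‖ₑ ≤
      ∫⁻ s : ℝ, O.indicator (fun y => ENNReal.ofReal h⁻¹ * ‖F y‖ₑ + ‖G y‖ₑ) (x + s • e) := by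
  have mF' : Measurable fun p : Plane × ℝ => ‖F (p.1 + p.2 • e)‖ₑ :=
    (mF.comp (by fun_prop)).enorm
  have mG' : Measurable fun p : Plane × ℝ => ‖G (p.1 + p.2 • e)‖ₑ :=
    (mG.comp (by fun_prop)).enorm
  have mI : Measurable fun x : Plane => ∫⁻ r in Ioc 0 h, ‖G (x + r • e)‖ₑ :=
    mG'.lintegral_prod_right'
  have h1 : ∀ s ∈ Ioc 0 h, ∀ᵐ x, x ∈ W →
      ‖F x‖ₑ ≤ ‖F (x + s • e)‖ₑ + ∫⁻ r in Ioc 0 h, ‖G (x + r • e)‖ₑ := by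
    intro s hs
    filter_upwards [hd.sub_eq_integral hF hG hW hs.1.le
      (fun x hx r hr => hWO x hx r ⟨hr.1, hr.2.trans hs.2⟩)] with x hx hxW
    have e1 : F x = F (x + s • e) - ∫ r in (0 : ℝ)..s, G (x + r • e) := by
      rw [← hx hxW]; ring
    calc ‖F x‖ₑ = ‖F (x + s • e) - ∫ r in (0 : ℝ)..s, G (x + r • e)‖ₑ := by rw [← e1]
      _ ≤ ‖F (x + s • e)‖ₑ + ‖∫ r in (0 : ℝ)..s, G (x + r • e)‖ₑ := enorm_sub_le
      _ ≤ _ := by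
        gcongr
        rw [intervalIntegral.integral_of_le hs.1.le]
        refine (enorm_integral_le_lintegral_enorm _).trans ?_
        exact lintegral_mono_set (Ioc_subset_Ioc_right hs.2)
  -- The exceptional null set depends on `s`. Measurability of the set of good pairs allows
  -- exchanging the quantifiers, so that for almost every `x` one may average over `s`.
  have h2 : ∀ᵐ s : ℝ, ∀ᵐ x : Plane, s ∈ Ioc 0 h → x ∈ W →
      ‖F x‖ₑ ≤ ‖F (x + s • e)‖ₑ + ∫⁻ r in Ioc 0 h, ‖G (x + r • e)‖ₑ := by
    refine Eventually.of_forall fun s => ?_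
    by_cases hs : s ∈ Ioc 0 h
    · filter_upwards [h1 s hs] with x hx _ using hx
    · exact Eventually.of_forall fun x hs' => absurd hs' hs
  have hms : MeasurableSet {p : ℝ × Plane | p.1 ∈ Ioc 0 h → p.2 ∈ W →
      ‖F p.2‖ₑ ≤ ‖F (p.2 + p.1 • e)‖ₑ + ∫⁻ r in Ioc 0 h, ‖G (p.2 + r • e)‖ₑ} := by
    have m1 : MeasurableSet {p : ℝ × Plane | p.1 ∈ Ioc 0 h} := measurable_fst measurableSet_Ioc
    have m2 : MeasurableSet {p : ℝ × Plane | p.2 ∈ W} := measurable_snd hW.measurableSet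
    have m3 : MeasurableSet {p : ℝ × Plane |
        ‖F p.2‖ₑ ≤ ‖F (p.2 + p.1 • e)‖ₑ + ∫⁻ r in Ioc 0 h, ‖G (p.2 + r • e)‖ₑ} :=
      measurableSet_le (mF.comp measurable_snd).enorm
        ((mF'.comp measurable_swap).add (mI.comp measurable_snd))
    have : {p : ℝ × Plane | p.1 ∈ Ioc 0 h → p.2 ∈ W →
      ‖F p.2‖ₑ ≤ ‖F (p.2 + p.1 • e)‖ₑ + ∫⁻ r in Ioc 0 h, ‖G (p.2 + r • e)‖ₑ}
      = {p : ℝ × Plane | p.1 ∈ Ioc 0 h}ᶜ ∪ ({p : ℝ × Plane | p.2 ∈ W}ᶜ ∪ {p : ℝ × Plane |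
        ‖F p.2‖ₑ ≤ ‖F (p.2 + p.1 • e)‖ₑ + ∫⁻ r in Ioc 0 h, ‖G (p.2 + r • e)‖ₑ}) := by
      ext p; simp only [mem_ofPred_eq, mem_union, mem_compl_iff]; tauto
    rw [this]
    exact m1.compl.union (m2.compl.union m3)
  rw [Measure.ae_ae_comm hms] at h2
  filter_upwards [h2] with x hx hxW
  have mFx : Measurable fun s : ℝ => ‖F (x + s • e)‖ₑ := mF'.comp measurable_prodMk_left
  have hh0 : ENNReal.ofReal h ≠ 0 := by simpa using hh
  have hvol : (volume : Measure ℝ) (Ioc 0 h) = ENNReal.ofReal h := by simp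
  -- Averaging over `s ∈ (0, h]` turns the end point value of `F` into a line integral; this is the
  -- origin of the weight `h⁻¹`.
  have h3 : ENNReal.ofReal h * ‖F x‖ₑ ≤ (∫⁻ s in Ioc 0 h, ‖F (x + s • e)‖ₑ)
      + ENNReal.ofReal h * ∫⁻ r in Ioc 0 h, ‖G (x + r • e)‖ₑ := by
    calc ENNReal.ofReal h * ‖F x‖ₑ = ∫⁻ s in Ioc 0 h, ‖F x‖ₑ := by
          rw [setLIntegral_const, hvol, mul_comm]
      _ ≤ ∫⁻ s in Ioc 0 h, (‖F (x + s • e)‖ₑ + ∫⁻ r in Ioc 0 h, ‖G (x + r • e)‖ₑ) := by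
          apply lintegral_mono_ae
          rw [ae_restrict_iff' measurableSet_Ioc]
          filter_upwards [hx] with s hs hs' using hs hs' hxW
      _ = _ := by
          rw [lintegral_add_left mFx, setLIntegral_const, hvol, mul_comm]
  have h4 : ‖F x‖ₑ ≤ ENNReal.ofReal h⁻¹ * (∫⁻ s in Ioc 0 h, ‖F (x + s • e)‖ₑ)
      + ∫⁻ r in Ioc 0 h, ‖G (x + r • e)‖ₑ := by
    have e1 : ENNReal.ofReal h⁻¹ * ENNReal.ofReal h = 1 := by
      rw [← ENNReal.ofReal_mul (by positivity), inv_mul_cancel₀ hh.ne']; simp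
    calc ‖F x‖ₑ = ENNReal.ofReal h⁻¹ * (ENNReal.ofReal h * ‖F x‖ₑ) := by
          rw [← mul_assoc, e1, one_mul]
      _ ≤ ENNReal.ofReal h⁻¹ * ((∫⁻ s in Ioc 0 h, ‖F (x + s • e)‖ₑ)
          + ENNReal.ofReal h * ∫⁻ r in Ioc 0 h, ‖G (x + r • e)‖ₑ) := by gcongr
      _ = _ := by rw [mul_add, ← mul_assoc _ (ENNReal.ofReal h), e1, one_mul]
  refine h4.trans ?_
  rw [← lintegral_const_mul _ mFx, ← lintegral_add_left (mFx.const_mul _),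
    ← lintegral_indicator measurableSet_Ioc]
  apply lintegral_mono
  intro s
  by_cases hs : s ∈ Ioc 0 h
  · rw [indicator_of_mem hs]
    exact (indicator_of_mem (hWO x hxW s ⟨hs.1.le, hs.2⟩)
      (fun y => ENNReal.ofReal h⁻¹ * ‖F y‖ₑ + ‖G y‖ₑ)).ge
  · rw [indicator_of_notMem hs]; simp

/-- The local form of the embedding `W^{1,1} ⊂ L²` in the plane. -/
theorem lintegral_sq_le_of_frame {O W : Set Plane} (b : OrthonormalBasis (Fin 2) ℝ Plane)
    {F G₁ G₂ : Plane → ℝ} (hd₁ : HasWeakDeriv O (b 0) F G₁) (hd₂ : HasWeakDeriv O (b 1) F G₂)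
    (hF : Integrable F) (hG₁ : Integrable G₁) (hG₂ : Integrable G₂) (mF : Measurable F)
    (mG₁ : Measurable G₁) (mG₂ : Measurable G₂) (hO : IsOpen O) (hW : IsOpen W) {h : ℝ}
    (hh : 0 < h) (hWO : ∀ x ∈ W, ∀ r ∈ Icc 0 h, ∀ s ∈ Icc 0 h, x + r • b 0 + s • b 1 ∈ O) :
    ∫⁻ x in W, ‖F x‖ₑ ^ 2 ≤ (∫⁻ x in O, (ENNReal.ofReal h⁻¹ * ‖F x‖ₑ + ‖G₁ x‖ₑ)) *
      ∫⁻ x in O, (ENNReal.ofReal h⁻¹ * ‖F x‖ₑ + ‖G₂ x‖ₑ) := by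
  have h0 : (0 : ℝ) ∈ Icc 0 h := ⟨le_rfl, hh.le⟩
  set f₁ := O.indicator (fun y => ENNReal.ofReal h⁻¹ * ‖F y‖ₑ + ‖G₁ y‖ₑ) with hf₁
  set f₂ := O.indicator (fun y => ENNReal.ofReal h⁻¹ * ‖F y‖ₑ + ‖G₂ y‖ₑ) with hf₂
  have mf₁ : Measurable f₁ := ((mF.enorm.const_mul _).add mG₁.enorm).indicator hO.measurableSet
  have mf₂ : Measurable f₂ := ((mF.enorm.const_mul _).add mG₂.enorm).indicator hO.measurableSet
  have a1 := hd₁.enorm_le_lintegral hF hG₁ mF mG₁ hW hh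
    (fun x hx r hr => by simpa using hWO x hx r hr 0 h0)
  have a2 := hd₂.enorm_le_lintegral hF hG₂ mF mG₂ hW hh
    (fun x hx r hr => by simpa using hWO x hx 0 h0 r hr)
  have hM := measurePreserving_frame b
  set M : ℝ × ℝ → Plane := fun p => p.1 • b 0 + p.2 • b 1 with hMdef
  have mA₁ : Measurable fun x : Plane => ∫⁻ s : ℝ, f₁ (x + s • b 0) :=
    (mf₁.comp (show Measurable fun p : Plane × ℝ => p.1 + p.2 • b 0 by
      fun_prop)).lintegral_prod_right'
  have mA₂ : Measurable fun x : Plane => ∫⁻ s : ℝ, f₂ (x + s • b 1) :=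
    (mf₂.comp (show Measurable fun p : Plane × ℝ => p.1 + p.2 • b 1 by
      fun_prop)).lintegral_prod_right'
  -- The line integral in direction `b 0` depends only on the second coordinate, the one in
  -- direction `b 1` only on the first. Hence the integral of their product factorizes, as in the
  -- Gagliardo–Nirenberg argument.
  have c1 : ∀ p : ℝ × ℝ, ∫⁻ s : ℝ, f₁ (M p + s • b 0) = ∫⁻ s : ℝ, f₁ (M (s, p.2)) := by
    intro p
    rw [← lintegral_add_left_eq_self (fun s => f₁ (M (s, p.2))) p.1]
    congr 1; ext s; congr 1; simp only [hMdef]; module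
  have c2 : ∀ p : ℝ × ℝ, ∫⁻ s : ℝ, f₂ (M p + s • b 1) = ∫⁻ s : ℝ, f₂ (M (p.1, s)) := by
    intro p
    rw [← lintegral_add_left_eq_self (fun s => f₂ (M (p.1, s))) p.2]
    congr 1; ext s; congr 1; simp only [hMdef]; module
  have mB₁ : Measurable fun y : ℝ => ∫⁻ s : ℝ, f₁ (M (s, y)) :=
    (mf₁.comp hM.measurable).lintegral_prod_left'
  have mB₂ : Measurable fun y : ℝ => ∫⁻ s : ℝ, f₂ (M (y, s)) :=
    (mf₂.comp hM.measurable).lintegral_prod_right'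
  have t1 : ∫⁻ y : ℝ, ∫⁻ s : ℝ, f₁ (M (s, y)) = ∫⁻ x, f₁ x := by
    rw [← hM.lintegral_comp mf₁, Measure.volume_eq_prod,
      lintegral_prod_symm' (fun p => f₁ (M p)) (mf₁.comp hM.measurable)]
  have t2 : ∫⁻ y : ℝ, ∫⁻ s : ℝ, f₂ (M (y, s)) = ∫⁻ x, f₂ x := by
    rw [← hM.lintegral_comp mf₂, Measure.volume_eq_prod,
      lintegral_prod (fun p => f₂ (M p)) (mf₂.comp hM.measurable).aemeasurable]
  calc ∫⁻ x in W, ‖F x‖ₑ ^ 2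
      ≤ ∫⁻ x in W, (∫⁻ s : ℝ, f₁ (x + s • b 0)) * ∫⁻ s : ℝ, f₂ (x + s • b 1) := by
        apply lintegral_mono_ae
        rw [ae_restrict_iff' hW.measurableSet]
        filter_upwards [a1, a2] with x h1 h2 hx
        rw [sq]
        exact mul_le_mul' (h1 hx) (h2 hx)
    _ ≤ ∫⁻ x, (∫⁻ s : ℝ, f₁ (x + s • b 0)) * ∫⁻ s : ℝ, f₂ (x + s • b 1) :=
        setLIntegral_le_lintegral _ _
    _ = ∫⁻ p : ℝ × ℝ, (∫⁻ s : ℝ, f₁ (M (s, p.2))) * ∫⁻ s : ℝ, f₂ (M (p.1, s)) := by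
        have := hM.lintegral_comp (mA₁.mul mA₂)
        simp only [Pi.mul_apply] at this
        rw [← this]
        simp only [c1, c2]
    _ = ∫⁻ x : ℝ, ∫⁻ y : ℝ, (∫⁻ s : ℝ, f₁ (M (s, y))) * ∫⁻ s : ℝ, f₂ (M (x, s)) := by
        rw [Measure.volume_eq_prod, lintegral_prod]
        exact ((mB₁.comp measurable_snd).mul (mB₂.comp measurable_fst)).aemeasurable
    _ = (∫⁻ x, f₁ x) * ∫⁻ x, f₂ x := by
        simp only [lintegral_mul_const _ mB₁]
        rw [lintegral_const_mul _ mB₂, t1, t2]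
    _ = _ := by
        rw [hf₁, hf₂, lintegral_indicator hO.measurableSet, lintegral_indicator hO.measurableSet]

/-- The local form of the embedding `W^{2,1} ⊂ L^∞` in the plane. -/
theorem enorm_le_lintegral_of_frame {O W : Set Plane} (b : OrthonormalBasis (Fin 2) ℝ Plane)
    {F G₁ G₂ G₁₂ : Plane → ℝ} (hd₁ : HasWeakDeriv O (b 0) F G₁)
    (hd₂ : HasWeakDeriv O (b 1) F G₂) (hd₁₂ : HasWeakDeriv O (b 1) G₁ G₁₂)
    (hF : Integrable F) (hG₁ : Integrable G₁) (hG₂ : Integrable G₂) (hG₁₂ : Integrable G₁₂)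
    (mF : Measurable F) (mG₁ : Measurable G₁) (mG₂ : Measurable G₂) (mG₁₂ : Measurable G₁₂)
    (hO : IsOpen O) (hW : IsOpen W) {h : ℝ}
    (hh : 0 < h) (hWO : ∀ x ∈ W, ∀ r ∈ Icc 0 h, ∀ s ∈ Icc 0 h, x + r • b 0 + s • b 1 ∈ O) :
    ∀ᵐ x, x ∈ W → ‖F x‖ₑ ≤ ∫⁻ x in O, (ENNReal.ofReal h⁻¹ *
      (ENNReal.ofReal h⁻¹ * ‖F x‖ₑ + ‖G₂ x‖ₑ) + (ENNReal.ofReal h⁻¹ * ‖G₁ x‖ₑ + ‖G₁₂ x‖ₑ)) := by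
  have h0 : (0 : ℝ) ∈ Icc 0 h := ⟨le_rfl, hh.le⟩
  set c := ENNReal.ofReal h⁻¹ with hc
  -- `W₁` is `W` swept along `b 0`. The bound along `b 0` is used on `W`; the bounds for `F` and its
  -- first derivative along `b 1` are then used on `W₁`.
  set W₁ : Set Plane := ⋃ r ∈ Icc 0 h, (fun y => y - r • b 0) ⁻¹' W with hW₁
  have oW₁ : IsOpen W₁ := isOpen_biUnion fun r _ => hW.preimage (by fun_prop)
  have memW₁ : ∀ x ∈ W, ∀ r ∈ Icc 0 h, x + r • b 0 ∈ W₁ := by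
    intro x hx r hr
    simp only [hW₁, mem_iUnion]
    exact ⟨r, hr, by simpa using hx⟩
  have hW₁O' : ∀ x ∈ W₁, ∀ s ∈ Icc 0 h, x + s • b 1 ∈ O := by
    intro x hx s hs
    simp only [hW₁, mem_iUnion] at hx
    obtain ⟨r, hr, hx⟩ := hx
    simpa using hWO _ hx r hr s hs
  have hW₁O : W₁ ⊆ O := fun x hx => by simpa using hW₁O' x hx 0 h0
  have a0 := (hd₁.mono hW₁O).enorm_le_lintegral hF hG₁ mF mG₁ hW hh memW₁
  have a1 := hd₂.enorm_le_lintegral hF hG₂ mF mG₂ oW₁ hh hW₁O'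
  have a2 := hd₁₂.enorm_le_lintegral hG₁ hG₁₂ mG₁ mG₁₂ oW₁ hh hW₁O'
  set f₂ := O.indicator (fun y => c * ‖F y‖ₑ + ‖G₂ y‖ₑ) with hf₂
  set f₁₂ := O.indicator (fun y => c * ‖G₁ y‖ₑ + ‖G₁₂ y‖ₑ) with hf₁₂
  have mf₂ : Measurable f₂ := ((mF.enorm.const_mul _).add mG₂.enorm).indicator hO.measurableSet
  have mf₁₂ : Measurable f₁₂ :=
    ((mG₁.enorm.const_mul _).add mG₁₂.enorm).indicator hO.measurableSet
  set g : Plane → ℝ≥0∞ := fun y => c * f₂ y + f₁₂ y with hg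
  have mg : Measurable g := (mf₂.const_mul _).add mf₁₂
  set k : Plane → ℝ≥0∞ := W₁.indicator (fun y => c * ‖F y‖ₑ + ‖G₁ y‖ₑ) with hk
  have mk : Measurable k := ((mF.enorm.const_mul _).add mG₁.enorm).indicator oW₁.measurableSet
  have mt : Measurable fun p : Plane × ℝ => p.1 + p.2 • b 1 := by fun_prop
  have mgi : Measurable fun y : Plane => ∫⁻ t : ℝ, g (y + t • b 1) :=
    (mg.comp mt).lintegral_prod_right'
  have a3 : ∀ᵐ y, k y ≤ ∫⁻ t : ℝ, g (y + t • b 1) := by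
    filter_upwards [a1, a2] with y h1 h2
    by_cases hy : y ∈ W₁
    · have m1 : Measurable fun t : ℝ => f₂ (y + t • b 1) := mf₂.comp (by fun_prop)
      simp only [hk, hg]
      rw [indicator_of_mem hy, lintegral_add_left (m1.const_mul c), lintegral_const_mul _ m1]
      gcongr
      · exact h1 hy
      · exact h2 hy
    · simp [hk, hy]
  -- The almost everywhere bound on the plane is transferred to almost every point of almost every
  -- line, by translation invariance and an exchange of quantifiers.
  have a4 : ∀ᵐ x : Plane, ∀ᵐ s : ℝ, k (x + s • b 0) ≤ ∫⁻ t : ℝ, g (x + s • b 0 + t • b 1) := by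
    have m0 : Measurable fun p : ℝ × Plane => p.2 + p.1 • b 0 := by fun_prop
    have mS : MeasurableSet {p : ℝ × Plane |
        k (p.2 + p.1 • b 0) ≤ ∫⁻ t : ℝ, g (p.2 + p.1 • b 0 + t • b 1)} :=
      measurableSet_le (mk.comp m0) (mgi.comp m0)
    refine (Measure.ae_ae_comm mS).1 ?_
    exact Eventually.of_forall fun s =>
      (measurePreserving_add_right volume (s • b 0)).quasiMeasurePreserving.ae a3
  have hM := measurePreserving_frame b
  have hfin : ∀ x : Plane, ∫⁻ s : ℝ, ∫⁻ t : ℝ, g (x + s • b 0 + t • b 1) = ∫⁻ y, g y := by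
    intro x
    have mx : Measurable fun y => g (x + y) := mg.comp (measurable_const_add x)
    rw [← lintegral_add_left_eq_self g x, ← hM.lintegral_comp mx,
      Measure.volume_eq_prod, lintegral_prod]
    · simp only [add_assoc]
    · exact (mx.comp hM.measurable).aemeasurable
  filter_upwards [a0, a4] with x h1 h2 hx
  refine (h1 hx).trans ((lintegral_mono_ae h2).trans ?_)
  rw [hfin, ← lintegral_indicator hO.measurableSet]
  apply lintegral_mono
  intro y
  by_cases hy : y ∈ O <;> simp [hg, hf₂, hf₁₂, hy]

/-- A quantitative cone condition: `O` is covered by finitely many open sets, on each of which one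
can move along the parallelepiped spanned by an orthonormal frame without leaving `O`. -/
def HasFrames (O : Set Plane) : Prop :=
  ∃ h : ℝ, 0 < h ∧ ∃ (ι : Type) (_ : Fintype ι) (W : ι → Set Plane)
    (b : ι → OrthonormalBasis (Fin 2) ℝ Plane), (∀ k, IsOpen (W k)) ∧ O ⊆ ⋃ k, W k ∧
      ∀ k, ∀ x ∈ W k, ∀ r ∈ Icc 0 h, ∀ s ∈ Icc 0 h, x + r • b k 0 + s • b k 1 ∈ O

theorem exists_orthonormalBasis_of_inner_eq_zero {v w : Plane} (hv : ‖v‖ = 1) (hw : ‖w‖ = 1)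
    (hvw : inner ℝ v w = 0) : ∃ b : OrthonormalBasis (Fin 2) ℝ Plane, b 0 = v ∧ b 1 = w := by
  have ho : Orthonormal ℝ ![v, w] := by
    rw [orthonormal_iff_ite]
    intro i j
    fin_cases i <;> fin_cases j <;>
      simp [hvw, hv, hw]
    rw [real_inner_comm, hvw]
  let B := basisOfOrthonormalOfCardEqFinrank ho (by simp)
  have hB : ⇑B = ![v, w] := coe_basisOfOrthonormalOfCardEqFinrank ho (by simp)
  refine ⟨B.toOrthonormalBasis (by rw [hB]; exact ho), ?_, ?_⟩ <;> simp [hB]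

/-- The negative gradient direction, rotated by 45 degrees either way, gives two perpendicular unit
vectors along both of which the functional decreases. -/
theorem exists_descent_frame {L : Plane →L[ℝ] ℝ} (hL : L ≠ 0) :
    ∃ b : OrthonormalBasis (Fin 2) ℝ Plane, L (b 0) < 0 ∧ L (b 1) < 0 := by
  set a := L (EuclideanSpace.single 0 1) with ha
  set c := L (EuclideanSpace.single 1 1) with hc
  have hLx : ∀ x y : ℝ, L !₂[x, y] = x * a + y * c := by
    intro x y
    have : (!₂[x, y] : Plane) = x • EuclideanSpace.single 0 1 + y • EuclideanSpace.single 1 1 := by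
      ext i; fin_cases i <;> simp
    rw [this, map_add, map_smul, map_smul]; simp [ha, hc]
  have hpos : 0 < a ^ 2 + c ^ 2 := by
    by_contra hcon
    have h1 : a = 0 := by nlinarith [sq_nonneg a, sq_nonneg c]
    have h2 : c = 0 := by nlinarith [sq_nonneg a, sq_nonneg c]
    apply hL
    ext x
    have hx : x = !₂[x 0, x 1] := by ext i; fin_cases i <;> simp
    rw [hx, hLx, h1, h2]; simp
  set N := Real.sqrt (2 * (a ^ 2 + c ^ 2)) with hN
  have hN0 : 0 < N := Real.sqrt_pos.2 (by positivity)
  have hN2 : N ^ 2 = 2 * (a ^ 2 + c ^ 2) := Real.sq_sqrt (by positivity)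
  -- With `(a, c)` the coefficients of `L`, these are `-(a, c)` rotated by ±45 degrees; the rotation
  -- contributes the factor `2` under the root in `N`.
  obtain ⟨b, h0, h1⟩ := exists_orthonormalBasis_of_inner_eq_zero
    (v := !₂[-(a - c) / N, -(c + a) / N]) (w := !₂[-(a + c) / N, -(c - a) / N])
    (by
      rw [EuclideanSpace.norm_eq, Real.sqrt_eq_one]
      simp [Fin.sum_univ_two]
      field_simp; rw [hN2]; ring)
    (by
      rw [EuclideanSpace.norm_eq, Real.sqrt_eq_one]
      simp [Fin.sum_univ_two]
      field_simp; rw [hN2]; ring)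
    (by
      simp [PiLp.inner_apply, Fin.sum_univ_two]
      field_simp; ring)
  refine ⟨b, ?_, ?_⟩
  · rw [h0, hLx]
    have : -(a - c) / N * a + -(c + a) / N * c = -(a ^ 2 + c ^ 2) / N := by field_simp; ring
    rw [this]; exact div_neg_of_neg_of_pos (by linarith) hN0
  · rw [h1, hLx]
    have : -(a + c) / N * a + -(c - a) / N * c = -(a ^ 2 + c ^ 2) / N := by field_simp; ring
    rw [this]; exact div_neg_of_neg_of_pos (by linarith) hN0

theorem norm_frame_le (b : OrthonormalBasis (Fin 2) ℝ Plane) {h r s : ℝ} (hr : r ∈ Icc 0 h)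
    (hs : s ∈ Icc 0 h) : ‖r • b 0 + s • b 1‖ ≤ 2 * h := by
  calc ‖r • b 0 + s • b 1‖ ≤ ‖r • b 0‖ + ‖s • b 1‖ := norm_add_le _ _
    _ = r + s := by
      rw [norm_smul, norm_smul, b.norm_eq_one, b.norm_eq_one, Real.norm_of_nonneg hr.1,
        Real.norm_of_nonneg hs.1]; ring
    _ ≤ 2 * h := by linarith [hr.2, hs.2]

/-- At an interior point any frame works. At a boundary point take a frame of descent for the
gradient of the defining function: by continuity it is one nearby too, so moving along nonnegative
combinations of its vectors keeps the defining function negative. -/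
theorem IsSmoothBoundedDomain.exists_frame {U : Set Plane} (hU : IsSmoothBoundedDomain U)
    {p : Plane} (hp : p ∈ closure U) : ∃ δ : ℝ, 0 < δ ∧ ∃ b : OrthonormalBasis (Fin 2) ℝ Plane,
      ∀ x ∈ Metric.ball p δ ∩ U, ∀ r ∈ Icc 0 δ, ∀ s ∈ Icc 0 δ, x + r • b 0 + s • b 1 ∈ U := by
  obtain ⟨ρ, hρ, hUρ, hgrad⟩ := hU.boundary
  by_cases hpU : p ∈ U
  · obtain ⟨δ, hδ, hball⟩ := Metric.isOpen_iff.1 hU.isOpen p hpU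
    refine ⟨δ / 4, by positivity, EuclideanSpace.basisFun _ _, ?_⟩
    intro x hx r hr s hs
    apply hball
    have h1 := norm_frame_le (EuclideanSpace.basisFun (Fin 2) ℝ) hr hs
    have h2 := mem_ball_iff_norm.1 hx.1
    rw [mem_ball_iff_norm, add_assoc, add_sub_right_comm]
    refine (norm_add_le _ _).trans_lt ?_
    linarith
  · have hρp : ρ p = 0 := by
      apply le_antisymm
      · have : closure U ⊆ {x | ρ x ≤ 0} := closure_minimal
          (by rw [hUρ]; exact fun x (hx : ρ x < 0) => hx.le)
          (isClosed_le hρ.continuous continuous_const)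
        exact this hp
      · by_contra hcon
        exact hpU (by rw [hUρ]; exact not_le.1 hcon)
    obtain ⟨b, hb0, hb1⟩ := exists_descent_frame (hgrad p hρp)
    have hcont : Continuous (fderiv ℝ ρ) := hρ.continuous_fderiv (by norm_num)
    have hev : ∀ᶠ y in 𝓝 p, fderiv ℝ ρ y (b 0) < 0 ∧ fderiv ℝ ρ y (b 1) < 0 := by
      have c0 : Continuous fun y => fderiv ℝ ρ y (b 0) := hcont.clm_apply continuous_const
      have c1 : Continuous fun y => fderiv ℝ ρ y (b 1) := hcont.clm_apply continuous_const
      exact (c0.continuousAt.eventually_lt_const hb0).and (c1.continuousAt.eventually_lt_const hb1)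
    obtain ⟨δ, hδ, hball⟩ := Metric.eventually_nhds_iff_ball.1 hev
    -- Starting within `δ / 4` of `p` and moving by at most `2 (δ / 4)`, the path stays in the ball
    -- where both directional derivatives are negative.
    refine ⟨δ / 4, by positivity, b, ?_⟩
    intro x hx r hr s hs
    set v := r • b 0 + s • b 1 with hv
    have hvn : ‖v‖ ≤ 2 * (δ / 4) := norm_frame_le b hr hs
    have hxn := mem_ball_iff_norm.1 hx.1
    have hd : ∀ τ : ℝ, HasDerivAt (fun τ : ℝ => ρ (x + τ • v)) (fderiv ℝ ρ (x + τ • v) v) τ := by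
      intro τ
      have h1 : HasDerivAt (fun τ : ℝ => x + τ • v) v τ := by
        simpa using ((hasDerivAt_id τ).smul_const v).const_add x
      exact (hρ.differentiable (by norm_num) _).hasFDerivAt.comp_hasDerivAt τ h1
    have hanti : AntitoneOn (fun τ : ℝ => ρ (x + τ • v)) (Icc 0 1) := by
      apply antitoneOn_of_deriv_nonpos (convex_Icc 0 1)
      · exact fun τ _ => (hd τ).continuousAt.continuousWithinAt
      · exact fun τ _ => (hd τ).differentiableAt.differentiableWithinAt
      · intro τ hτ
        rw [interior_Icc] at hτ
        rw [(hd τ).deriv]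
        have hmem : x + τ • v ∈ Metric.ball p δ := by
          rw [mem_ball_iff_norm, add_sub_right_comm]
          refine (norm_add_le _ _).trans_lt ?_
          have : ‖τ • v‖ ≤ ‖v‖ := by
            rw [norm_smul, Real.norm_of_nonneg hτ.1.le]
            exact mul_le_of_le_one_left (norm_nonneg _) hτ.2.le
          linarith
        obtain ⟨h0, h1⟩ := hball _ hmem
        simp only [hv, map_add, map_smul, smul_eq_mul] at h0 h1 ⊢
        nlinarith [hr.1, hs.1, mul_nonneg hr.1 (neg_nonneg.2 h0.le),
          mul_nonneg hs.1 (neg_nonneg.2 h1.le)]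
    have := hanti (left_mem_Icc.2 zero_le_one) (right_mem_Icc.2 zero_le_one) zero_le_one
    have hxU : ρ x < 0 := by
      have := hx.2
      rw [hUρ] at this; exact this
    rw [hUρ, add_assoc]
    simp only [one_smul, zero_smul, add_zero] at this
    exact lt_of_le_of_lt this hxU

/-- Compactness of the closure leaves finitely many local frames, which then share a common positive
side length. -/
theorem IsSmoothBoundedDomain.hasFrames {U : Set Plane} (hU : IsSmoothBoundedDomain U) :
    HasFrames U := by
  choose! δ hδ b hb using fun p (hp : p ∈ closure U) => hU.exists_frame hp
  have hK : IsCompact (closure U) := hU.isBounded.isCompact_closure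
  obtain ⟨t, ht, htc⟩ := hK.elim_nhds_subcover (fun p => Metric.ball p (δ p))
    fun p hp => Metric.ball_mem_nhds p (hδ p hp)
  have hev : ∀ᶠ h in 𝓝[>] (0 : ℝ), ∀ p ∈ t, h ≤ δ p :=
    (Filter.eventually_all_finset t).2 fun p hp => by
      filter_upwards [Ioo_mem_nhdsGT (hδ p (ht p hp))] with h hh using hh.2.le
  obtain ⟨h, hh, hh0⟩ := (hev.and self_mem_nhdsWithin).exists
  obtain ⟨n, ⟨e⟩⟩ := Finite.exists_equiv_fin t
  refine ⟨h, hh0, Fin n, inferInstance, fun k => Metric.ball (e.symm k : Plane) (δ (e.symm k)) ∩ U,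
    fun k => b (e.symm k), fun k => Metric.isOpen_ball.inter hU.isOpen, ?_, ?_⟩
  · intro x hx
    obtain ⟨p, hp, hxp⟩ := mem_iUnion₂.1 (htc (subset_closure hx))
    exact mem_iUnion.2 ⟨e ⟨p, hp⟩, by simpa using ⟨hxp, hx⟩⟩
  · intro k x hx r hr s hs
    have hk := hh _ (e.symm k).2
    exact hb _ (ht _ (e.symm k).2) x hx r ⟨hr.1, hr.2.trans hk⟩ s ⟨hs.1, hs.2.trans hk⟩

/-- The open fundamental cell of the torus. -/
def openCell : Set Plane := {x | ∀ i, 0 < x i ∧ x i < 2 * Real.pi}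

theorem isOpen_openCell : IsOpen openCell := by
  have : openCell = ⋂ i : Fin 2, {x : Plane | 0 < x i ∧ x i < 2 * Real.pi} := by
    ext x; simp [openCell]
  rw [this]
  have hc : ∀ i : Fin 2, Continuous fun x : Plane => x i := fun i => by fun_prop
  exact isOpen_iInter_of_finite fun i =>
    (isOpen_lt continuous_const (hc i)).and (isOpen_lt (hc i) continuous_const)

/-- A coordinate below `3π/2` can be increased, and one above `π/2` decreased, by `π/4` without
leaving the cell. The four choices of signs give four frames. -/
theorem hasFrames_openCell : HasFrames openCell := by
  have hπ := Real.pi_pos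
  have hframe : ∀ q : Bool × Bool, ∃ b : OrthonormalBasis (Fin 2) ℝ Plane,
      b 0 = EuclideanSpace.single 0 (if q.1 then (1 : ℝ) else -1) ∧
      b 1 = EuclideanSpace.single 1 (if q.2 then (1 : ℝ) else -1) := by
    intro q
    apply exists_orthonormalBasis_of_inner_eq_zero
    · rw [PiLp.norm_single]; split_ifs <;> simp
    · rw [PiLp.norm_single]; split_ifs <;> simp
    · simp [EuclideanSpace.inner_single_left]
  choose b hb0 hb1 using hframe
  let P : Bool → ℝ → Prop := fun q y =>
    if q then y < 3 * Real.pi / 2 else Real.pi / 2 < y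
  have hP : ∀ q (i : Fin 2), IsOpen {x : Plane | P q (x i)} := by
    intro q i
    cases q
    · simpa [P] using isOpen_lt (continuous_const (y := Real.pi / 2))
        (show Continuous fun x : Plane => x i by fun_prop)
    · simpa [P] using isOpen_lt (show Continuous fun x : Plane => x i by fun_prop)
        (continuous_const (y := 3 * Real.pi / 2))
  have hstep : ∀ (q : Bool) (y r : ℝ), 0 < y → y < 2 * Real.pi → P q y → r ∈ Icc 0 (Real.pi / 4) →
      0 < y + r * (if q then (1 : ℝ) else -1) ∧
        y + r * (if q then (1 : ℝ) else -1) < 2 * Real.pi := by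
    intro q y r h1 h2 h3 h4
    obtain ⟨h4, h5⟩ := h4
    cases q <;> simp [P] at h3 ⊢ <;> constructor <;> linarith
  refine ⟨Real.pi / 4, by positivity, Bool × Bool, inferInstance,
    fun q => openCell ∩ ({x | P q.1 (x 0)} ∩ {x | P q.2 (x 1)}), b,
    fun q => isOpen_openCell.inter ((hP _ _).inter (hP _ _)), ?_, ?_⟩
  · intro x hx
    have hex : ∀ y : ℝ, ∃ q, P q y := by
      intro y
      by_cases hy : y < 3 * Real.pi / 2
      · exact ⟨true, by simpa [P] using hy⟩
      · exact ⟨false, by simp only [P]; simp; linarith⟩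
    obtain ⟨q1, h1⟩ := hex (x 0)
    obtain ⟨q2, h2⟩ := hex (x 1)
    exact mem_iUnion.2 ⟨(q1, q2), hx, h1, h2⟩
  · intro q x hx r hr s hs
    obtain ⟨hx, h1, h2⟩ := hx
    intro i
    rw [hb0, hb1]
    fin_cases i
    · simpa using hstep q.1 (x 0) r (hx 0).1 (hx 0).2 h1 hr
    · simpa using hstep q.2 (x 1) s (hx 1).1 (hx 1).2 h2 hs

/-! ### The torus: periodic extension and periodization -/

/-- The lattice `2πℤ²`. -/
def lattice (k : ℤ × ℤ) : Plane := !₂[2 * Real.pi * k.1, 2 * Real.pi * k.2]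

theorem lattice_add (k l : ℤ × ℤ) : lattice (k + l) = lattice k + lattice l := by
  ext i; fin_cases i <;> simp [lattice] <;> ring

@[simp] theorem lattice_zero : lattice 0 = 0 := by
  ext i; fin_cases i <;> simp [lattice]

/-- Reduction modulo the lattice to the fundamental cell. -/
def wrap (x : Plane) : Plane := WithLp.toLp 2 fun i => 2 * Real.pi * Int.fract (x i / (2 * Real.pi))

/-- The lattice index of the cell containing a point. -/
def cellIndex (x : Plane) : ℤ × ℤ := (⌊x 0 / (2 * Real.pi)⌋, ⌊x 1 / (2 * Real.pi)⌋)

theorem wrap_add_lattice_cellIndex (x : Plane) : wrap x + lattice (cellIndex x) = x := by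
  have h := Real.two_pi_pos.ne'
  ext i; fin_cases i <;> simp [wrap, lattice, cellIndex] <;>
    rw [← mul_add, add_comm (Int.fract _), Int.floor_add_fract] <;> field_simp

theorem wrap_add_lattice (x : Plane) (k : ℤ × ℤ) : wrap (x + lattice k) = wrap x := by
  have h := Real.two_pi_pos.ne'
  ext i; fin_cases i <;> simp [wrap, lattice] <;>
    rw [add_div, mul_div_cancel_left₀ _ h, Int.fract_add_intCast]

theorem wrap_mem_region (x : Plane) : wrap x ∈ Setting.torus.region := by
  intro i
  have h := Real.two_pi_pos
  constructor
  · exact mul_nonneg h.le (Int.fract_nonneg _)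
  · exact mul_lt_of_lt_one_right h (Int.fract_lt_one _)

theorem wrap_of_mem_region {x : Plane} (hx : x ∈ Setting.torus.region) : wrap x = x := by
  have h := Real.two_pi_pos
  ext i
  have h1 : Int.fract (x i / (2 * Real.pi)) = x i / (2 * Real.pi) := by
    rw [Int.fract_eq_self]
    exact ⟨div_nonneg (hx i).1 h.le, (div_lt_one h).2 (hx i).2⟩
  simp only [wrap]
  rw [h1]; field_simp

theorem measurable_wrap : Measurable wrap := by
  unfold wrap
  fun_prop

theorem measurableSet_region_torus : MeasurableSet Setting.torus.region := by
  have : Setting.torus.region = ⋂ i : Fin 2, {x : Plane | 0 ≤ x i ∧ x i < 2 * Real.pi} := by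
    ext x; simp [Setting.region]
  rw [this]
  refine MeasurableSet.iInter fun i => ?_
  have hc : Measurable fun x : Plane => x i := by fun_prop
  exact (measurableSet_le measurable_const hc).inter (measurableSet_lt hc measurable_const)

theorem norm_le_of_mem_region {x : Plane} (hx : x ∈ Setting.torus.region) :
    ‖x‖ ≤ 2 * (2 * Real.pi) := by
  have : x = EuclideanSpace.single 0 (x 0) + EuclideanSpace.single 1 (x 1) := by
    ext i; fin_cases i <;> simp
  rw [this]
  refine (norm_add_le _ _).trans ?_
  rw [PiLp.norm_single, PiLp.norm_single, Real.norm_of_nonneg (hx 0).1,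
    Real.norm_of_nonneg (hx 1).1]
  linarith [(hx 0).2, (hx 1).2]

theorem isFiniteMeasure_torus : IsFiniteMeasure Setting.torus.μ := by
  refine ⟨?_⟩
  rw [Setting.μ, Measure.restrict_apply_univ]
  refine (measure_mono (t := Metric.closedBall 0 (2 * (2 * Real.pi))) ?_).trans_lt
    measure_closedBall_lt_top
  intro x hx
  simpa using norm_le_of_mem_region hx

/-- The translate of the fundamental cell by a lattice vector. -/
def tile (k : ℤ × ℤ) : Set Plane := (fun x => x - lattice k) ⁻¹' Setting.torus.region

theorem measurableSet_tile (k : ℤ × ℤ) : MeasurableSet (tile k) :=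
  (measurable_sub_const _) measurableSet_region_torus

theorem mem_tile_cellIndex (x : Plane) : x ∈ tile (cellIndex x) := by
  have : x - lattice (cellIndex x) = wrap x := by
    nth_rw 1 [← wrap_add_lattice_cellIndex x]; simp
  rw [tile, mem_preimage, this]; exact wrap_mem_region x

theorem iUnion_tile : ⋃ k, tile k = univ :=
  eq_univ_of_forall fun x => mem_iUnion.2 ⟨_, mem_tile_cellIndex x⟩

theorem wrap_of_mem_tile {x : Plane} {k : ℤ × ℤ} (hx : x ∈ tile k) : wrap x = x - lattice k := by
  have h := wrap_of_mem_region (x := x - lattice k) hx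
  rw [← h, ← wrap_add_lattice (x - lattice k) k, sub_add_cancel]

theorem lattice_injective : Function.Injective lattice := by
  intro k l h
  have hp := Real.two_pi_pos.ne'
  have h0 := congrArg (fun x : Plane => x 0) h
  have h1 := congrArg (fun x : Plane => x 1) h
  simp [lattice] at h0 h1
  ext <;> assumption

theorem pairwise_disjoint_tile : Pairwise (Function.onFun Disjoint tile) := by
  intro k l hkl
  rw [Function.onFun, Set.disjoint_left]
  intro x hk hl
  apply hkl
  apply lattice_injective
  have := (wrap_of_mem_tile hk).symm.trans (wrap_of_mem_tile hl)
  simpa using this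

/-- Preimages of null sets are countable unions of translated null sets. Hence periodic extension
respects almost everywhere equality and is well defined on classes. -/
theorem quasiMeasurePreserving_wrap :
    Measure.QuasiMeasurePreserving wrap volume Setting.torus.μ := by
  refine ⟨measurable_wrap, ?_⟩
  refine Measure.AbsolutelyContinuous.mk fun N hN h0 => ?_
  rw [Measure.map_apply measurable_wrap hN]
  rw [Setting.μ, Measure.restrict_apply hN] at h0
  have : wrap ⁻¹' N ⊆ ⋃ k, (fun x => x - lattice k) ⁻¹' (N ∩ Setting.torus.region) := by
    intro x hx
    have h1 := mem_tile_cellIndex x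
    refine mem_iUnion.2 ⟨cellIndex x, ?_, h1⟩
    have := wrap_of_mem_tile h1
    rw [mem_preimage] at hx
    rwa [this] at hx
  refine measure_mono_null this ?_
  rw [measure_iUnion_null_iff]
  intro k
  exact (measurePreserving_sub_right volume (lattice k)).quasiMeasurePreserving.preimage_null h0

/-- The periodic extension of a function on the cell. -/
def periodicExt (f : Plane → ℝ) (x : Plane) : ℝ := f (wrap x)

theorem periodicExt_add_lattice (f : Plane → ℝ) (x : Plane) (k : ℤ × ℤ) :
    periodicExt f (x + lattice k) = periodicExt f x := by
  rw [periodicExt, wrap_add_lattice]; rfl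

theorem periodicExt_of_mem {f : Plane → ℝ} {x : Plane} (hx : x ∈ Setting.torus.region) :
    periodicExt f x = f x := by
  rw [periodicExt, wrap_of_mem_region hx]

theorem measurePreserving_tile (k : ℤ × ℤ) :
    MeasurePreserving (fun x => x - lattice k) (volume.restrict (tile k)) Setting.torus.μ :=
  (measurePreserving_sub_right volume (lattice k)).restrict_preimage measurableSet_region_torus

theorem exists_finset_lattice (R : ℝ) : ∃ S : Finset (ℤ × ℤ), ∀ k ∉ S, R < ‖lattice k‖ := by
  obtain ⟨n, hn⟩ := exists_nat_gt (R / (2 * Real.pi))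
  refine ⟨Finset.Icc (-n : ℤ) n ×ˢ Finset.Icc (-n : ℤ) n, fun k hk => ?_⟩
  have h := Real.two_pi_pos
  rw [div_lt_iff₀ h] at hn
  have key : ∀ m : ℤ, m ∉ Finset.Icc (-n : ℤ) n → R < |2 * Real.pi * m| := by
    intro m hm
    have h1 : (n : ℤ) < |m| := by
      rw [lt_abs]
      by_contra hcon
      push Not at hcon
      exact hm (Finset.mem_Icc.2 ⟨by linarith, hcon.1⟩)
    have h2 : (n : ℝ) < |(m : ℝ)| := by exact_mod_cast h1
    rw [abs_mul, abs_of_pos h]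
    nlinarith
  have hco : ∀ i, |lattice k i| ≤ ‖lattice k‖ := fun i => PiLp.norm_apply_le (lattice k) i
  by_cases h1 : k.1 ∈ Finset.Icc (-n : ℤ) n
  · have h2 : k.2 ∉ Finset.Icc (-n : ℤ) n := fun h2 => hk (Finset.mem_product.2 ⟨h1, h2⟩)
    exact (key _ h2).trans_le (by simpa [lattice] using hco 1)
  · exact (key _ h1).trans_le (by simpa [lattice] using hco 0)

/-- A compact set meets only finitely many tiles, and on each tile the extension is a translate of
`f`. -/
theorem memLp_periodicExt {f : Plane → ℝ} (hf : MemLp f 2 Setting.torus.μ) (K : Set Plane)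
    (hK : IsCompact K) : MemLp (periodicExt f) 2 (volume.restrict K) := by
  have ht : ∀ k, MemLp (periodicExt f) 2 (volume.restrict (tile k)) := by
    intro k
    have := hf.comp_measurePreserving (measurePreserving_tile k)
    refine this.ae_eq ?_
    filter_upwards [ae_restrict_mem (measurableSet_tile k)] with x hx
    simp [periodicExt, wrap_of_mem_tile hx]
  obtain ⟨R, hR⟩ := hK.isBounded.exists_norm_le
  obtain ⟨S, hS⟩ := exists_finset_lattice (R + 2 * (2 * Real.pi))
  have hKS : K ⊆ ⋃ k ∈ S, tile k := by
    intro x hx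
    refine mem_iUnion₂.2 ⟨cellIndex x, ?_, mem_tile_cellIndex x⟩
    by_contra hcon
    have h1 := hS _ hcon
    have h2 : lattice (cellIndex x) = x - wrap x := by
      nth_rw 2 [← wrap_add_lattice_cellIndex x]; simp
    have h3 : ‖wrap x‖ ≤ 2 * (2 * Real.pi) := norm_le_of_mem_region (wrap_mem_region x)
    rw [h2] at h1
    have := norm_sub_le x (wrap x)
    linarith [hR x hx]
  have hm : AEStronglyMeasurable (periodicExt f) volume :=
    hf.1.comp_quasiMeasurePreserving quasiMeasurePreserving_wrap
  rw [memLp_two_iff_integrable_sq hm.restrict]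
  refine IntegrableOn.mono_set (t := ⋃ k ∈ S, tile k) ?_ hKS
  rw [integrableOn_finset_iUnion]
  exact fun k _ => (memLp_two_iff_integrable_sq hm.restrict).1 (ht k)

theorem integral_eq_tsum_cell {F : Plane → ℝ} (hF : Integrable F) :
    ∫ x, F x = ∑' k, ∫ x, F (x + lattice k) ∂Setting.torus.μ := by
  rw [← setIntegral_univ, ← iUnion_tile,
    integral_iUnion measurableSet_tile pairwise_disjoint_tile hF.integrableOn]
  congr 1; ext k
  rw [← (measurePreserving_tile k).integral_comp
    (MeasurableEquiv.subRight (lattice k)).measurableEmbedding]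
  simp

/-- The periodization of a function on the plane. -/
def periodize (ψ : Plane → ℝ) (x : Plane) : ℝ := ∑' k, ψ (x + lattice k)

theorem exists_finset_periodize {ψ : Plane → ℝ} (hc : HasCompactSupport ψ) (R : ℝ) :
    ∃ S : Finset (ℤ × ℤ), ∀ x, ‖x‖ ≤ R → ∀ k ∉ S, ψ (x + lattice k) = 0 := by
  obtain ⟨R', hR'⟩ := hc.isBounded.exists_norm_le
  obtain ⟨S, hS⟩ := exists_finset_lattice (R + R')
  refine ⟨S, fun x hx k hk => ?_⟩
  by_contra hcon
  have h1 := hR' _ (subset_tsupport ψ hcon)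
  have h2 := hS k hk
  have h3 : ‖lattice k‖ ≤ ‖x + lattice k‖ + ‖x‖ := by
    have := norm_sub_le (x + lattice k) x
    rwa [add_sub_cancel_left] at this
  linarith

theorem periodize_eq_sum {ψ : Plane → ℝ} {x : Plane} {S : Finset (ℤ × ℤ)}
    (h : ∀ k ∉ S, ψ (x + lattice k) = 0) : periodize ψ x = ∑ k ∈ S, ψ (x + lattice k) :=
  tsum_eq_sum h

theorem eventually_periodize_eq_sum {ψ : Plane → ℝ} (hc : HasCompactSupport ψ) (x : Plane) :
    ∃ S : Finset (ℤ × ℤ), (∀ k ∉ S, ψ (x + lattice k) = 0) ∧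
      (∀ k ∉ S, ∀ᶠ y in 𝓝 x, ψ (y + lattice k) = 0) ∧
      periodize ψ =ᶠ[𝓝 x] fun y => ∑ k ∈ S, ψ (y + lattice k) := by
  obtain ⟨S, hS⟩ := exists_finset_periodize hc (‖x‖ + 1)
  have hev : ∀ᶠ y in 𝓝 x, ‖y‖ ≤ ‖x‖ + 1 := by
    filter_upwards [continuous_norm.continuousAt.eventually_lt_const (lt_add_one ‖x‖)] with y hy
      using hy.le
  refine ⟨S, hS x (by linarith), fun k hk => ?_, ?_⟩
  · filter_upwards [hev] with y hy using hS y hy k hk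
  · filter_upwards [hev] with y hy using periodize_eq_sum (hS y hy)

theorem contDiff_periodize {ψ : Plane → ℝ} (hψ : ContDiff ℝ ∞ ψ) (hc : HasCompactSupport ψ) :
    ContDiff ℝ ∞ (periodize ψ) := by
  rw [contDiff_iff_contDiffAt]
  intro x
  obtain ⟨S, -, -, hS⟩ := eventually_periodize_eq_sum hc x
  refine ContDiffAt.congr_of_eventuallyEq ?_ hS
  exact ContDiffAt.sum fun k _ => (hψ.comp (contDiff_id.add contDiff_const)).contDiffAt

theorem fderiv_periodize {ψ : Plane → ℝ} (hψ : ContDiff ℝ ∞ ψ) (hc : HasCompactSupport ψ)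
    (e x : Plane) : fderiv ℝ (periodize ψ) x e = periodize (fun y => fderiv ℝ ψ y e) x := by
  obtain ⟨S, -, hS0, hS⟩ := eventually_periodize_eq_sum hc x
  have hd : ∀ k, fderiv ℝ (fun y => ψ (y + lattice k)) x = fderiv ℝ ψ (x + lattice k) :=
    fun k => fderiv_comp_add_right (lattice k)
  rw [hS.fderiv_eq, fderiv_fun_sum]
  · rw [periodize_eq_sum (S := S)]
    · simp [hd]
    · intro k hk
      have : (fun y => ψ (y + lattice k)) =ᶠ[𝓝 x] fun _ => 0 := hS0 k hk
      rw [← hd, this.fderiv_eq]; simp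
  · exact fun k _ => (hψ.comp (contDiff_id.add contDiff_const)).differentiable (by simp) x

theorem periodize_add_lattice (ψ : Plane → ℝ) (x : Plane) (k : ℤ × ℤ) :
    periodize ψ (x + lattice k) = periodize ψ x := by
  unfold periodize
  rw [← (Equiv.addLeft k).tsum_eq fun l => ψ (x + lattice l)]
  congr 1; ext l
  simp [lattice_add, add_assoc]

theorem single_eq_lattice (i : Fin 2) :
    ∃ k, EuclideanSpace.single i (2 * Real.pi) = lattice k := by
  fin_cases i
  · exact ⟨(1, 0), by ext i; fin_cases i <;> simp [lattice]⟩
  · exact ⟨(0, 1), by ext i; fin_cases i <;> simp [lattice]⟩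

theorem isPeriodic_iff {φ : Plane → ℝ} :
    IsPeriodic φ ↔ ∀ k x, φ (x + lattice k) = φ x := by
  constructor
  · intro h k x
    have hp : ∀ i, Function.Periodic φ (EuclideanSpace.single i (2 * Real.pi)) := fun i x => h i x
    have e : lattice k = k.1 • (EuclideanSpace.single 0 (2 * Real.pi) : Plane)
        + k.2 • EuclideanSpace.single 1 (2 * Real.pi) := by
      ext i; fin_cases i <;> simp [lattice] <;> ring
    rw [e, ← add_assoc, (hp 1).zsmul k.2, (hp 0).zsmul k.1]
  · intro h i x
    obtain ⟨k, hk⟩ := single_eq_lattice i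
    rw [hk, h]

/-- Unfolding: cut the plane into tiles, translate each back to the cell, and sum the translates of
`ψ`. Compact support makes the sum finite, uniformly on the cell. -/
theorem integral_periodicExt_mul {f ψ : Plane → ℝ} (hf : MemLp f 2 Setting.torus.μ)
    (hψ : Continuous ψ) (hc : HasCompactSupport ψ) :
    ∫ x, periodicExt f x * ψ x = ∫ x, f x * periodize ψ x ∂Setting.torus.μ := by
  have hloc : LocallyIntegrable (periodicExt f) := by
    rw [locallyIntegrable_iff]
    intro K hK
    have : IsFiniteMeasure (volume.restrict K) := ⟨by simpa using hK.measure_lt_top⟩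
    exact (memLp_periodicExt hf K hK).integrable (by norm_num)
  have hint := integrable_mul_of_hasCompactSupport hloc hψ hc
  rw [integral_eq_tsum_cell hint]
  have hbd : ∀ x ∈ Setting.torus.region, ‖x‖ ≤ 2 * (2 * Real.pi) :=
    fun x hx => norm_le_of_mem_region hx
  obtain ⟨S, hS⟩ := exists_finset_periodize hc (2 * (2 * Real.pi))
  have hk : ∀ k, ∫ x, periodicExt f (x + lattice k) * ψ (x + lattice k) ∂Setting.torus.μ
      = ∫ x, f x * ψ (x + lattice k) ∂Setting.torus.μ := by
    intro k
    apply integral_congr_ae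
    filter_upwards [ae_restrict_mem measurableSet_region_torus] with x hx
    rw [periodicExt_add_lattice, periodicExt_of_mem hx]
  obtain ⟨C, hC⟩ := hc.exists_bound_of_continuous hψ
  have := isFiniteMeasure_torus
  have hfi : Integrable f Setting.torus.μ := hf.integrable (by norm_num)
  simp only [hk]
  rw [tsum_eq_sum (s := S)]
  · rw [← integral_finsetSum]
    · apply integral_congr_ae
      filter_upwards [ae_restrict_mem measurableSet_region_torus] with x hx
      rw [periodize_eq_sum (hS x (hbd x hx)), Finset.mul_sum]
    · intro k _
      exact hfi.mul_bdd (c := C)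
        (hψ.comp (continuous_id.add continuous_const)).aestronglyMeasurable
        (Eventually.of_forall fun x => hC _)
  · intro k hkS
    rw [← integral_zero]
    apply integral_congr_ae
    filter_upwards [ae_restrict_mem measurableSet_region_torus] with x hx
    rw [hS x (hbd x hx) k hkS, mul_zero]

/-- Multiply `φ` by `χ` divided by its periodization, where `χ` is a bump function positive on the
cell; the translates of this quotient sum to `1`. Thus periodizations exhaust the test functions of
the torus. -/
theorem exists_periodize_eq {φ : Plane → ℝ} (hφ : ContDiff ℝ ∞ φ) (hp : IsPeriodic φ) :
    ∃ ψ : Plane → ℝ, ContDiff ℝ ∞ ψ ∧ HasCompactSupport ψ ∧ periodize ψ = φ := by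
  obtain ⟨χ, hχ1, hχ2, hχ3, hχ4⟩ : ∃ χ : Plane → ℝ, ContDiff ℝ ∞ χ ∧ HasCompactSupport χ ∧
      (∀ x, 0 ≤ χ x) ∧ ∀ x ∈ Setting.torus.region, 0 < χ x := by
    -- Points of the cell have norm at most `4π`, so these radii make the bump positive on it.
    let f : ContDiffBump (0 : Plane) :=
      ⟨4 * Real.pi + 1, 4 * Real.pi + 2, by positivity, by linarith⟩
    refine ⟨f, f.contDiff, f.hasCompactSupport, fun x => f.nonneg, fun x hx => f.pos_of_mem_ball ?_⟩
    rw [mem_ball_zero_iff]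
    have := norm_le_of_mem_region hx
    change ‖x‖ < 4 * Real.pi + 2
    linarith
  have hsum : ∀ x, Summable fun k => χ (x + lattice k) := by
    intro x
    obtain ⟨S, hS, -⟩ := eventually_periodize_eq_sum hχ2 x
    exact summable_of_ne_finset_zero hS
  have hpos : ∀ x, 0 < periodize χ x := by
    intro x
    have h1 : periodize χ x = periodize χ (wrap x) := by
      nth_rw 1 [← wrap_add_lattice_cellIndex x]
      rw [periodize_add_lattice]
    rw [h1]
    refine (hχ4 _ (wrap_mem_region x)).trans_le ?_
    have := (hsum (wrap x)).le_tsum 0 fun k _ => hχ3 _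
    simpa [periodize] using this
  refine ⟨fun x => χ x * (φ x / periodize χ x), ?_, hχ2.mul_right, ?_⟩
  · exact hχ1.mul (hφ.div (contDiff_periodize hχ1 hχ2) fun x => (hpos x).ne')
  · ext x
    have : ∀ k, χ (x + lattice k) * (φ (x + lattice k) / periodize χ (x + lattice k))
        = χ (x + lattice k) * (φ x / periodize χ x) := by
      intro k
      rw [isPeriodic_iff.1 hp, periodize_add_lattice]
    rw [periodize]
    simp only [this]
    rw [tsum_mul_right]
    have h := (hpos x).ne'
    change periodize χ x * _ = _
    field_simp

/-- Weak derivatives on the torus are weak derivatives of periodic extensions on the plane. -/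
theorem isWeakPartial_torus_iff {i : Fin 2} {u g : Setting.torus.H} :
    Setting.torus.IsWeakPartial i u g ↔
      HasWeakDeriv univ (EuclideanSpace.single i 1) (periodicExt u) (periodicExt g) := by
  have key : ∀ ψ : Plane → ℝ, ContDiff ℝ ∞ ψ → HasCompactSupport ψ →
      ((∫ x, periodicExt u x * fderiv ℝ ψ x (EuclideanSpace.single i 1)
        = ∫ x, u x * pderiv i (periodize ψ) x ∂Setting.torus.μ) ∧
      ∫ x, periodicExt g x * ψ x = ∫ x, g x * periodize ψ x ∂Setting.torus.μ) := by
    intro ψ h1 h2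
    refine ⟨?_, integral_periodicExt_mul (Lp.memLp g) h1.continuous h2⟩
    rw [integral_periodicExt_mul (Lp.memLp u) (continuous_fderiv_apply_of_smooth h1 _)
      (hasCompactSupport_fderiv_apply h2 _)]
    simp only [pderiv, fderiv_periodize h1 h2]
  constructor
  · intro h ψ h1 h2 _
    rw [(key ψ h1 h2).1, (key ψ h1 h2).2]
    exact h _ ⟨contDiff_periodize h1 h2,
      isPeriodic_iff.2 fun k x => periodize_add_lattice ψ x k⟩
  · intro h φ hφ
    obtain ⟨ψ, h1, h2, rfl⟩ := exists_periodize_eq hφ.1 hφ.2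
    rw [← (key ψ h1 h2).1, ← (key ψ h1 h2).2]
    exact h ψ h1 h2 (subset_univ _)

theorem volume_region_diff_openCell : volume (Setting.torus.region \ openCell) = 0 := by
  have hsub : Setting.torus.region \ openCell ⊆
      ⋃ i : Fin 2, {x : Plane | (EuclideanSpace.proj i : Plane →L[ℝ] ℝ) x = 0} := by
    intro x hx
    obtain ⟨h1, h2⟩ := hx
    simp only [openCell, mem_ofPred_eq, not_forall, not_and_or, not_lt] at h2
    obtain ⟨i, hi⟩ := h2
    refine mem_iUnion.2 ⟨i, ?_⟩
    rcases hi with hi | hi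
    · exact le_antisymm hi (h1 i).1
    · exact absurd (h1 i).2 (not_lt.2 hi)
  refine measure_mono_null hsub ?_
  rw [measure_iUnion_null_iff]
  intro i
  have := Measure.addHaar_submodule (volume : Measure Plane)
    (LinearMap.ker (EuclideanSpace.proj i : Plane →L[ℝ] ℝ).toLinearMap) ?_
  · exact this
  · intro h
    have h1 : EuclideanSpace.single i (1 : ℝ) ∈
      LinearMap.ker (EuclideanSpace.proj i : Plane →L[ℝ] ℝ).toLinearMap := by rw [h]; trivial
    simp at h1

/-! ### Sobolev calculus common to both settings -/

namespace Setting

/-- The open set on which weak derivatives are tested, after extension to the plane. -/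
def localDomain : Setting → Set Plane
  | torus => univ
  | neumann U => U

/-- The interior of the region of integration. -/
def openRegion : Setting → Set Plane
  | torus => openCell
  | neumann U => U

/-- The canonical extension of a function to the plane. -/
def ext : Setting → (Plane → ℝ) → Plane → ℝ
  | torus, f => periodicExt f
  | neumann U, f => U.indicator f

variable {D : Setting}

theorem isOpen_localDomain (hD : D.Admissible) : IsOpen D.localDomain := by
  cases D with
  | torus => exact isOpen_univ
  | neumann U => exact hD.isOpen

theorem isOpen_openRegion (hD : D.Admissible) : IsOpen D.openRegion := by
  cases D with
  | torus => exact isOpen_openCell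
  | neumann U => exact hD.isOpen

theorem hasFrames_openRegion (hD : D.Admissible) : HasFrames D.openRegion := by
  cases D with
  | torus => exact hasFrames_openCell
  | neumann U => exact IsSmoothBoundedDomain.hasFrames hD

theorem openRegion_subset_localDomain : D.openRegion ⊆ D.localDomain := by
  cases D with
  | torus => exact subset_univ _
  | neumann U => exact Subset.rfl

theorem openRegion_subset_region : D.openRegion ⊆ D.region := by
  cases D with
  | torus => exact fun x hx i => ⟨(hx i).1.le, (hx i).2⟩
  | neumann U => exact Subset.rfl

theorem μ_eq : D.μ = volume.restrict D.openRegion := by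
  cases D with
  | torus =>
    apply Measure.restrict_congr_set
    refine (ae_eq_set.2 ⟨volume_region_diff_openCell, ?_⟩)
    rw [sdiff_eq_empty.2 (openRegion_subset_region (D := torus))]; simp
  | neumann U => rfl

theorem isFiniteMeasure_μ (hD : D.Admissible) : IsFiniteMeasure D.μ := by
  cases D with
  | torus => exact isFiniteMeasure_torus
  | neumann U =>
    refine ⟨?_⟩
    rw [μ, Measure.restrict_apply_univ]
    exact (IsSmoothBoundedDomain.isBounded hD).measure_lt_top

theorem ae_μ_iff (hD : D.Admissible) {p : Plane → Prop} :
    (∀ᵐ x ∂D.μ, p x) ↔ ∀ᵐ x, x ∈ D.openRegion → p x := by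
  rw [μ_eq, ae_restrict_iff' (isOpen_openRegion hD).measurableSet]

theorem ext_of_mem {f : Plane → ℝ} {x : Plane} (hx : x ∈ D.openRegion) : D.ext f x = f x := by
  cases D with
  | torus => exact periodicExt_of_mem (openRegion_subset_region (D := torus) hx)
  | neumann U => exact indicator_of_mem hx f

theorem ext_mul (f g : Plane → ℝ) (x : Plane) :
    D.ext (fun y => f y * g y) x = D.ext f x * D.ext g x := by
  cases D with
  | torus => rfl
  | neumann U => by_cases hx : x ∈ U <;> simp [ext, hx]

theorem ext_add (f g : Plane → ℝ) (x : Plane) :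
    D.ext (fun y => f y + g y) x = D.ext f x + D.ext g x := by
  cases D with
  | torus => rfl
  | neumann U => by_cases hx : x ∈ U <;> simp [ext, hx]

theorem ext_const_mul (c : ℝ) (f : Plane → ℝ) (x : Plane) :
    D.ext (fun y => c * f y) x = c * D.ext f x := by
  cases D with
  | torus => rfl
  | neumann U => by_cases hx : x ∈ U <;> simp [ext, hx]

theorem ext_congr (hD : D.Admissible) {f g : Plane → ℝ} (h : f =ᵐ[D.μ] g) :
    D.ext f =ᵐ[volume] D.ext g := by
  cases D with
  | torus => exact quasiMeasurePreserving_wrap.ae h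
  | neumann U =>
    have h2 := (ae_μ_iff (D := neumann U) hD).1 h
    filter_upwards [h2] with x hx
    by_cases hxU : x ∈ U
    · simp [ext, hxU, hx hxU]
    · simp [ext, hxU]

theorem memLp_ext (hD : D.Admissible) {f : Plane → ℝ} (hf : MemLp f 2 D.μ) (K : Set Plane)
    (hK : IsCompact K) : MemLp (D.ext f) 2 (volume.restrict K) := by
  cases D with
  | torus => exact memLp_periodicExt hf K hK
  | neumann U =>
    have : MemLp (U.indicator f) 2 volume :=
      (memLp_indicator_iff_restrict (IsSmoothBoundedDomain.isOpen hD).measurableSet).2 hf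
    exact this.restrict K

theorem locallyIntegrable_ext (hD : D.Admissible) {f : Plane → ℝ} (hf : MemLp f 2 D.μ) :
    LocallyIntegrable (D.ext f) := by
  rw [locallyIntegrable_iff]
  intro K hK
  have : IsFiniteMeasure (volume.restrict K) := ⟨by simpa using hK.measure_lt_top⟩
  exact (memLp_ext hD hf K hK).integrable (by norm_num)

/-- Reduces both settings to the local notion on the plane. On the torus the derivative is tested on
all of the plane, hence also across the edges of the cell. -/
theorem isWeakPartial_iff (hD : D.Admissible) {i : Fin 2} {u g : D.H} :
    D.IsWeakPartial i u g ↔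
      HasWeakDeriv D.localDomain (EuclideanSpace.single i 1) (D.ext u) (D.ext g) := by
  cases D with
  | torus => exact isWeakPartial_torus_iff
  | neumann U =>
    have hU := (IsSmoothBoundedDomain.isOpen hD).measurableSet
    have key : ∀ f h : Plane → ℝ, ∫ x, U.indicator f x * h x = ∫ x in U, f x * h x := by
      intro f h
      rw [← integral_indicator hU]
      congr 1; ext x
      by_cases hx : x ∈ U <;> simp [hx]
    constructor
    · intro h ψ h1 h2 h3
      have := h ψ ⟨h1, h2, h3⟩
      simp only [ext, key]
      exact this
    · intro h ψ hψ
      have := h ψ hψ.1 hψ.2.1 hψ.2.2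
      simp only [ext, key] at this
      exact this

/-- This makes the chosen `weakPartial` independent of the choice, and so linear on `H1`. -/
theorem IsWeakPartial.unique (hD : D.Admissible) {i : Fin 2} {u g g' : D.H}
    (h : D.IsWeakPartial i u g) (h' : D.IsWeakPartial i u g') : g = g' := by
  have := ((isWeakPartial_iff hD).1 h).unique (isOpen_localDomain hD) ((isWeakPartial_iff hD).1 h')
    (locallyIntegrable_ext hD (Lp.memLp g)) (locallyIntegrable_ext hD (Lp.memLp g'))
  apply Lp.ext
  refine (ae_μ_iff hD).2 ?_
  filter_upwards [this] with x hx hxO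
  have := hx (openRegion_subset_localDomain hxO)
  rwa [ext_of_mem hxO, ext_of_mem hxO] at this

theorem isWeakPartial_weakPartial {u : D.H} (hu : u ∈ D.H1) (i : Fin 2) :
    D.IsWeakPartial i u (D.weakPartial i u) := by
  unfold weakPartial
  rw [dif_pos (hu i)]
  exact (hu i).choose_spec

theorem IsWeakPartial.weakPartial_eq (hD : D.Admissible) {i : Fin 2} {u g : D.H}
    (h : D.IsWeakPartial i u g) : D.weakPartial i u = g := by
  have hex : ∃ g : D.H, D.IsWeakPartial i u g := ⟨g, h⟩
  refine IsWeakPartial.unique hD (i := i) (u := u) ?_ h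
  unfold weakPartial
  rw [dif_pos hex]
  exact hex.choose_spec

theorem IsWeakPartial.add (hD : D.Admissible) {i : Fin 2} {u w g k : D.H}
    (h : D.IsWeakPartial i u g) (h' : D.IsWeakPartial i w k) :
    D.IsWeakPartial i (u + w) (g + k) := by
  rw [isWeakPartial_iff hD] at *
  have L : ∀ f : D.H, LocallyIntegrable (D.ext f) := fun f => locallyIntegrable_ext hD (Lp.memLp f)
  have e : ∀ f f' : D.H, ∀ᵐ x, D.ext f x + D.ext f' x = D.ext (f + f' : D.H) x := by
    intro f f'
    filter_upwards [ext_congr hD (Lp.coeFn_add f f')] with x hx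
    rw [hx]; exact (ext_add _ _ x).symm
  refine (h.add h' (L u) (L w) (L g) (L k)).congr ?_ ?_
  · filter_upwards [e u w] with x hx _ using hx
  · filter_upwards [e g k] with x hx _ using hx

theorem IsWeakPartial.smul (hD : D.Admissible) {i : Fin 2} {u g : D.H}
    (h : D.IsWeakPartial i u g) (c : ℝ) : D.IsWeakPartial i (c • u) (c • g) := by
  rw [isWeakPartial_iff hD] at *
  have e : ∀ f : D.H, ∀ᵐ x, c * D.ext f x = D.ext (c • f : D.H) x := by
    intro f
    filter_upwards [ext_congr hD (Lp.coeFn_smul c f)] with x hx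
    rw [hx]; exact (ext_const_mul c _ x).symm
  refine (h.const_mul c).congr ?_ ?_
  · filter_upwards [e u] with x hx _ using hx
  · filter_upwards [e g] with x hx _ using hx

theorem isWeakPartial_zero (i : Fin 2) : D.IsWeakPartial i 0 0 := by
  intro φ _
  have h0 : ((0 : D.H) : Plane → ℝ) =ᵐ[D.μ] 0 := Lp.coeFn_zero ℝ 2 D.μ
  rw [integral_congr_ae (g := fun _ => 0), integral_congr_ae (f := fun x => (0 : D.H) x * φ x)
    (g := fun _ => 0)]
  · simp
  · filter_upwards [h0] with x hx; rw [hx, Pi.zero_apply, zero_mul]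
  · filter_upwards [h0] with x hx; rw [hx, Pi.zero_apply, zero_mul]

/-- `H¹` as a subspace. -/
def H1Sub (D : Setting) (hD : D.Admissible) : Submodule ℝ D.H where
  carrier := D.H1
  add_mem' hu hw i :=
    ⟨_, (isWeakPartial_weakPartial hu i).add hD (isWeakPartial_weakPartial hw i)⟩
  zero_mem' i := ⟨0, isWeakPartial_zero i⟩
  smul_mem' c _ hu i := ⟨_, (isWeakPartial_weakPartial hu i).smul hD c⟩

theorem weakPartial_add (hD : D.Admissible) {u w : D.H} (hu : u ∈ D.H1) (hw : w ∈ D.H1)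
    (i : Fin 2) : D.weakPartial i (u + w) = D.weakPartial i u + D.weakPartial i w :=
  ((isWeakPartial_weakPartial hu i).add hD (isWeakPartial_weakPartial hw i)).weakPartial_eq hD

theorem weakPartial_smul (hD : D.Admissible) {u : D.H} (hu : u ∈ D.H1) (c : ℝ)
    (i : Fin 2) : D.weakPartial i (c • u) = c • D.weakPartial i u :=
  ((isWeakPartial_weakPartial hu i).smul hD c).weakPartial_eq hD

theorem sub_mem_H1 (hD : D.Admissible) {u w : D.H} (hu : u ∈ D.H1) (hw : w ∈ D.H1) :
    u - w ∈ D.H1 := (D.H1Sub hD).sub_mem hu hw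

theorem weakPartial_sub (hD : D.Admissible) {u w : D.H} (hu : u ∈ D.H1) (hw : w ∈ D.H1)
    (i : Fin 2) : D.weakPartial i (u - w) = D.weakPartial i u - D.weakPartial i w := by
  have h := weakPartial_add hD (sub_mem_H1 hD hu hw) hw i
  rw [sub_add_cancel] at h
  rw [h]; abel

theorem gradInner_sub_left (hD : D.Admissible) {u v : D.H} (hu : u ∈ D.H1) (hv : v ∈ D.H1)
    (w : D.H) : D.gradInner (u - v) w = D.gradInner u w - D.gradInner v w := by
  simp only [gradInner, weakPartial_sub hD hu hv, inner_sub_left, Finset.sum_sub_distrib]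

theorem lap_sub (hD : D.Admissible) {u v : D.H} (hu : u ∈ D.H2) (hv : v ∈ D.H2) :
    D.lap (u - v) = D.lap u - D.lap v := by
  unfold lap
  rw [← Finset.sum_sub_distrib]
  refine Finset.sum_congr rfl fun i _ => ?_
  rw [weakPartial_sub hD hu.1 hv.1, weakPartial_sub hD (hu.2 i) (hv.2 i)]

theorem sub_mem_V (hD : D.Admissible) {u v : D.H} (hu : u ∈ D.V) (hv : v ∈ D.V) :
    u - v ∈ D.V := by
  refine ⟨⟨sub_mem_H1 hD hu.1.1 hv.1.1, fun i => ?_⟩, fun w hw => ?_⟩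
  · rw [weakPartial_sub hD hu.1.1 hv.1.1]
    exact sub_mem_H1 hD (hu.1.2 i) (hv.1.2 i)
  · rw [gradInner_sub_left hD hu.1.1 hv.1.1, lap_sub hD hu.1 hv.1, inner_sub_left, hu.2 w hw,
      hv.2 w hw]
    ring

theorem gradInner_self (u : D.H) : D.gradInner u u = ∑ i, ‖D.weakPartial i u‖ ^ 2 := by
  simp [gradInner]

theorem gradInner_self_nonneg (u : D.H) : 0 ≤ D.gradInner u u := by
  rw [gradInner_self]; positivity

theorem h1Norm_nonneg (u : D.H) : 0 ≤ D.h1Norm u := Real.sqrt_nonneg _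

theorem h1Norm_sq (u : D.H) : D.h1Norm u ^ 2 = ‖u‖ ^ 2 + D.gradInner u u :=
  Real.sq_sqrt (add_nonneg (by positivity) (gradInner_self_nonneg u))

theorem norm_le_h1Norm (u : D.H) : ‖u‖ ≤ D.h1Norm u := by
  apply Real.le_sqrt_of_sq_le
  linarith [gradInner_self_nonneg u]

theorem norm_weakPartial_le_h1Norm (u : D.H) (i : Fin 2) : ‖D.weakPartial i u‖ ≤ D.h1Norm u := by
  apply Real.le_sqrt_of_sq_le
  rw [gradInner_self]
  have := Finset.single_le_sum (f := fun i => ‖D.weakPartial i u‖ ^ 2)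
    (fun i _ => by positivity) (Finset.mem_univ i)
  nlinarith [sq_nonneg ‖u‖]

theorem h1Norm_smul (hD : D.Admissible) {u : D.H} (hu : u ∈ D.H1) (c : ℝ) :
    D.h1Norm (c • u) = |c| * D.h1Norm u := by
  rw [← Real.sqrt_sq (abs_nonneg c), h1Norm, h1Norm, ← Real.sqrt_mul (by positivity)]
  congr 1
  rw [gradInner_self, gradInner_self]
  simp only [weakPartial_smul hD hu, norm_smul, mul_pow, Real.norm_eq_abs]
  rw [mul_add, Finset.mul_sum]

/-- The norm of `H²`. -/
def h2Norm (D : Setting) (u : D.H) : ℝ :=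
  Real.sqrt (D.h1Norm u ^ 2 + ∑ i, ∑ j, ‖D.weakPartial i (D.weakPartial j u)‖ ^ 2)

theorem h2Norm_sq (u : D.H) : D.h2Norm u ^ 2 =
    D.h1Norm u ^ 2 + ∑ i, ∑ j, ‖D.weakPartial i (D.weakPartial j u)‖ ^ 2 :=
  Real.sq_sqrt (by positivity)

theorem h2Norm_nonneg (u : D.H) : 0 ≤ D.h2Norm u := Real.sqrt_nonneg _

theorem h1Norm_le_h2Norm (u : D.H) : D.h1Norm u ≤ D.h2Norm u := by
  apply Real.le_sqrt_of_sq_le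
  have : 0 ≤ ∑ i, ∑ j, ‖D.weakPartial i (D.weakPartial j u)‖ ^ 2 := by positivity
  linarith

theorem norm_weakPartial_weakPartial_le (u : D.H) (i j : Fin 2) :
    ‖D.weakPartial i (D.weakPartial j u)‖ ≤ D.h2Norm u := by
  apply Real.le_sqrt_of_sq_le
  have h1 := Finset.single_le_sum (f := fun i => ∑ j, ‖D.weakPartial i (D.weakPartial j u)‖ ^ 2)
    (fun i _ => by positivity) (Finset.mem_univ i)
  have h2 := Finset.single_le_sum (f := fun j => ‖D.weakPartial i (D.weakPartial j u)‖ ^ 2)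
    (fun i _ => by positivity) (Finset.mem_univ j)
  nlinarith [sq_nonneg (D.h1Norm u)]

theorem h1Norm_weakPartial_le (u : D.H) (j : Fin 2) :
    D.h1Norm (D.weakPartial j u) ≤ D.h2Norm u := by
  apply Real.sqrt_le_sqrt
  rw [gradInner_self, h1Norm_sq, gradInner_self, Fin.sum_univ_two, Fin.sum_univ_two,
    Fin.sum_univ_two, Fin.sum_univ_two, Fin.sum_univ_two]
  fin_cases j
  · simp only [Fin.zero_eta]; nlinarith [sq_nonneg ‖u‖, sq_nonneg ‖D.weakPartial 1 u‖,
      sq_nonneg ‖D.weakPartial 0 (D.weakPartial 1 u)‖,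
      sq_nonneg ‖D.weakPartial 1 (D.weakPartial 1 u)‖]
  · simp only [Fin.mk_one]; nlinarith [sq_nonneg ‖u‖, sq_nonneg ‖D.weakPartial 0 u‖,
      sq_nonneg ‖D.weakPartial 0 (D.weakPartial 0 u)‖,
      sq_nonneg ‖D.weakPartial 1 (D.weakPartial 0 u)‖]

/-- The product of two functions in `H¹` satisfies the product rule. -/
theorem hasWeakDeriv_ext_mul (hD : D.Admissible) {i : Fin 2} {u w g k : D.H}
    (h : D.IsWeakPartial i u g) (h' : D.IsWeakPartial i w k) :
    HasWeakDeriv D.localDomain (EuclideanSpace.single i 1) (D.ext fun x => u x * w x)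
      (D.ext fun x => g x * w x + u x * k x) := by
  rw [isWeakPartial_iff hD] at h h'
  have M : ∀ f : D.H, ∀ K, IsCompact K → MemLp (D.ext f) 2 (volume.restrict K) :=
    fun f K hK => memLp_ext hD (Lp.memLp f) K hK
  have := h.mul h' (isOpen_localDomain hD) (M u) (M g) (M w) (M k)
  have e1 : (D.ext fun x => u x * w x) = fun x => D.ext u x * D.ext w x := by
    ext x; exact ext_mul _ _ x
  have e2 : (D.ext fun x => g x * w x + u x * k x)
      = fun x => D.ext g x * D.ext w x + D.ext u x * D.ext k x := by
    ext x
    rw [ext_add (fun x => g x * w x) (fun x => u x * k x) x, ext_mul, ext_mul]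
  rw [e1, e2]; exact this

theorem IsWeakPartial.mul (hD : D.Admissible) {i : Fin 2} {u w g k z y : D.H}
    (h : D.IsWeakPartial i u g) (h' : D.IsWeakPartial i w k)
    (hz : z =ᵐ[D.μ] fun x => u x * w x) (hy : y =ᵐ[D.μ] fun x => g x * w x + u x * k x) :
    D.IsWeakPartial i z y := by
  rw [isWeakPartial_iff hD]
  refine (hasWeakDeriv_ext_mul hD h h').congr ?_ ?_
  · filter_upwards [ext_congr hD hz] with x hx _ using hx.symm
  · filter_upwards [ext_congr hD hy] with x hx _ using hx.symm

end Setting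

/-! ### Global Sobolev embeddings -/

theorem HasWeakDeriv.of_partials {O : Set Plane} {F : Plane → ℝ} {G : Fin 2 → Plane → ℝ}
    (h : ∀ i, HasWeakDeriv O (EuclideanSpace.single i 1) F (G i)) (hF : Integrable F)
    (hG : ∀ i, Integrable (G i)) (e : Plane) :
    HasWeakDeriv O e F (fun x => e 0 * G 0 x + e 1 * G 1 x) := by
  have := (h 0).comb_dir (h 1) hF.locallyIntegrable (hG 0).locallyIntegrable
    (hG 1).locallyIntegrable (e 0) (e 1)
  convert this using 1
  ext i; fin_cases i <;> simp

theorem enorm_comb_le {e : Plane} (he : ‖e‖ = 1) (a b : ℝ) :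
    ‖e 0 * a + e 1 * b‖ₑ ≤ ‖a‖ₑ + ‖b‖ₑ := by
  have hi : ∀ i, ‖e i‖ₑ ≤ 1 := by
    intro i
    rw [← ofReal_norm, ENNReal.ofReal_le_one, ← he]
    exact PiLp.norm_apply_le e i
  refine (enorm_add_le _ _).trans ?_
  rw [enorm_mul, enorm_mul]
  exact add_le_add (mul_le_of_le_one_left' (hi 0)) (mul_le_of_le_one_left' (hi 1))

namespace Setting

variable {D : Setting}

theorem integrable_indicator_openRegion (hD : D.Admissible) {f : Plane → ℝ}
    (hf : Integrable f D.μ) : Integrable (D.openRegion.indicator f) := by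
  rw [integrable_indicator_iff (isOpen_openRegion hD).measurableSet, IntegrableOn, ← μ_eq]
  exact hf

/-- Cutting off by an indicator creates no boundary terms, because only test functions supported
inside the open region are admitted. It provides globally integrable functions, as the frame
estimates require. -/
theorem hasWeakDeriv_indicator (hD : D.Admissible) {e : Plane} {f g : Plane → ℝ}
    {F G : Plane → ℝ}
    (h : HasWeakDeriv D.localDomain e (D.ext F) (D.ext G)) (hf : f =ᵐ[D.μ] F) (hg : g =ᵐ[D.μ] G) :
    HasWeakDeriv D.openRegion e (D.openRegion.indicator f) (D.openRegion.indicator g) := by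
  have key : ∀ {f F : Plane → ℝ}, f =ᵐ[D.μ] F →
      ∀ᵐ x, x ∈ D.openRegion → D.ext F x = D.openRegion.indicator f x := by
    intro f F h
    filter_upwards [(ae_μ_iff hD).1 h] with x hx hxO
    rw [ext_of_mem hxO, indicator_of_mem hxO, hx hxO]
  exact (h.mono openRegion_subset_localDomain).congr (key hf) (key hg)

/-- The Sobolev embedding `W^{1,1} ⊂ L²`. -/
theorem exists_lintegral_sq_le (hD : D.Admissible) : ∃ C : ℝ≥0, ∀ (f : Plane → ℝ)
    (g : Fin 2 → Plane → ℝ), Measurable f → (∀ i, Measurable (g i)) → Integrable f D.μ →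
    (∀ i, Integrable (g i) D.μ) →
    (∀ i, HasWeakDeriv D.openRegion (EuclideanSpace.single i 1) (D.openRegion.indicator f)
      (D.openRegion.indicator (g i))) →
    ∫⁻ x, ‖f x‖ₑ ^ 2 ∂D.μ ≤ C * (∫⁻ x, (‖f x‖ₑ + (‖g 0 x‖ₑ + ‖g 1 x‖ₑ)) ∂D.μ) ^ 2 := by
  obtain ⟨h, hh, ι, hι, W, b, hW, hcov, hWO⟩ := hasFrames_openRegion hD
  set O := D.openRegion with hO
  have oO : IsOpen O := isOpen_openRegion hD
  -- Each of the finitely many frame sets contributes two line factors, and each factor is bounded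
  -- by `(h⁻¹ + 1)` times the `W^{1,1}` norm.
  refine ⟨Fintype.card ι * (h⁻¹.toNNReal + 1) ^ 2, fun f g mf mg hf hg hd => ?_⟩
  set c := ENNReal.ofReal h⁻¹ with hc
  set I := ∫⁻ x, (‖f x‖ₑ + (‖g 0 x‖ₑ + ‖g 1 x‖ₑ)) ∂D.μ with hI
  have iF := integrable_indicator_openRegion hD hf
  have iG := fun i => integrable_indicator_openRegion hD (hg i)
  have mF : Measurable (O.indicator f) := mf.indicator oO.measurableSet
  have mG : ∀ i, Measurable (O.indicator (g i)) := fun i => (mg i).indicator oO.measurableSet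
  have hside : ∀ e : Plane, ‖e‖ = 1 → ∫⁻ x in O, (c * ‖O.indicator f x‖ₑ
      + ‖e 0 * O.indicator (g 0) x + e 1 * O.indicator (g 1) x‖ₑ) ≤ (c + 1) * I := by
    intro e he
    rw [hI, μ_eq, ← hO, ← lintegral_const_mul' _ _ (by simp [hc])]
    apply setLIntegral_mono_ae' oO.measurableSet
    refine Eventually.of_forall fun x hx => ?_
    simp only [indicator_of_mem hx]
    calc c * ‖f x‖ₑ + ‖e 0 * g 0 x + e 1 * g 1 x‖ₑ
        ≤ c * ‖f x‖ₑ + (‖g 0 x‖ₑ + ‖g 1 x‖ₑ) := by gcongr; exact enorm_comb_le he _ _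
      _ ≤ (c + 1) * ‖f x‖ₑ + (c + 1) * (‖g 0 x‖ₑ + ‖g 1 x‖ₑ) := by
          gcongr
          · exact le_self_add
          · exact le_mul_of_one_le_left' le_add_self
      _ = _ := by ring
  have hk : ∀ k, ∫⁻ x in W k, ‖O.indicator f x‖ₑ ^ 2 ≤ ((c + 1) * I) ^ 2 := by
    intro k
    have d : ∀ e : Plane, HasWeakDeriv O e (O.indicator f)
        (fun x => e 0 * O.indicator (g 0) x + e 1 * O.indicator (g 1) x) :=
      fun e => HasWeakDeriv.of_partials (G := fun i => O.indicator (g i)) hd iF iG e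
    have iGe : ∀ e : Plane, Integrable
        (fun x => e 0 * O.indicator (g 0) x + e 1 * O.indicator (g 1) x) :=
      fun e => ((iG 0).const_mul _).add ((iG 1).const_mul _)
    have mGe : ∀ e : Plane, Measurable
        (fun x => e 0 * O.indicator (g 0) x + e 1 * O.indicator (g 1) x) :=
      fun e => ((mG 0).const_mul _).add ((mG 1).const_mul _)
    refine (lintegral_sq_le_of_frame (b k) (d (b k 0)) (d (b k 1)) iF (iGe _) (iGe _) mF (mGe _)
      (mGe _) oO (hW k) hh (hWO k)).trans ?_
    rw [sq]
    exact mul_le_mul' (hside _ ((b k).norm_eq_one 0)) (hside _ ((b k).norm_eq_one 1))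
  have hcc : ((h⁻¹.toNNReal : ℝ≥0) : ℝ≥0∞) = c := rfl
  calc ∫⁻ x, ‖f x‖ₑ ^ 2 ∂D.μ = ∫⁻ x in O, ‖O.indicator f x‖ₑ ^ 2 := by
        rw [μ_eq]
        apply setLIntegral_congr_fun oO.measurableSet
        intro x hx
        simp only
        rw [indicator_of_mem hx]
    _ ≤ ∫⁻ x in ⋃ k, W k, ‖O.indicator f x‖ₑ ^ 2 := lintegral_mono_set hcov
    _ ≤ ∑' k, ∫⁻ x in W k, ‖O.indicator f x‖ₑ ^ 2 := lintegral_iUnion_le _ _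
    _ ≤ ∑ k : ι, ((c + 1) * I) ^ 2 := by
        rw [tsum_fintype]
        exact Finset.sum_le_sum fun k _ => hk k
    _ = _ := by
        rw [Finset.sum_const, Finset.card_univ, nsmul_eq_mul, mul_pow]
        push_cast
        rw [hcc]; ring

/-- The Sobolev embedding `W^{2,1} ⊂ L^∞`. -/
theorem exists_enorm_le_lintegral (hD : D.Admissible) : ∃ C : ℝ≥0, ∀ (f : Plane → ℝ)
    (g : Fin 2 → Plane → ℝ) (k : Fin 2 → Fin 2 → Plane → ℝ), Measurable f →
    (∀ i, Measurable (g i)) → (∀ i j, Measurable (k i j)) → Integrable f D.μ →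
    (∀ i, Integrable (g i) D.μ) → (∀ i j, Integrable (k i j) D.μ) →
    (∀ i, HasWeakDeriv D.openRegion (EuclideanSpace.single i 1) (D.openRegion.indicator f)
      (D.openRegion.indicator (g i))) →
    (∀ i j, HasWeakDeriv D.openRegion (EuclideanSpace.single j 1) (D.openRegion.indicator (g i))
      (D.openRegion.indicator (k i j))) →
    ∀ᵐ x ∂D.μ, ‖f x‖ₑ ≤ C * ((∫⁻ x, ‖f x‖ₑ ∂D.μ) + (∑ i, ∫⁻ x, ‖g i x‖ₑ ∂D.μ)
      + ∑ i, ∑ j, ∫⁻ x, ‖k i j x‖ₑ ∂D.μ) := by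
  obtain ⟨h, hh, ι, hι, W, b, hW, hcov, hWO⟩ := hasFrames_openRegion hD
  set O := D.openRegion with hO
  have oO : IsOpen O := isOpen_openRegion hD
  refine ⟨(h⁻¹.toNNReal + 1) ^ 2, fun f g k mf mg mk hf hg hk hd hdd => ?_⟩
  set c := ENNReal.ofReal h⁻¹ with hc
  have iF := integrable_indicator_openRegion hD hf
  have iG := fun i => integrable_indicator_openRegion hD (hg i)
  have iK := fun i j => integrable_indicator_openRegion hD (hk i j)
  have mF : Measurable (O.indicator f) := mf.indicator oO.measurableSet
  have mG : ∀ i, Measurable (O.indicator (g i)) := fun i => (mg i).indicator oO.measurableSet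
  have mK : ∀ i j, Measurable (O.indicator (k i j)) :=
    fun i j => (mk i j).indicator oO.measurableSet
  have d : ∀ e : Plane, HasWeakDeriv O e (O.indicator f)
      (fun x => e 0 * O.indicator (g 0) x + e 1 * O.indicator (g 1) x) :=
    fun e => HasWeakDeriv.of_partials (G := fun i => O.indicator (g i)) hd iF iG e
  have dg : ∀ (i : Fin 2) (e : Plane), HasWeakDeriv O e (O.indicator (g i))
      (fun x => e 0 * O.indicator (k i 0) x + e 1 * O.indicator (k i 1) x) :=
    fun i e => HasWeakDeriv.of_partials (G := fun j => O.indicator (k i j)) (hdd i) (iG i) (iK i) e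
  have iGe : ∀ e : Plane, Integrable
      (fun x => e 0 * O.indicator (g 0) x + e 1 * O.indicator (g 1) x) :=
    fun e => ((iG 0).const_mul _).add ((iG 1).const_mul _)
  have mGe : ∀ e : Plane, Measurable
      (fun x => e 0 * O.indicator (g 0) x + e 1 * O.indicator (g 1) x) :=
    fun e => ((mG 0).const_mul _).add ((mG 1).const_mul _)
  have iKe : ∀ i (e : Plane), Integrable
      (fun x => e 0 * O.indicator (k i 0) x + e 1 * O.indicator (k i 1) x) :=
    fun i e => ((iK i 0).const_mul _).add ((iK i 1).const_mul _)
  have mKe : ∀ i (e : Plane), Measurable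
      (fun x => e 0 * O.indicator (k i 0) x + e 1 * O.indicator (k i 1) x) :=
    fun i e => ((mK i 0).const_mul _).add ((mK i 1).const_mul _)
  have hae : ∀ q, ∀ᵐ x, x ∈ W q → ‖O.indicator f x‖ₑ ≤
      (c + 1) ^ 2 * ((∫⁻ x, ‖f x‖ₑ ∂D.μ) + (∑ i, ∫⁻ x, ‖g i x‖ₑ ∂D.μ)
      + ∑ i, ∑ j, ∫⁻ x, ‖k i j x‖ₑ ∂D.μ) := by
    intro q
    -- The mixed second derivative along the frame, as a combination of the coordinate second
    -- derivatives with coefficients at most `1` in absolute value.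
    have d2 : HasWeakDeriv O (b q 1)
        (fun x => b q 0 0 * O.indicator (g 0) x + b q 0 1 * O.indicator (g 1) x)
        (fun x => b q 0 0 * (b q 1 0 * O.indicator (k 0 0) x + b q 1 1 * O.indicator (k 0 1) x)
          + b q 0 1 * (b q 1 0 * O.indicator (k 1 0) x + b q 1 1 * O.indicator (k 1 1) x)) :=
      ((dg 0 (b q 1)).const_mul _).add ((dg 1 (b q 1)).const_mul _)
        ((iG 0).const_mul _).locallyIntegrable ((iG 1).const_mul _).locallyIntegrable
        ((iKe 0 _).const_mul _).locallyIntegrable ((iKe 1 _).const_mul _).locallyIntegrable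
    have main := enorm_le_lintegral_of_frame (b q) (d (b q 0)) (d (b q 1)) d2 iF (iGe _) (iGe _)
      (((iKe 0 _).const_mul _).add ((iKe 1 _).const_mul _)) mF (mGe _) (mGe _)
      (((mKe 0 _).const_mul _).add ((mKe 1 _).const_mul _)) oO (hW q) hh (hWO q)
    filter_upwards [main] with x hx hxW
    refine (hx hxW).trans ?_
    have e0 := (b q).norm_eq_one 0
    have e1 := (b q).norm_eq_one 1
    have c1 : (1 : ℝ≥0∞) ≤ (c + 1) ^ 2 := one_le_pow₀ le_add_self
    have c2 : c ≤ (c + 1) ^ 2 := le_self_add.trans (le_self_pow₀ le_add_self (by norm_num))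
    have c3 : c * c ≤ (c + 1) ^ 2 := by
      rw [sq]; exact mul_le_mul' le_self_add le_self_add
    have c4 : c + c ≤ (c + 1) ^ 2 := by
      have : (c + 1) ^ 2 = c * c + (c + c) + 1 := by ring
      rw [this]; exact le_add_self.trans le_self_add
    have hpt : ∀ y ∈ O, c * (c * ‖O.indicator f y‖ₑ
        + ‖b q 1 0 * O.indicator (g 0) y + b q 1 1 * O.indicator (g 1) y‖ₑ)
        + (c * ‖b q 0 0 * O.indicator (g 0) y + b q 0 1 * O.indicator (g 1) y‖ₑ
        + ‖b q 0 0 * (b q 1 0 * O.indicator (k 0 0) y + b q 1 1 * O.indicator (k 0 1) y)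
          + b q 0 1 * (b q 1 0 * O.indicator (k 1 0) y + b q 1 1 * O.indicator (k 1 1) y)‖ₑ)
        ≤ (c + 1) ^ 2 * (‖f y‖ₑ + (‖g 0 y‖ₑ + ‖g 1 y‖ₑ)
          + ((‖k 0 0 y‖ₑ + ‖k 0 1 y‖ₑ) + (‖k 1 0 y‖ₑ + ‖k 1 1 y‖ₑ))) := by
      intro y hy
      simp only [indicator_of_mem hy]
      calc _ ≤ c * (c * ‖f y‖ₑ + (‖g 0 y‖ₑ + ‖g 1 y‖ₑ)) + (c * (‖g 0 y‖ₑ + ‖g 1 y‖ₑ)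
            + ((‖k 0 0 y‖ₑ + ‖k 0 1 y‖ₑ) + (‖k 1 0 y‖ₑ + ‖k 1 1 y‖ₑ))) := by
            gcongr
            · exact enorm_comb_le e1 _ _
            · exact enorm_comb_le e0 _ _
            · exact (enorm_comb_le e0 _ _).trans
                (add_le_add (enorm_comb_le e1 _ _) (enorm_comb_le e1 _ _))
        _ = c * c * ‖f y‖ₑ + (c + c) * (‖g 0 y‖ₑ + ‖g 1 y‖ₑ)
            + 1 * ((‖k 0 0 y‖ₑ + ‖k 0 1 y‖ₑ) + (‖k 1 0 y‖ₑ + ‖k 1 1 y‖ₑ)) := by ring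
        _ ≤ (c + 1) ^ 2 * ‖f y‖ₑ + (c + 1) ^ 2 * (‖g 0 y‖ₑ + ‖g 1 y‖ₑ)
            + (c + 1) ^ 2 * ((‖k 0 0 y‖ₑ + ‖k 0 1 y‖ₑ) + (‖k 1 0 y‖ₑ + ‖k 1 1 y‖ₑ)) := by gcongr
        _ = _ := by ring
    refine (setLIntegral_mono' oO.measurableSet hpt).trans (le_of_eq ?_)
    have n : ∀ {F : Plane → ℝ}, Measurable F → Measurable fun x => ‖F x‖ₑ := fun h => h.enorm
    rw [lintegral_const_mul' _ _ (by simp [hc]), μ_eq]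
    simp only [Fin.sum_univ_two]
    have m1 : Measurable fun x => ‖f x‖ₑ + (‖g 0 x‖ₑ + ‖g 1 x‖ₑ) :=
      (n mf).add ((n (mg 0)).add (n (mg 1)))
    have m2 : Measurable fun x => ‖k 0 0 x‖ₑ + ‖k 0 1 x‖ₑ := (n (mk 0 0)).add (n (mk 0 1))
    rw [lintegral_add_left m1, lintegral_add_left (n mf), lintegral_add_left (n (mg 0)),
      lintegral_add_left m2, lintegral_add_left (n (mk 0 0)), lintegral_add_left (n (mk 1 0))]
  rw [ae_μ_iff hD]
  filter_upwards [ae_all_iff.2 hae] with x hx hxO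
  obtain ⟨q, hq⟩ := mem_iUnion.1 (hcov hxO)
  have := hx q hq
  rw [indicator_of_mem hxO] at this
  refine this.trans (le_of_eq ?_)
  push_cast; rfl

end Setting

/-! ### Ladyzhenskaya's inequality and the pointwise bound in H² -/

theorem coeFn_toL2 {α E : Type*} [MeasurableSpace α] [NormedAddCommGroup E] {ν : Measure α}
    {f : α → E} (h : MemLp f 2 ν) : toL2 ν f =ᵐ[ν] f := by
  rw [toL2, dif_pos h]; exact h.coeFn_toLp

theorem lintegral_enorm_mul_le {α : Type*} [MeasurableSpace α] {ν : Measure α} (u w : Lp ℝ 2 ν) :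
    ∫⁻ x, ‖u x * w x‖ₑ ∂ν ≤ ENNReal.ofReal (‖u‖ * ‖w‖) := by
  have := eLpNorm_smul_le_mul_eLpNorm (p := 2) (q := 2) (r := 1) (μ := ν) (f := w) (φ := u)
    (Lp.aestronglyMeasurable w) (Lp.aestronglyMeasurable u)
  rw [eLpNorm_one_eq_lintegral_enorm] at this
  rw [ENNReal.ofReal_mul (norm_nonneg _), ofReal_norm, ofReal_norm, Lp.enorm_def, Lp.enorm_def]
  exact this

theorem integrable_mul_Lp {α : Type*} [MeasurableSpace α] {ν : Measure α} (u w : Lp ℝ 2 ν) :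
    Integrable (fun x => u x * w x) ν :=
  ⟨(Lp.aestronglyMeasurable u).mul (Lp.aestronglyMeasurable w),
    (lintegral_enorm_mul_le u w).trans_lt ENNReal.ofReal_lt_top⟩

namespace Setting

variable {D : Setting}

/-- The pointwise product, provided it is square integrable. -/
def mul (u w : D.H) : D.H := toL2 D.μ fun x => u x * w x

/-- The embedding `W^{1,1} ⊂ L²` is applied to `u²`, whose gradient is `2 u ∇u`. -/
theorem exists_sq_bound (hD : D.Admissible) : ∃ C : ℝ, 0 ≤ C ∧ ∀ u ∈ D.H1,
    MemLp (fun x => u x * u x) 2 D.μ ∧ ‖mul u u‖ ≤ C * (‖u‖ * D.h1Norm u) := by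
  obtain ⟨C, hC⟩ := exists_lintegral_sq_le hD
  -- `5 = 1 + 2 + 2`: one for the `L¹` norm of `u²` and two for each partial derivative.
  refine ⟨√C * 5, by positivity, fun u hu => ?_⟩
  have mL : ∀ f : D.H, Measurable (f : Plane → ℝ) := fun f => (Lp.stronglyMeasurable f).measurable
  set N := ‖u‖ * D.h1Norm u with hN
  have hN0 : 0 ≤ N := mul_nonneg (norm_nonneg _) (h1Norm_nonneg u)
  have hgi : ∀ i, Integrable (fun x => 2 * (u x * D.weakPartial i u x)) D.μ :=
    fun i => (integrable_mul_Lp u (D.weakPartial i u)).const_mul 2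
  have key := hC (fun x => u x * u x) (fun i x => 2 * (u x * D.weakPartial i u x))
    ((mL u).mul (mL u)) (fun i => ((mL u).mul (mL _)).const_mul 2) (integrable_mul_Lp u u) hgi
    (fun i => hasWeakDeriv_indicator hD (hasWeakDeriv_ext_mul hD (isWeakPartial_weakPartial hu i)
      (isWeakPartial_weakPartial hu i)) (ae_eq_refl _) (ae_of_all _ fun x => by ring))
  have hb : ∀ i, ∫⁻ x, ‖2 * (u x * D.weakPartial i u x)‖ₑ ∂D.μ ≤ ENNReal.ofReal (2 * N) := by
    intro i
    simp_rw [enorm_mul (2 : ℝ)]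
    rw [lintegral_const_mul' _ _ (by simp), ENNReal.ofReal_mul zero_le_two,
      ← Real.enorm_of_nonneg (zero_le_two (α := ℝ))]
    gcongr
    refine (lintegral_enorm_mul_le _ _).trans (ENNReal.ofReal_le_ofReal ?_)
    exact mul_le_mul_of_nonneg_left (norm_weakPartial_le_h1Norm u i) (norm_nonneg _)
  have hb0 : ∫⁻ x, ‖u x * u x‖ₑ ∂D.μ ≤ ENNReal.ofReal N := by
    refine (lintegral_enorm_mul_le _ _).trans (ENNReal.ofReal_le_ofReal ?_)
    exact mul_le_mul_of_nonneg_left (norm_le_h1Norm u) (norm_nonneg _)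
  have m0 : Measurable fun x => ‖u x * u x‖ₑ := ((mL u).mul (mL u)).enorm
  have m1 : Measurable fun x => ‖2 * (u x * D.weakPartial 0 u x)‖ₑ :=
    (((mL u).mul (mL _)).const_mul 2).enorm
  rw [lintegral_add_left m0, lintegral_add_left m1] at key
  have key2 : ∫⁻ x, ‖u x * u x‖ₑ ^ 2 ∂D.μ ≤ ENNReal.ofReal ((√C * 5 * N) ^ 2) := by
    refine key.trans ?_
    calc _ ≤ (C : ℝ≥0∞) * (ENNReal.ofReal N + (ENNReal.ofReal (2 * N) + ENNReal.ofReal (2 * N)))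
          ^ 2 := by
          gcongr
          · exact hb 0
          · exact hb 1
      _ = _ := by
          rw [← ENNReal.ofReal_add (by positivity) (by positivity),
            ← ENNReal.ofReal_add (by positivity) (by positivity), ← ENNReal.ofReal_pow (by positivity),
            ← ENNReal.ofReal_coe_nnreal, ← ENNReal.ofReal_mul (by positivity)]
          congr 1
          rw [mul_pow, mul_pow, Real.sq_sqrt (by positivity)]; ring
  have e2 : eLpNorm (fun x => u x * u x) 2 D.μ ^ 2 = ∫⁻ x, ‖u x * u x‖ₑ ^ 2 ∂D.μ := by
    have := eLpNorm_nnreal_pow_eq_lintegral (f := fun x => u x * u x) (μ := D.μ) (p := 2) (by simp)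
    simpa using this
  have hle : eLpNorm (fun x => u x * u x) 2 D.μ ≤ ENNReal.ofReal (√C * 5 * N) := by
    rw [← e2, ENNReal.ofReal_pow (by positivity)] at key2
    exact (ENNReal.pow_le_pow_left_iff two_ne_zero).1 key2
  have hm : MemLp (fun x => u x * u x) 2 D.μ :=
    ⟨((mL u).mul (mL u)).aestronglyMeasurable, hle.trans_lt ENNReal.ofReal_lt_top⟩
  refine ⟨hm, ?_⟩
  rw [mul, toL2, dif_pos hm, Lp.norm_toLp]
  exact ENNReal.toReal_le_of_le_ofReal (by positivity) hle

/-- Ladyzhenskaya's inequality for products. -/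
theorem exists_mul_bound (hD : D.Admissible) : ∃ C : ℝ, 0 ≤ C ∧ ∀ u ∈ D.H1, ∀ w ∈ D.H1,
    mul u w =ᵐ[D.μ] (fun x => u x * w x) ∧
      ‖mul u w‖ ^ 2 ≤ C ^ 2 * ((‖u‖ * D.h1Norm u) * (‖w‖ * D.h1Norm w)) := by
  obtain ⟨C, hC0, hC⟩ := exists_sq_bound hD
  refine ⟨C, hC0, fun u hu w hw => ?_⟩
  obtain ⟨mu, bu⟩ := hC u hu
  obtain ⟨mw, bw⟩ := hC w hw
  have hm : MemLp (fun x => u x * w x) 2 D.μ := by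
    refine (mu.add mw).mono ((Lp.aestronglyMeasurable u).mul (Lp.aestronglyMeasurable w))
      (ae_of_all _ fun x => ?_)
    simp only [Pi.add_apply, Real.norm_eq_abs]
    have h0 : 0 ≤ u x * u x + w x * w x :=
      add_nonneg (mul_self_nonneg (u x)) (mul_self_nonneg (w x))
    rw [abs_of_nonneg h0, abs_le]
    constructor <;> nlinarith [mul_self_nonneg (u x + w x), mul_self_nonneg (u x - w x),
      mul_self_nonneg (u x), mul_self_nonneg (w x)]
  have h := coeFn_toL2 hm
  refine ⟨h, ?_⟩
  -- Both sides are the integral of `u² w²`, so the bound for squares and Cauchy–Schwarz give the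
  -- bound for products.
  have e : ‖mul u w‖ ^ 2 = inner ℝ (mul u u) (mul w w) := by
    rw [← real_inner_self_eq_norm_sq, L2.inner_def, L2.inner_def]
    refine integral_congr_ae ?_
    filter_upwards [h, coeFn_toL2 mu, coeFn_toL2 mw] with x h1 h2 h3
    simp only [mul, h1, h2, h3, RCLike.inner_apply, conj_trivial]; ring
  rw [e]
  calc _ ≤ ‖mul u u‖ * ‖mul w w‖ := real_inner_le_norm _ _
    _ ≤ (C * (‖u‖ * D.h1Norm u)) * (C * (‖w‖ * D.h1Norm w)) := by
        gcongr
        exact mul_nonneg hC0 (mul_nonneg (norm_nonneg _) (h1Norm_nonneg _))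
    _ = _ := by ring

theorem isWeakPartial_mul (hD : D.Admissible) {i : Fin 2} {u w : D.H} (hu : u ∈ D.H1)
    (hw : w ∈ D.H1) {y : D.H}
    (hy : y =ᵐ[D.μ] fun x => D.weakPartial i u x * w x + u x * D.weakPartial i w x) :
    D.IsWeakPartial i (mul u w) y := by
  obtain ⟨C, hC0, hC⟩ := exists_mul_bound hD
  exact (isWeakPartial_weakPartial hu i).mul hD (isWeakPartial_weakPartial hw i) (hC u hu w hw).1 hy

/-- A pointwise bound for functions in `H²`. -/
theorem exists_cube_bound (hD : D.Admissible) : ∃ C : ℝ, 0 ≤ C ∧ ∀ u ∈ D.H2,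
    ∀ᵐ x ∂D.μ, |u x| ^ 3 ≤ C * (D.h1Norm u ^ 2 * D.h2Norm u) := by
  obtain ⟨C, hC0, hC⟩ := exists_mul_bound hD
  obtain ⟨B, hB⟩ := exists_enorm_le_lintegral hD
  -- `43 = 1 + 2 · 3 + 4 · 9`: the function `u³`, its two first derivatives and its four second
  -- derivatives.
  refine ⟨B * (43 * C), by positivity, fun u hu => ?_⟩
  set Q := D.h1Norm u ^ 2 * D.h2Norm u with hQ
  have a0 := h1Norm_nonneg u
  have a1 := h1Norm_le_h2Norm u
  have a2 := h2Norm_nonneg u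
  have hQ0 : 0 ≤ Q := by positivity
  have mL : ∀ f : D.H, Measurable (f : Plane → ℝ) := fun f => (Lp.stronglyMeasurable f).measurable
  have hu1 := hu.1
  set z := mul u u with hz
  have zc := (hC u hu1 u hu1).1
  have zb : ‖z‖ ≤ C * D.h1Norm u ^ 2 := by
    refine abs_le_of_sq_le_sq' ?_ (by positivity) |>.2
    refine (hC u hu1 u hu1).2.trans ?_
    rw [mul_pow]
    gcongr
    have := mul_le_mul_of_nonneg_right (norm_le_h1Norm u) a0
    calc _ ≤ (D.h1Norm u * D.h1Norm u) * (D.h1Norm u * D.h1Norm u) := by gcongr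
      _ = _ := by ring
  set m := fun i => mul u (D.weakPartial i u) with hm
  have mc : ∀ i, m i =ᵐ[D.μ] fun x => u x * D.weakPartial i u x :=
    fun i => (hC u hu1 _ (hu.2 i)).1
  -- After squaring, the product bound gives five powers of the `H¹` norm and one of the `H²` norm;
  -- one of the five is traded for a second power of the `H²` norm.
  have mb : ∀ i, ‖m i‖ * D.h1Norm u ≤ C * Q := by
    intro i
    refine abs_le_of_sq_le_sq' ?_ (by positivity) |>.2
    have h1 := (hC u hu1 _ (hu.2 i)).2
    have h2 := norm_weakPartial_le_h1Norm u i
    have h3 := h1Norm_weakPartial_le u i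
    have h4 := norm_le_h1Norm u
    have h5 := h1Norm_nonneg (D.weakPartial i u)
    have h6 := h2Norm_nonneg u
    calc (‖m i‖ * D.h1Norm u) ^ 2 = ‖m i‖ ^ 2 * D.h1Norm u ^ 2 := by ring
      _ ≤ C ^ 2 * ((‖u‖ * D.h1Norm u) * (‖D.weakPartial i u‖ * D.h1Norm (D.weakPartial i u)))
          * D.h1Norm u ^ 2 := by gcongr
      _ ≤ C ^ 2 * ((D.h1Norm u * D.h1Norm u) * (D.h1Norm u * D.h2Norm u)) * D.h1Norm u ^ 2 := by
          gcongr
      _ = C ^ 2 * (D.h1Norm u ^ 4 * D.h2Norm u) * D.h1Norm u := by ring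
      _ ≤ C ^ 2 * (D.h1Norm u ^ 4 * D.h2Norm u) * D.h2Norm u := by gcongr
      _ = _ := by rw [hQ]; ring
  have zd : ∀ i, D.IsWeakPartial i z ((2 : ℝ) • m i) := by
    intro i
    refine isWeakPartial_mul hD hu1 hu1 ?_
    filter_upwards [Lp.coeFn_smul (2 : ℝ) (m i), mc i] with x h1 h2
    rw [h1, Pi.smul_apply, h2, smul_eq_mul]; ring
  have z3 : ∀ i, D.IsWeakPartial i ((3 : ℝ) • z) ((3 : ℝ) • (2 : ℝ) • m i) :=
    fun i => (zd i).smul hD 3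
  set p := fun i => D.weakPartial i u with hp
  set q := fun i j => D.weakPartial j (D.weakPartial i u) with hq
  set y := fun j => (3 : ℝ) • (2 : ℝ) • m j with hy
  set w := (3 : ℝ) • z with hw
  -- The embedding `W^{2,1} ⊂ L^∞` is applied to `u³ = u² · u`, with `∂u³ = 3 u² ∂u` and second
  -- derivatives `6 u ∂u ∂u + 3 u² ∂∂u`. Every product is paired so that both factors lie in `L²`.
  have key := hB (fun x => z x * u x) (fun i x => w x * p i x)
    (fun i j x => y j x * p i x + w x * q i j x) ((mL _).mul (mL _))
    (fun i => (mL _).mul (mL _)) (fun i j => ((mL _).mul (mL _)).add ((mL _).mul (mL _)))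
    (integrable_mul_Lp _ _) (fun i => integrable_mul_Lp _ _)
    (fun i j => (integrable_mul_Lp _ _).add (integrable_mul_Lp _ _))
    (fun i => hasWeakDeriv_indicator hD (hasWeakDeriv_ext_mul hD (zd i)
      (isWeakPartial_weakPartial hu1 i)) (ae_eq_refl _) (by
        filter_upwards [zc, Lp.coeFn_smul (3 : ℝ) z, Lp.coeFn_smul (2 : ℝ) (m i), mc i]
          with x h1 h2 h3 h4
        simp only [hw, h2, h3, Pi.smul_apply, smul_eq_mul, h4, hp]
        rw [show z x = u x * u x from h1]; ring))
    (fun i j => hasWeakDeriv_indicator hD (hasWeakDeriv_ext_mul hD (z3 j)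
      (isWeakPartial_weakPartial (hu.2 i) j)) (ae_eq_refl _) (ae_eq_refl _))
  have nw : ‖w‖ ≤ 3 * (C * D.h1Norm u ^ 2) := by
    rw [hw, norm_smul, Real.norm_of_nonneg (by norm_num)]; gcongr
  have ny : ∀ j, ‖y j‖ = 6 * ‖m j‖ := by
    intro j
    rw [hy, norm_smul, norm_smul, Real.norm_of_nonneg (by norm_num),
      Real.norm_of_nonneg (by norm_num)]; ring
  have hQ1 : D.h1Norm u ^ 2 * D.h1Norm u ≤ Q :=
    mul_le_mul_of_nonneg_left a1 (sq_nonneg _)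
  have bf : ∫⁻ x, ‖z x * u x‖ₑ ∂D.μ ≤ ENNReal.ofReal (C * Q) := by
    refine (lintegral_enorm_mul_le _ _).trans (ENNReal.ofReal_le_ofReal ?_)
    calc _ ≤ C * D.h1Norm u ^ 2 * D.h1Norm u := by gcongr; exact norm_le_h1Norm u
      _ ≤ _ := by rw [mul_assoc]; gcongr
  have bg : ∀ i, ∫⁻ x, ‖w x * p i x‖ₑ ∂D.μ ≤ ENNReal.ofReal (3 * C * Q) := by
    intro i
    refine (lintegral_enorm_mul_le _ _).trans (ENNReal.ofReal_le_ofReal ?_)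
    calc _ ≤ 3 * (C * D.h1Norm u ^ 2) * D.h1Norm u := by
          gcongr; exact norm_weakPartial_le_h1Norm u i
      _ = 3 * C * (D.h1Norm u ^ 2 * D.h1Norm u) := by ring
      _ ≤ _ := by gcongr
  have bk : ∀ i j, ∫⁻ x, ‖y j x * p i x + w x * q i j x‖ₑ ∂D.μ ≤ ENNReal.ofReal (9 * C * Q) := by
    intro i j
    have mm : Measurable fun x => ‖y j x * p i x‖ₑ := ((mL _).mul (mL _)).enorm
    calc _ ≤ ∫⁻ x, (‖y j x * p i x‖ₑ + ‖w x * q i j x‖ₑ) ∂D.μ :=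
          lintegral_mono fun x => enorm_add_le _ _
      _ ≤ ENNReal.ofReal (6 * (C * Q)) + ENNReal.ofReal (3 * C * Q) := by
          rw [lintegral_add_left mm]
          refine add_le_add ((lintegral_enorm_mul_le _ _).trans (ENNReal.ofReal_le_ofReal ?_))
            ((lintegral_enorm_mul_le _ _).trans (ENNReal.ofReal_le_ofReal ?_))
          · rw [ny, mul_assoc]
            have := mb j
            have h2 := mul_le_mul_of_nonneg_left (norm_weakPartial_le_h1Norm u i)
              (norm_nonneg (m j))
            exact mul_le_mul_of_nonneg_left (h2.trans this) (by norm_num)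
          · calc _ ≤ 3 * (C * D.h1Norm u ^ 2) * D.h2Norm u := by
                  gcongr; exact norm_weakPartial_weakPartial_le u j i
              _ = _ := by rw [hQ]; ring
      _ = _ := by
          rw [← ENNReal.ofReal_add (by positivity) (by positivity)]; congr 1; ring
  filter_upwards [key, zc] with x hx hzx
  have hS : (∫⁻ x, ‖z x * u x‖ₑ ∂D.μ) + (∑ i, ∫⁻ x, ‖w x * p i x‖ₑ ∂D.μ)
      + ∑ i, ∑ j, ∫⁻ x, ‖y j x * p i x + w x * q i j x‖ₑ ∂D.μ ≤ ENNReal.ofReal (43 * C * Q) := by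
    calc _ ≤ ENNReal.ofReal (C * Q) + (∑ i : Fin 2, ENNReal.ofReal (3 * C * Q))
          + ∑ i : Fin 2, ∑ j : Fin 2, ENNReal.ofReal (9 * C * Q) :=
          add_le_add (add_le_add bf (Finset.sum_le_sum fun i _ => bg i))
            (Finset.sum_le_sum fun i _ => Finset.sum_le_sum fun j _ => bk i j)
      _ = _ := by
          simp only [Fin.sum_univ_two]
          have : 0 ≤ C * Q := by positivity
          repeat rw [← ENNReal.ofReal_add (by positivity) (by positivity)]
          congr 1; ring
  have h2 := hx.trans (mul_le_mul_right hS (B : ℝ≥0∞))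
  rw [← ENNReal.ofReal_coe_nnreal, ← ENNReal.ofReal_mul (by positivity), ← ofReal_norm,
    ENNReal.ofReal_le_ofReal_iff (by positivity)] at h2
  rw [show z x = u x * u x from hzx, Real.norm_eq_abs] at h2
  calc |u x| ^ 3 = |u x * u x * u x| := by rw [abs_mul, abs_mul]; ring
    _ ≤ _ := h2.trans (le_of_eq (by ring))

end Setting

/-! ### An energy inequality without time derivatives -/

theorem abs_integral_inner_le {α E : Type*} [MeasurableSpace α] {ν : Measure α}
    [NormedAddCommGroup E] [InnerProductSpace ℝ E] {f g : α → E}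
    (hf : MemLp f 2 ν) (hg : MemLp g 2 ν) :
    |∫ x, inner ℝ (f x) (g x) ∂ν| ≤ (eLpNorm f 2 ν).toReal * (eLpNorm g 2 ν).toReal := by
  have h1 : inner ℝ (hf.toLp f) (hg.toLp g) = ∫ x, inner ℝ (f x) (g x) ∂ν := by
    rw [L2.inner_def]
    apply integral_congr_ae
    filter_upwards [hf.coeFn_toLp, hg.coeFn_toLp] with x h1 h2
    rw [h1, h2]
  rw [← h1, ← Lp.norm_toLp f hf, ← Lp.norm_toLp g hg]
  exact abs_real_inner_le_norm _ _

theorem integrable_inner_of_memLp_two {α E : Type*} [MeasurableSpace α] {ν : Measure α}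
    [NormedAddCommGroup E] [InnerProductSpace ℝ E] {f g : α → E}
    (hf : MemLp f 2 ν) (hg : MemLp g 2 ν) : Integrable (fun x => inner ℝ (f x) (g x)) ν := by
  refine (L2.integrable_inner (𝕜 := ℝ) (hf.toLp f) (hg.toLp g)).congr ?_
  filter_upwards [hf.coeFn_toLp, hg.coeFn_toLp] with x h1 h2
  rw [h1, h2]

section

variable {E : Type*} [NormedAddCommGroup E] [InnerProductSpace ℝ E]

theorem tendsto_integral_inner_translate {A B : ℝ → E} (hA : MemLp A 2) (hB : MemLp B 2) :
    Tendsto (fun r => ∫ t, inner ℝ (A (t - r)) (B t)) (𝓝 0) (𝓝 (∫ t, inner ℝ (A t) (B t))) := by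
  have hA' : ∀ r, MemLp (fun t => A (t - r)) 2 := fun r => by
    simpa only [sub_eq_add_neg] using memLp_translate hA (-r)
  rw [tendsto_iff_norm_sub_tendsto_zero]
  have h0 : Tendsto (fun r : ℝ => eLpNorm (fun t => A (t - r) - A t) 2 volume) (𝓝 0) (𝓝 0) := by
    have h1 : Tendsto (fun r : ℝ => -r) (𝓝 0) (𝓝 0) := by simpa using tendsto_neg (0 : ℝ)
    simpa only [sub_eq_add_neg, Function.comp_def] using
      (tendsto_eLpNorm_translate_sub volume hA).comp h1
  have h1 := ((ENNReal.tendsto_toReal (by simp)).comp h0).mul_const (eLpNorm B 2 volume).toReal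
  simp only [ENNReal.toReal_zero, zero_mul] at h1
  refine squeeze_zero (fun _ => norm_nonneg _) (fun r => ?_) h1
  rw [← integral_sub (integrable_inner_of_memLp_two (hA' r) hB) (integrable_inner_of_memLp_two hA hB)]
  simp only [← inner_sub_left]
  exact abs_integral_inner_le ((hA' r).sub hA) hB

/-- The integrand is dominated by `‖A(t-r)‖² + ‖B(t)‖²`, restricted to `r ∈ [0,h]`; the first
summand is a convolution integrand. -/
theorem integrable_inner_translate {A B : ℝ → E} (hA : MemLp A 2) (hB : MemLp B 2) (h : ℝ) :
    Integrable (fun p : ℝ × ℝ => (Icc 0 h).indicator (fun r => inner ℝ (A (p.1 - r)) (B p.1)) p.2)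
      (volume.prod volume) := by
  have i1 : Integrable ((Icc 0 h).indicator fun _ : ℝ => (1 : ℝ)) :=
    (integrable_indicator_iff measurableSet_Icc).2 (by simp)
  have c1 := i1.convolution_integrand (ContinuousLinearMap.mul ℝ ℝ) (μ := volume)
    hA.norm.integrable_sq
  have c2 := (hB.norm.integrable_sq).mul_prod i1
  refine (c1.add c2).mono' ?_ (ae_of_all _ fun p => ?_)
  · have e : (fun p : ℝ × ℝ => (Icc 0 h).indicator (fun r => inner ℝ (A (p.1 - r)) (B p.1)) p.2)
        = (Prod.snd ⁻¹' Icc 0 h).indicator fun p : ℝ × ℝ => inner ℝ (A (p.1 - p.2)) (B p.1) := by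
      ext p; by_cases hp : p.2 ∈ Icc 0 h <;> simp [indicator, hp]
    rw [e]
    refine AEStronglyMeasurable.indicator ?_ (measurable_snd measurableSet_Icc)
    exact (hA.1.comp_quasiMeasurePreserving
      (quasiMeasurePreserving_sub_of_right_invariant volume volume)).inner hB.1.comp_fst
  · by_cases hp : p.2 ∈ Icc 0 h
    · simp only [indicator_of_mem hp, Pi.add_apply, ContinuousLinearMap.mul_apply', one_mul, mul_one]
      refine (norm_inner_le_norm _ _).trans ?_
      nlinarith [sq_nonneg (‖A (p.1 - p.2)‖ - ‖B p.1‖), sq_nonneg ‖A (p.1 - p.2)‖,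
        sq_nonneg ‖B p.1‖]
    · simp [indicator_of_notMem hp]

/-- The energy inequality for `d' = ∑ⱼ Dⱼ^* Aⱼ`, where the test space depends on time. -/
theorem norm_sq_sub_le_integral {ι : Type*} [Fintype ι] {T : ℝ} {d : ℝ → E} {A B : ι → ℝ → E}
    (hd : ContinuousOn d (Icc 0 T)) (hA : ∀ j, MemLp (A j) 2 (volume.restrict (Icc 0 T)))
    (hB : ∀ j, MemLp (B j) 2 (volume.restrict (Icc 0 T)))
    (hw : ∀ᵐ t ∂(volume.restrict (Icc 0 T)), ∀ s ∈ Icc 0 t,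
      inner ℝ (d t - d s) (d t) = ∫ r in s..t, ∑ j, inner ℝ (A j r) (B j t))
    {τ : ℝ} (hτ : τ ∈ Icc 0 T) :
    ‖d τ‖ ^ 2 - ‖d 0‖ ^ 2 ≤ 2 * ∫ t in (0 : ℝ)..τ, ∑ j, inner ℝ (A j t) (B j t) := by
  rcases hτ.1.eq_or_lt with h0 | h0
  · subst h0; simp
  have hsub : Ioc 0 τ ⊆ Icc 0 T := fun x hx => ⟨hx.1.le, hx.2.trans hτ.2⟩
  have ext0 : ∀ {F : ℝ → E}, MemLp F 2 (volume.restrict (Icc 0 T)) →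
      MemLp ((Ioc 0 τ).indicator F) 2 := fun hF =>
    (memLp_indicator_iff_restrict measurableSet_Ioc).2
      (hF.mono_measure (Measure.restrict_mono_set _ hsub))
  set A' := fun j => (Ioc 0 τ).indicator (A j) with hA'
  set B' := fun j => (Ioc 0 τ).indicator (B j) with hB'
  have mA : ∀ j, MemLp (A' j) 2 := fun j => ext0 (hA j)
  have mB : ∀ j, MemLp (B' j) 2 := fun j => ext0 (hB j)
  -- Extending by the initial value to negative times makes the increments over a step `h`
  -- telescope, leaving `h ‖d 0‖²` at the lower end.
  set g : ℝ → ℝ := fun t => ‖d (projIcc 0 τ h0.le t)‖ ^ 2 with hg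
  have gc : Continuous g := by
    have : Continuous fun t => d (projIcc 0 τ h0.le t) :=
      (hd.mono (Icc_subset_Icc_right hτ.2)).domRestrict.comp continuous_projIcc
    exact this.norm.pow 2
  have g0 : ∀ t ≤ 0, g t = ‖d 0‖ ^ 2 := fun t ht => by
    simp only [hg]; rw [projIcc_of_le_left _ ht]
  have gτ : g τ = ‖d τ‖ ^ 2 := by simp only [hg]; rw [projIcc_of_right_le _ le_rfl]
  have gm : ∀ t ∈ Icc 0 τ, g t = ‖d t‖ ^ 2 := fun t ht => by
    simp only [hg]; rw [projIcc_of_mem _ ht]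
  -- `Φ r` pairs the equation at time `t - r` with the test function at time `t`. It is continuous
  -- at `0` because translation is continuous in `L²`.
  set Φ : ℝ → ℝ := fun r => ∑ j, ∫ t, inner ℝ (A' j (t - r)) (B' j t) with hΦ
  have Φ0 : ∑ j, ∫ t, inner ℝ (A' j t) (B' j t)
      = ∫ t in (0 : ℝ)..τ, ∑ j, inner ℝ (A j t) (B j t) := by
    rw [intervalIntegral.integral_of_le h0.le, ← integral_indicator measurableSet_Ioc,
      ← integral_finsetSum _ fun j _ => integrable_inner_of_memLp_two (mA j) (mB j)]
    congr 1; ext t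
    by_cases ht : t ∈ Ioc 0 τ <;> simp [hA', hB', ht]
  have Φt : Tendsto Φ (𝓝 0) (𝓝 (∑ j, ∫ t, inner ℝ (A' j t) (B' j t))) :=
    tendsto_finsetSum _ fun j _ => tendsto_integral_inner_translate (mA j) (mB j)
  rw [Φ0] at Φt
  set I := ∫ t in (0 : ℝ)..τ, ∑ j, inner ℝ (A j t) (B j t) with hI
  have iΦ : ∀ h, Integrable fun r => ∑ j, (Icc 0 h).indicator
      (fun r => ∫ t, inner ℝ (A' j (t - r)) (B' j t)) r := by
    refine fun h => integrable_finsetSum _ fun j _ =>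
      (integrable_inner_translate (mA j) (mB j) h).integral_prod_right.congr (ae_of_all _ fun r => ?_)
    by_cases hr : r ∈ Icc 0 h <;> simp [hr]
  have eΦ : ∀ h, (fun r => ∑ j, (Icc 0 h).indicator
      (fun r => ∫ t, inner ℝ (A' j (t - r)) (B' j t)) r) = (Icc 0 h).indicator Φ := by
    intro h
    ext r
    by_cases hr : r ∈ Icc 0 h <;> simp [hr, hΦ]
  have step : ∀ h ∈ Ioo 0 τ, (∫ t in (τ - h)..τ, g t) - h * ‖d 0‖ ^ 2
      ≤ 2 * ∫ r in (0 : ℝ)..h, Φ r := by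
    intro h hh
    have iF := fun j => integrable_inner_translate (mA j) (mB j) h
    have pt : ∀ᵐ t, t ∈ Ioc 0 τ → g t - g (t - h) ≤
        2 * ∑ j, ∫ r, (Icc 0 h).indicator (fun r => inner ℝ (A' j (t - r)) (B' j t)) r := by
      have hw' := (ae_restrict_iff' measurableSet_Icc).1 hw
      filter_upwards [hw', ae_all_iff.2 fun j => (iF j).prod_right_ae] with t ht hi htτ
      have hs : max (t - h) 0 ∈ Icc 0 t := ⟨le_max_right _ _, max_le (by linarith [hh.1]) htτ.1.le⟩
      have e1 : g (t - h) = ‖d (max (t - h) 0)‖ ^ 2 := by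
        rcases le_total (t - h) 0 with h1 | h1
        · rw [max_eq_right h1, g0 _ h1]
        · rw [max_eq_left h1, gm _ ⟨h1, by linarith [hh.1, htτ.2]⟩]
      have e2 := ht (hsub htτ) _ hs
      have e3 : ∑ j, ∫ r, (Icc 0 h).indicator (fun r => inner ℝ (A' j (t - r)) (B' j t)) r
          = ∫ r in (max (t - h) 0)..t, ∑ j, inner ℝ (A j r) (B j t) := by
        rw [← integral_finsetSum _ fun j _ => hi j]
        have : ∀ r, ∑ j, (Icc 0 h).indicator (fun r => inner ℝ (A' j (t - r)) (B' j t)) r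
            = (Icc 0 h).indicator (fun r => ∑ j, inner ℝ (A' j (t - r)) (B' j t)) r := by
          intro r
          by_cases hr : r ∈ Icc 0 h
          · simp only [indicator_of_mem hr]
          · simp only [indicator_of_notMem hr, Finset.sum_const_zero]
        simp_rw [this]
        rw [integral_indicator measurableSet_Icc, integral_Icc_eq_integral_Ioc,
          ← intervalIntegral.integral_of_le hh.1.le,
          intervalIntegral.integral_comp_sub_left (fun r => ∑ j, inner ℝ (A' j r) (B' j t)), sub_zero,
          intervalIntegral.integral_of_le (by linarith [hh.1]), intervalIntegral.integral_of_le hs.2]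
        have e4 : ∀ r, ∑ j, inner ℝ (A' j r) (B' j t)
            = (Ioc 0 τ).indicator (fun r => ∑ j, inner ℝ (A j r) (B j t)) r := by
          intro r
          by_cases hr : r ∈ Ioc 0 τ <;> simp [hA', hB', hr, htτ]
        simp_rw [e4]
        rw [setIntegral_indicator measurableSet_Ioc, Ioc_inter_Ioc, min_eq_left htτ.2]
      -- Convexity of the square: `‖a‖² - ‖b‖² ≤ 2 ⟨a - b, a⟩`, with `a = d t` and `b` the value one
      -- step earlier. Only testing with the later value is needed.
      rw [e3, e1, gm t ⟨htτ.1.le, htτ.2⟩, ← e2, inner_sub_left, real_inner_self_eq_norm_sq]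
      nlinarith [real_inner_le_norm (d (max (t - h) 0)) (d t),
        sq_nonneg (‖d t‖ - ‖d (max (t - h) 0)‖)]
    have gh : Continuous fun t => g (t - h) := gc.comp (continuous_sub_right h)
    have iG : IntervalIntegrable (fun t => g t - g (t - h)) volume 0 τ :=
      (gc.sub gh).intervalIntegrable _ _
    have iR : Integrable (fun t => 2 * ∑ j, ∫ r, (Icc 0 h).indicator
        (fun r => inner ℝ (A' j (t - r)) (B' j t)) r) :=
      (integrable_finsetSum _ fun j _ => (iF j).integral_prod_left).const_mul 2
    have m := setIntegral_mono_on_ae ((intervalIntegrable_iff_integrableOn_Ioc_of_le h0.le).1 iG)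
      iR.integrableOn measurableSet_Ioc pt
    rw [← intervalIntegral.integral_of_le h0.le, intervalIntegral.integral_sub
      (gc.intervalIntegrable _ _) (gh.intervalIntegrable _ _),
      intervalIntegral.integral_comp_sub_right g,
      intervalIntegral.integral_interval_sub_interval_comm' (gc.intervalIntegrable _ _)
        (gc.intervalIntegrable _ _) (gc.intervalIntegrable _ _)] at m
    have c : ∫ t in (0 - h)..0, g t = h * ‖d 0‖ ^ 2 := by
      rw [intervalIntegral.integral_congr (g := fun _ => ‖d 0‖ ^ 2), intervalIntegral.integral_const]
      · simp
      · intro t ht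
        rw [uIcc_of_le (by linarith [hh.1])] at ht
        exact g0 t ht.2
    rw [c] at m
    refine m.trans (le_of_eq ?_)
    have e5 : ∫ t in Ioc 0 τ, 2 * ∑ j, ∫ r, (Icc 0 h).indicator
        (fun r => inner ℝ (A' j (t - r)) (B' j t)) r = ∫ t, 2 * ∑ j, ∫ r, (Icc 0 h).indicator
        (fun r => inner ℝ (A' j (t - r)) (B' j t)) r := by
      refine setIntegral_eq_integral_of_forall_compl_eq_zero fun t ht => ?_
      simp [hB', ht]
    rw [e5, integral_const_mul, integral_finsetSum _ fun j _ => (iF j).integral_prod_left]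
    congr 1
    have e6 : ∀ j, ∫ t, ∫ r, (Icc 0 h).indicator (fun r => inner ℝ (A' j (t - r)) (B' j t)) r
        = ∫ r, (Icc 0 h).indicator (fun r => ∫ t, inner ℝ (A' j (t - r)) (B' j t)) r := by
      intro j
      rw [integral_integral_swap (iF j)]
      congr 1; ext r
      by_cases hr : r ∈ Icc 0 h <;> simp [hr]
    simp_rw [e6]
    have i7 : ∀ j, Integrable fun r => (Icc 0 h).indicator
        (fun r => ∫ t, inner ℝ (A' j (t - r)) (B' j t)) r := by
      intro j
      refine (iF j).integral_prod_right.congr (ae_of_all _ fun r => ?_)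
      by_cases hr : r ∈ Icc 0 h <;> simp [hr]
    rw [← integral_finsetSum _ fun j _ => i7 j, intervalIntegral.integral_of_le hh.1.le,
      ← integral_Icc_eq_integral_Ioc, ← integral_indicator measurableSet_Icc, eΦ h]
  refine le_of_forall_pos_le_add fun η hη => ?_
  have hη4 : 0 < η / 4 := by positivity
  obtain ⟨δ₁, hδ₁, h1⟩ := Metric.tendsto_nhds_nhds.1 Φt (η / 4) hη4
  obtain ⟨δ₂, hδ₂, h2⟩ := Metric.continuous_iff.1 gc τ (η / 4) hη4
  -- With `h` this small, both averages over windows of length `h` are within `η / 4` of their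
  -- limits; dividing by `h` concludes.
  set h := min (min δ₁ δ₂ / 2) (τ / 2) with hh
  have hpos : 0 < h := by positivity
  have hlt1 : h < δ₁ := by
    have := min_le_left (min δ₁ δ₂ / 2) (τ / 2)
    have := min_le_left δ₁ δ₂
    linarith
  have hlt2 : h < δ₂ := by
    have := min_le_left (min δ₁ δ₂ / 2) (τ / 2)
    have := min_le_right δ₁ δ₂
    linarith
  have hltτ : h < τ := by
    have := min_le_right (min δ₁ δ₂ / 2) (τ / 2)
    linarith
  have key := step h ⟨hpos, hltτ⟩
  have b1 : h * (‖d τ‖ ^ 2 - η / 4) ≤ ∫ t in (τ - h)..τ, g t := by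
    have := intervalIntegral.integral_mono_on (μ := volume) (a := τ - h) (b := τ) (f := fun _ => ‖d τ‖ ^ 2 - η / 4)
      (g := g) (by linarith) intervalIntegrable_const (gc.intervalIntegrable _ _) (fun t ht => by
        have := h2 t (by rw [Real.dist_eq, abs_lt]; constructor <;> linarith [ht.1, ht.2])
        rw [Real.dist_eq, abs_lt, gτ] at this
        linarith [this.1])
    rwa [intervalIntegral.integral_const, sub_sub_cancel, smul_eq_mul] at this
  have b2 : ∫ r in (0 : ℝ)..h, Φ r ≤ h * (I + η / 4) := by
    have hi : IntervalIntegrable Φ volume 0 h := by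
      have := iΦ h
      rw [eΦ h, integrable_indicator_iff measurableSet_Icc] at this
      exact (intervalIntegrable_iff_integrableOn_Icc_of_le hpos.le).2 this
    have := intervalIntegral.integral_mono_on (μ := volume) (a := 0) (b := h) (f := Φ)
      (g := fun _ => I + η / 4) hpos.le hi (by simp) (fun t ht => by
        have := h1 (x := t) (by
          rw [Real.dist_eq, sub_zero, abs_lt]; constructor <;> linarith [ht.1, ht.2])
        rw [Real.dist_eq, abs_lt] at this
        linarith [this.2])
    rwa [intervalIntegral.integral_const, sub_zero, smul_eq_mul] at this
  have : h * (‖d τ‖ ^ 2 - ‖d 0‖ ^ 2) ≤ h * (2 * I + η) := by nlinarith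
  exact le_of_mul_le_mul_left this hpos

end

/-! ### Continuous paths in L² and the dual norm -/

theorem toL2_congr {α E : Type*} [MeasurableSpace α] [NormedAddCommGroup E] {ν : Measure α}
    {f g : α → E} (h : f =ᵐ[ν] g) : toL2 ν f = toL2 ν g := by
  by_cases hf : MemLp f 2 ν
  · have hg := hf.ae_eq h
    rw [toL2, toL2, dif_pos hf, dif_pos hg, MemLp.toLp_eq_toLp_iff]
    exact h
  · have hg : ¬ MemLp g 2 ν := fun hg => hf (hg.ae_eq h.symm)
    rw [toL2, toL2, dif_neg hf, dif_neg hg]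

theorem toL2_sub {α E : Type*} [MeasurableSpace α] [NormedAddCommGroup E] {ν : Measure α}
    {f g : α → E} (hf : MemLp f 2 ν) (hg : MemLp g 2 ν) :
    toL2 ν f - toL2 ν g = toL2 ν (fun x => f x - g x) := by
  have h : MemLp (fun x => f x - g x) 2 ν := hf.sub hg
  rw [toL2, toL2, toL2, dif_pos hf, dif_pos hg, dif_pos h, ← MemLp.toLp_sub]
  rfl

theorem norm_toL2_sq {α : Type*} [MeasurableSpace α] {ν : Measure α}
    {f : α → ℝ} (hf : MemLp f 2 ν) : ‖toL2 ν f‖ ^ 2 = ∫ x, f x ^ 2 ∂ν := by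
  rw [← real_inner_self_eq_norm_sq, L2.inner_def]
  refine integral_congr_ae ?_
  filter_upwards [coeFn_toL2 hf] with x hx
  simp [hx, sq]

theorem inner_toL2 {α : Type*} [MeasurableSpace α] {ν : Measure α}
    {f : α → ℝ} (hf : MemLp f 2 ν) (w : Lp ℝ 2 ν) :
    inner ℝ (toL2 ν f) w = ∫ x, f x * w x ∂ν := by
  rw [L2.inner_def]
  refine integral_congr_ae ?_
  filter_upwards [coeFn_toL2 hf] with x hx
  simp [hx, mul_comm]

namespace Setting

variable {D : Setting}

theorem isCompact_closure_region (hD : D.Admissible) : IsCompact (closure D.region) := by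
  refine Bornology.IsBounded.isCompact_closure ?_
  cases D with
  | torus =>
    rw [isBounded_iff_forall_norm_le]
    exact ⟨_, fun x hx => norm_le_of_mem_region hx⟩
  | neumann U => exact hD.isBounded

theorem measurableSet_region (hD : D.Admissible) : MeasurableSet D.region := by
  cases D with
  | torus => exact measurableSet_region_torus
  | neumann U => exact hD.isOpen.measurableSet

theorem IsC0Path.continuousOn {T : ℝ} {z : ℝ → Plane → ℝ} (hz : D.IsC0Path T z) :
    ContinuousOn (fun q : ℝ × Plane => z q.1 q.2) (Icc 0 T ×ˢ closure D.region) := by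
  cases D with
  | torus => exact hz.1.mono (prod_mono_right (subset_univ _))
  | neumann U => exact hz

theorem IsC0Path.comp₂ {T : ℝ} {z y : ℝ → Plane → ℝ} (hz : D.IsC0Path T z) (hy : D.IsC0Path T y)
    {φ : ℝ → ℝ → ℝ} (hφ : Continuous fun q : ℝ × ℝ => φ q.1 q.2) :
    D.IsC0Path T fun t x => φ (z t x) (y t x) := by
  cases D with
  | torus =>
    refine ⟨hφ.comp_continuousOn (hz.1.prodMk hy.1), fun t ht i x => ?_⟩
    simp only [hz.2 t ht i x, hy.2 t ht i x]
  | neumann U => exact hφ.comp_continuousOn (ContinuousOn.prodMk hz hy)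

theorem IsC0Path.comp {T : ℝ} {z : ℝ → Plane → ℝ} (hz : D.IsC0Path T z)
    {φ : ℝ → ℝ} (hφ : Continuous φ) : D.IsC0Path T fun t x => φ (z t x) :=
  hz.comp₂ hz (φ := fun a _ => φ a) (by fun_prop)

theorem IsC0Path.exists_bound (hD : D.Admissible) {T : ℝ} {z : ℝ → Plane → ℝ}
    (hz : D.IsC0Path T z) : ∃ C, ∀ t ∈ Icc 0 T, ∀ x ∈ D.region, |z t x| ≤ C := by
  obtain ⟨C, hC⟩ := (isCompact_Icc.prod (isCompact_closure_region hD)).exists_bound_of_continuousOn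
    hz.continuousOn
  exact ⟨C, fun t ht x hx => hC (t, x) ⟨ht, subset_closure hx⟩⟩

theorem ae_mem_region (hD : D.Admissible) : ∀ᵐ x ∂D.μ, x ∈ D.region :=
  ae_restrict_mem (measurableSet_region hD)

theorem IsC0Path.aestronglyMeasurable (hD : D.Admissible) {T : ℝ} {z : ℝ → Plane → ℝ}
    (hz : D.IsC0Path T z) {t : ℝ} (ht : t ∈ Icc 0 T) : AEStronglyMeasurable (z t) D.μ := by
  refine ContinuousOn.aestronglyMeasurable ?_ (measurableSet_region hD)
  exact hz.continuousOn.comp (by fun_prop : ContinuousOn (fun x : Plane => (t, x)) D.region)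
    fun x hx => ⟨ht, subset_closure hx⟩

theorem IsC0Path.memLp (hD : D.Admissible) {T : ℝ} {z : ℝ → Plane → ℝ}
    (hz : D.IsC0Path T z) {t : ℝ} (ht : t ∈ Icc 0 T) : MemLp (z t) 2 D.μ := by
  have := isFiniteMeasure_μ hD
  obtain ⟨C, hC⟩ := hz.exists_bound hD
  refine MemLp.of_bound (hz.aestronglyMeasurable hD ht) C ?_
  filter_upwards [ae_mem_region hD] with x hx using hC t ht x hx

/-- A path in `C⁰` is a continuous path in `L²`. -/
theorem IsC0Path.continuousOn_toL2 (hD : D.Admissible) {T : ℝ} {z : ℝ → Plane → ℝ}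
    (hz : D.IsC0Path T z) : ContinuousOn (fun t => toL2 D.μ (z t)) (Icc 0 T) := by
  have := isFiniteMeasure_μ hD
  obtain ⟨C, hC⟩ := hz.exists_bound hD
  intro t₀ h0
  have key : ContinuousWithinAt (fun t => ∫ x, (z t x - z t₀ x) ^ 2 ∂D.μ) (Icc 0 T) t₀ := by
    refine continuousWithinAt_of_dominated (bound := fun _ => (C + C) ^ 2) ?_ ?_
      (integrable_const _) ?_
    · filter_upwards [self_mem_nhdsWithin] with t ht
      exact ((hz.aestronglyMeasurable hD ht).sub (hz.aestronglyMeasurable hD h0)).pow 2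
    · filter_upwards [self_mem_nhdsWithin] with t ht
      filter_upwards [ae_mem_region hD] with x hx
      rw [norm_pow]
      have := norm_sub_le (z t x) (z t₀ x)
      simp only [Real.norm_eq_abs] at *
      have := hC t ht x hx
      have := hC t₀ h0 x hx
      gcongr; linarith
    · filter_upwards [ae_mem_region hD] with x hx
      have : ContinuousWithinAt (fun t => z t x) (Icc 0 T) t₀ :=
        (hz.continuousOn.comp (by fun_prop : ContinuousOn (fun t : ℝ => (t, x)) (Icc 0 T))
          fun t ht => ⟨ht, subset_closure hx⟩) t₀ h0
      exact (this.sub continuousWithinAt_const).pow 2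
  have k2 : Tendsto (fun t => ∫ x, (z t x - z t₀ x) ^ 2 ∂D.μ) (𝓝[Icc 0 T] t₀) (𝓝 0) := by
    simpa [ContinuousWithinAt] using key
  rw [ContinuousWithinAt, tendsto_iff_norm_sub_tendsto_zero]
  have k3 := k2.sqrt
  rw [Real.sqrt_zero] at k3
  refine k3.congr' ?_
  filter_upwards [self_mem_nhdsWithin] with t ht
  have hm : MemLp (fun x => z t x - z t₀ x) 2 D.μ := (hz.memLp hD ht).sub (hz.memLp hD h0)
  rw [toL2_sub (hz.memLp hD ht) (hz.memLp hD h0), ← norm_toL2_sq hm, Real.sqrt_sq (norm_nonneg _)]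

/-! ### The dual norm -/

theorem hNegNorm_eq {w : Plane → ℝ} (hw : MemLp w 2 D.μ) : D.hNegNorm w =
    ⨆ φ : D.H, ⨆ _ : φ ∈ D.H1 ∧ D.h1Norm φ ≤ 1, ENNReal.ofReal |inner ℝ (toL2 D.μ w) φ| := by
  simp only [hNegNorm, inner_toL2 hw]

/-- The `L²` norm dominates. Finiteness is what makes `toReal` of the dual norm meaningful later. -/
theorem hNegNorm_ne_top {w : Plane → ℝ} (hw : MemLp w 2 D.μ) : D.hNegNorm w ≠ ⊤ := by
  refine ne_top_of_le_ne_top (ENNReal.ofReal_ne_top (r := ‖toL2 D.μ w‖)) ?_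
  rw [hNegNorm_eq hw]
  refine iSup₂_le fun φ hφ => ENNReal.ofReal_le_ofReal ?_
  refine (abs_real_inner_le_norm _ _).trans (mul_le_of_le_one_right (norm_nonneg _) ?_)
  exact (norm_le_h1Norm φ).trans hφ.2

theorem abs_integral_mul_le_hNegNorm (hD : D.Admissible) {w : Plane → ℝ} (hw : MemLp w 2 D.μ)
    {φ : D.H} (hφ : φ ∈ D.H1) :
    |∫ x, w x * φ x ∂D.μ| ≤ (D.hNegNorm w).toReal * D.h1Norm φ := by
  rw [← inner_toL2 hw]
  rcases (h1Norm_nonneg φ).eq_or_lt with h | h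
  · have h0 : φ = 0 := by
      rw [← norm_le_zero_iff, h]; exact norm_le_h1Norm φ
    rw [← h, h0]; simp
  · have h1 : D.h1Norm ((D.h1Norm φ)⁻¹ • φ) ≤ 1 := by
      rw [h1Norm_smul hD hφ, abs_of_pos (inv_pos.2 h), inv_mul_cancel₀ h.ne']
    have h2 : ENNReal.ofReal |inner ℝ (toL2 D.μ w) ((D.h1Norm φ)⁻¹ • φ)| ≤ D.hNegNorm w := by
      rw [hNegNorm_eq hw]
      exact le_iSup₂_of_le ((D.h1Norm φ)⁻¹ • φ) ⟨(H1Sub D hD).smul_mem _ hφ, h1⟩ le_rfl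
    have h3 := (ENNReal.ofReal_le_iff_le_toReal (hNegNorm_ne_top hw)).1 h2
    rw [inner_smul_right, abs_mul, abs_of_pos (inv_pos.2 h), inv_mul_le_iff₀ h] at h3
    linarith

/-- The supremum runs over an uncountable family, but each member is continuous in time, so the
supremum is lower semicontinuous and hence measurable. -/
theorem IsC0Path.aemeasurable_hNegNorm (hD : D.Admissible) {T : ℝ} (hT : 0 ≤ T)
    {z : ℝ → Plane → ℝ} (hz : D.IsC0Path T z) :
    AEMeasurable (fun t => D.hNegNorm (z t)) (volume.restrict (Icc 0 T)) := by
  have hc : Continuous fun t => toL2 D.μ (z (projIcc 0 T hT t)) :=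
    (hz.continuousOn_toL2 hD).domRestrict.comp continuous_projIcc
  have hm : Measurable fun t => ⨆ φ : D.H, ⨆ _ : φ ∈ D.H1 ∧ D.h1Norm φ ≤ 1,
      ENNReal.ofReal |inner ℝ (toL2 D.μ (z (projIcc 0 T hT t))) φ| := by
    refine LowerSemicontinuous.measurable (lowerSemicontinuous_iSup fun φ =>
      lowerSemicontinuous_iSup fun _ => Continuous.lowerSemicontinuous ?_)
    exact ENNReal.continuous_ofReal.comp (hc.inner continuous_const).abs
  refine hm.aemeasurable.congr ?_
  filter_upwards [ae_restrict_mem measurableSet_Icc] with t ht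
  rw [projIcc_of_mem hT ht, hNegNorm_eq (hz.memLp hD ht)]

end Setting

/-! ### The limiting equation: cubes in H² and the boundary condition -/

theorem ae_eq_zero_of_intervalIntegral_eq_zero {T : ℝ} (hT : 0 ≤ T) {g : ℝ → ℝ}
    (hg : IntegrableOn g (Icc 0 T)) (h : ∀ t ∈ Icc 0 T, ∫ s in (0 : ℝ)..t, g s = 0) :
    ∀ᵐ t ∂(volume.restrict (Icc 0 T)), g t = 0 := by
  have hi := (intervalIntegrable_iff_integrableOn_Icc_of_le hT).2 hg
  rw [← restrict_Ioo_eq_restrict_Icc, ae_restrict_iff' measurableSet_Ioo]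
  filter_upwards [hi.ae_hasDerivAt_integral] with t ht htT
  have h1 := ht (by rw [uIcc_of_le hT]; exact Ioo_subset_Icc_self htT) 0 left_mem_uIcc
  refine h1.unique ((hasDerivAt_const t (0 : ℝ)).congr_of_eventuallyEq ?_)
  filter_upwards [Ioo_mem_nhds htT.1 htT.2] with s hs using h s (Ioo_subset_Icc_self hs)

/-- The third power of the truncation at height `n`. -/
def clipCube (n : ℕ) (r : ℝ) : ℝ := (max (-(n : ℝ)) (min (n : ℝ) r)) ^ 3

theorem clipCube_of_abs_le {n : ℕ} {r : ℝ} (h : |r| ≤ n) : clipCube n r = r ^ 3 := by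
  rw [abs_le] at h
  rw [clipCube, min_eq_right h.2, max_eq_right h.1]

theorem lipschitzWith_clipCube (n : ℕ) : LipschitzWith (3 * n ^ 2 : ℝ≥0) (clipCube n) := by
  have h1 : LipschitzWith 1 fun r : ℝ => max (-(n : ℝ)) (min n r) :=
    (LipschitzWith.id.const_min (n : ℝ)).const_max (-(n : ℝ))
  refine LipschitzWith.of_dist_le_mul fun r s => ?_
  have h2 := h1.dist_le_mul r s
  have hb : ∀ r : ℝ, |max (-(n : ℝ)) (min n r)| ≤ n := fun r =>
    abs_le.2 ⟨le_max_left _ _, max_le (by linarith [n.cast_nonneg (α := ℝ)]) (min_le_left _ _)⟩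
  have ha := hb r
  have hc := hb s
  simp only [clipCube, Real.dist_eq, NNReal.coe_one, one_mul] at h2 ⊢
  set a := max (-(n : ℝ)) (min n r)
  set c := max (-(n : ℝ)) (min n s)
  rw [show a ^ 3 - c ^ 3 = (a ^ 2 + a * c + c ^ 2) * (a - c) by ring, abs_mul]
  have h3 : |a ^ 2 + a * c + c ^ 2| ≤ 3 * (n : ℝ) ^ 2 := by
    calc _ ≤ |a ^ 2 + a * c| + |c ^ 2| := abs_add_le _ _
      _ ≤ |a ^ 2| + |a * c| + |c ^ 2| := by gcongr; exact abs_add_le _ _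
      _ = |a| ^ 2 + |a| * |c| + |c| ^ 2 := by rw [abs_mul, abs_pow, abs_pow]
      _ ≤ (n : ℝ) ^ 2 + n * n + (n : ℝ) ^ 2 := by gcongr
      _ = _ := by ring
  push_cast
  gcongr

namespace Setting

variable {D : Setting}

theorem integral_indicator_mul (hD : D.Admissible) (f h : Plane → ℝ) :
    ∫ x, D.openRegion.indicator f x * h x = ∫ x, f x * h x ∂D.μ := by
  rw [μ_eq, ← integral_indicator (isOpen_openRegion hD).measurableSet]
  congr 1; ext x
  by_cases hx : x ∈ D.openRegion <;> simp [hx]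

theorem IsTest.contDiff {ψ : Plane → ℝ} (h : D.IsTest ψ) : ContDiff ℝ (⊤ : ℕ∞) ψ := by
  cases D with
  | torus => exact h.1
  | neumann U => exact h.1

theorem memLp_of_hasCompactSupport (D : Setting) {φ : Plane → ℝ} (h1 : Continuous φ)
    (h2 : HasCompactSupport φ) : MemLp φ 2 D.μ :=
  (h1.memLp_of_hasCompactSupport h2).restrict _

theorem isWeakPartial_of_smooth {φ : Plane → ℝ}
    (h1 : ContDiff ℝ (⊤ : ℕ∞) φ) (h2 : HasCompactSupport φ) (h3 : tsupport φ ⊆ D.openRegion)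
    (i : Fin 2) : D.IsWeakPartial i (toL2 D.μ φ) (toL2 D.μ (pderiv i φ)) := by
  intro ψ hψ
  have hψ' := hψ.contDiff
  have c2 : Continuous (pderiv i φ) := continuous_fderiv_apply_of_smooth h1 _
  have s2 : HasCompactSupport (pderiv i φ) := hasCompactSupport_fderiv_apply h2 _
  have c3 : Continuous (pderiv i ψ) := continuous_fderiv_apply_of_smooth hψ' _
  have m1 := memLp_of_hasCompactSupport D h1.continuous h2
  have m2 := memLp_of_hasCompactSupport D c2 s2
  have e1 : ∫ x, toL2 D.μ φ x * pderiv i ψ x ∂D.μ = ∫ x, φ x * pderiv i ψ x := by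
    rw [integral_congr_ae (g := fun x => φ x * pderiv i ψ x) (by
      filter_upwards [coeFn_toL2 m1] with x hx; rw [hx]), μ_eq]
    refine setIntegral_eq_integral_of_forall_compl_eq_zero fun x hx => ?_
    rw [image_eq_zero_of_notMem_tsupport fun h => hx (h3 h), zero_mul]
  have e2 : ∫ x, toL2 D.μ (pderiv i φ) x * ψ x ∂D.μ = ∫ x, pderiv i φ x * ψ x := by
    rw [integral_congr_ae (g := fun x => pderiv i φ x * ψ x) (by
      filter_upwards [coeFn_toL2 m2] with x hx; rw [hx]), μ_eq]
    refine setIntegral_eq_integral_of_forall_compl_eq_zero fun x hx => ?_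
    rw [pderiv, fderiv_eq_zero_of_notMem_tsupport fun h => hx (h3 h)]; simp
  rw [e1, e2]
  exact integral_mul_fderiv_eq_neg_fderiv_mul_of_integrable
    ((c2.mul hψ'.continuous).integrable_of_hasCompactSupport s2.mul_right)
    ((h1.continuous.mul c3).integrable_of_hasCompactSupport h2.mul_right)
    ((h1.continuous.mul hψ'.continuous).integrable_of_hasCompactSupport h2.mul_right)
    (fun x _ => (h1.differentiable (by simp)).differentiableAt)
    (fun x _ => (hψ'.differentiable (by simp)).differentiableAt)

theorem toL2_mem_H1_of_smooth {φ : Plane → ℝ}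
    (h1 : ContDiff ℝ (⊤ : ℕ∞) φ) (h2 : HasCompactSupport φ) (h3 : tsupport φ ⊆ D.openRegion) :
    toL2 D.μ φ ∈ D.H1 := fun i => ⟨_, isWeakPartial_of_smooth h1 h2 h3 i⟩

/-- Green's formula against compactly supported smooth functions. -/
theorem gradInner_smooth (hD : D.Admissible) {φ : Plane → ℝ}
    (h1 : ContDiff ℝ (⊤ : ℕ∞) φ) (h2 : HasCompactSupport φ) (h3 : tsupport φ ⊆ D.openRegion)
    {v : D.H} (hv : v ∈ D.H2) : D.gradInner v (toL2 D.μ φ) = - inner ℝ (D.lap v) (toL2 D.μ φ) := by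
  have m1 := memLp_of_hasCompactSupport D h1.continuous h2
  have m2 : ∀ i, MemLp (pderiv i φ) 2 D.μ := fun i => memLp_of_hasCompactSupport D
    (continuous_fderiv_apply_of_smooth h1 _) (hasCompactSupport_fderiv_apply h2 _)
  rw [gradInner, lap, sum_inner, ← Finset.sum_neg_distrib]
  refine Finset.sum_congr rfl fun i _ => ?_
  rw [(isWeakPartial_of_smooth h1 h2 h3 i).weakPartial_eq hD, real_inner_comm,
    inner_toL2 (m2 i), real_inner_comm, inner_toL2 m1]
  have := hasWeakDeriv_indicator hD
    ((isWeakPartial_iff hD).1 (isWeakPartial_weakPartial (hv.2 i) i)) (ae_eq_refl _) (ae_eq_refl _)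
    φ h1 h2 h3
  rw [integral_indicator_mul hD, integral_indicator_mul hD] at this
  simp only [mul_comm (φ _), mul_comm (pderiv i φ _)]
  exact this

/-- Test functions supported in the open region determine an element of `L²`; on the torus the edges
of the cell are null. -/
theorem eq_zero_of_inner_smooth (hD : D.Admissible) {G : D.H}
    (h : ∀ φ : Plane → ℝ, ContDiff ℝ (⊤ : ℕ∞) φ → HasCompactSupport φ →
      tsupport φ ⊆ D.openRegion → inner ℝ G (toL2 D.μ φ) = 0) : G = 0 := by
  have := isFiniteMeasure_μ hD
  have hG : Integrable G D.μ := (Lp.memLp G).integrable (by norm_num)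
  have hO := isOpen_openRegion hD
  have key := hO.ae_eq_zero_of_integral_contDiff_smul_eq_zero (f := G) (μ := volume) (by
    have : IntegrableOn G D.openRegion := by rw [IntegrableOn, ← μ_eq]; exact hG
    exact this.locallyIntegrableOn) (fun φ h1 h2 h3 => by
      have h4 := h φ h1 h2 h3
      rw [real_inner_comm, inner_toL2 (memLp_of_hasCompactSupport D h1.continuous h2)] at h4
      simp only [mul_comm (φ _)] at h4
      rw [← integral_indicator_mul hD] at h4
      rw [← h4]
      congr 1; ext x
      by_cases hx : x ∈ D.openRegion
      · rw [indicator_of_mem hx, smul_eq_mul, mul_comm]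
      · rw [image_eq_zero_of_notMem_tsupport fun h => hx (h3 h)]; simp)
  apply Lp.ext
  filter_upwards [(ae_μ_iff hD).2 key, Lp.coeFn_zero ℝ 2 D.μ] with x hx h0
  rw [hx, h0]; rfl

/-- The class of `u³`. -/
def cube (u : D.H) : D.H := toL2 D.μ fun x => u x ^ 3

theorem exists_norm_cube_le (hD : D.Admissible) : ∃ C : ℝ, 0 ≤ C ∧ ∀ u ∈ D.H2,
    MemLp (fun x => u x ^ 3) 2 D.μ ∧ ‖cube u‖ ≤ C * (D.h1Norm u ^ 2 * D.h2Norm u) := by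
  have := isFiniteMeasure_μ hD
  obtain ⟨C, hC0, hC⟩ := exists_cube_bound hD
  refine ⟨√(D.μ.real univ) * C, by positivity, fun u hu => ?_⟩
  set B := C * (D.h1Norm u ^ 2 * D.h2Norm u) with hB
  have hB0 : 0 ≤ B := mul_nonneg hC0 (mul_nonneg (sq_nonneg _) (h2Norm_nonneg u))
  have hae : ∀ᵐ x ∂D.μ, ‖u x ^ 3‖ ≤ B := by
    filter_upwards [hC u hu] with x hx
    rwa [norm_pow, Real.norm_eq_abs]
  have hm : MemLp (fun x => u x ^ 3) 2 D.μ :=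
    MemLp.of_bound ((Lp.aestronglyMeasurable u).pow 3) B hae
  refine ⟨hm, ?_⟩
  rw [mul_assoc, ← hB]
  refine abs_le_of_sq_le_sq' ?_ (by positivity) |>.2
  rw [cube, norm_toL2_sq hm, mul_pow, Real.sq_sqrt measureReal_nonneg]
  calc _ ≤ ∫ x, B ^ 2 ∂D.μ := by
        refine integral_mono_ae hm.integrable_sq (integrable_const _) ?_
        filter_upwards [hae] with x hx
        rw [← sq_abs (u x ^ 3)]
        exact pow_le_pow_left₀ (abs_nonneg _) hx 2
    _ = _ := by rw [integral_const, smul_eq_mul]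

/-- Cubing is not continuous on `L²`, but the truncated cubes are Lipschitz and induce continuous
maps there. For each `t` with `u t ∈ D.H2` they agree with the cube once the truncation height is
large, because such functions are essentially bounded. -/
theorem aestronglyMeasurable_cube (hD : D.Admissible) {ν : Measure ℝ} {u : ℝ → D.H}
    (hm : AEStronglyMeasurable u ν) (hu : ∀ᵐ t ∂ν, u t ∈ D.H2) :
    AEStronglyMeasurable (fun t => cube (u t)) ν := by
  obtain ⟨C, hC0, hC⟩ := exists_cube_bound hD
  have c0 : ∀ n, clipCube n 0 = 0 := fun n => by rw [clipCube_of_abs_le (by simp)]; simp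
  refine aestronglyMeasurable_of_tendsto_ae atTop
    (f := fun n t => (lipschitzWith_clipCube n).compLp (c0 n) (u t)) (fun n =>
      ((lipschitzWith_clipCube n).continuous_compLp (c0 n)).comp_aestronglyMeasurable hm) ?_
  filter_upwards [hu] with t ht
  refine tendsto_const_nhds.congr' ?_
  set B := C * (D.h1Norm (u t) ^ 2 * D.h2Norm (u t)) with hB
  filter_upwards [eventually_ge_atTop (⌈B + 1⌉₊)] with n hn
  -- The extra `1` ensures `n ≥ 1`, hence `n ≤ n³`: if `|u| > n` then `n ≤ |u|³ ≤ B < n`, which is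
  -- impossible.
  have hn' : B + 1 ≤ n := (Nat.le_ceil _).trans (by exact_mod_cast hn)
  obtain ⟨C', _, hC'⟩ := exists_norm_cube_le hD
  apply Lp.ext
  filter_upwards [coeFn_toL2 (hC' _ ht).1,
    (lipschitzWith_clipCube n).coeFn_compLp (c0 n) (u t), hC _ ht] with x h1 h2 h3
  rw [cube, h1, h2, Function.comp_apply, clipCube_of_abs_le]
  by_contra h
  push Not at h
  have h4 : (1 : ℝ) ≤ n := by
    have : 0 ≤ B := mul_nonneg hC0 (mul_nonneg (sq_nonneg _) (h2Norm_nonneg _))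
    linarith
  have h5 : (n : ℝ) ≤ (n : ℝ) ^ 3 := le_self_pow₀ h4 (by norm_num)
  have h6 : (n : ℝ) ^ 3 ≤ |u t x| ^ 3 := by gcongr
  linarith

end Setting

theorem inner_intervalIntegral {E : Type*} [NormedAddCommGroup E] [InnerProductSpace ℝ E]
    [CompleteSpace E] {F : ℝ → E} {a b : ℝ} (hF : IntervalIntegrable F volume a b) (w : E) :
    ∫ s in a..b, inner ℝ w (F s) = inner ℝ w (∫ s in a..b, F s) :=
  (innerSL ℝ w).intervalIntegral_comp_comm hF

namespace Setting

variable {D : Setting}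

/-- The nonlinearity `f(u) - 3 C₀ u` of the limiting equation. -/
def limitForce (C₀ : ℝ) (u : D.H) : D.H := u - cube u - (3 * C₀) • u

theorem coeFn_limitForce (hD : D.Admissible) (C₀ : ℝ) {u : D.H} (hu : u ∈ D.H2) :
    limitForce C₀ u =ᵐ[D.μ] fun x => cubic (u x) - 3 * C₀ * u x := by
  obtain ⟨C, _, hC⟩ := exists_norm_cube_le hD
  filter_upwards [Lp.coeFn_sub (u - cube u) ((3 * C₀) • u), Lp.coeFn_sub u (cube u),
    Lp.coeFn_smul (3 * C₀) u, coeFn_toL2 (hC u hu).1] with x h1 h2 h3 h4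
  rw [limitForce, h1, Pi.sub_apply, h2, Pi.sub_apply, h3, Pi.smul_apply, cube, h4, cubic,
    smul_eq_mul]

theorem integral_limitForce (hD : D.Admissible) (C₀ : ℝ) {u : D.H} (hu : u ∈ D.H2) (w : D.H) :
    ∫ x, (cubic (u x) - 3 * C₀ * u x) * w x ∂D.μ = inner ℝ (limitForce C₀ u) w := by
  rw [L2.inner_def]
  refine integral_congr_ae ?_
  filter_upwards [coeFn_limitForce hD C₀ hu] with x hx
  rw [hx]; simp [mul_comm]

theorem IsC0H1.exists_h1Norm_le {T : ℝ} {u : ℝ → D.H} (hu : D.IsC0H1 T u) :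
    ∃ M, 1 ≤ M ∧ ∀ t ∈ Icc 0 T, D.h1Norm (u t) ≤ M := by
  have hc : ContinuousOn (fun t => D.h1Norm (u t)) (Icc 0 T) := by
    simp only [h1Norm, gradInner_self]
    refine ContinuousOn.sqrt ((hu.2.1.norm.pow 2).add ?_)
    exact continuousOn_finsetSum _ fun i _ => (hu.2.2 i).norm.pow 2
  obtain ⟨M, hM⟩ := isCompact_Icc.exists_bound_of_continuousOn hc
  exact ⟨max M 1, le_max_right _ _, fun t ht =>
    (le_abs_self _).trans ((hM t ht).trans (le_max_left _ _))⟩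

theorem IsL2H2.memLp_h2Norm {T : ℝ} {u : ℝ → D.H} (hu : D.IsL2H2 T u) :
    MemLp (fun t => D.h2Norm (u t)) 2 (volume.restrict (Icc 0 T)) := by
  obtain ⟨_, h0, h1, h2⟩ := hu
  have hi : Integrable (fun t => D.h2Norm (u t) ^ 2) (volume.restrict (Icc 0 T)) := by
    simp only [h2Norm_sq, h1Norm_sq, gradInner_self]
    exact ((h0.norm.integrable_sq).add (integrable_finsetSum _ fun i _ =>
      (h1 i).norm.integrable_sq)).add (integrable_finsetSum _ fun i _ =>
      integrable_finsetSum _ fun j _ => (h2 i j).norm.integrable_sq)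
  have hm : AEStronglyMeasurable (fun t => D.h2Norm (u t)) (volume.restrict (Icc 0 T)) := by
    have := Real.continuous_sqrt.comp_aestronglyMeasurable hi.1
    simpa only [Real.sqrt_sq (h2Norm_nonneg _)] using this
  exact (memLp_two_iff_integrable_sq hm).2 hi

theorem IsL2H2.memLp_lap {T : ℝ} {u : ℝ → D.H} (hu : D.IsL2H2 T u) :
    MemLp (fun t => D.lap (u t)) 2 (volume.restrict (Icc 0 T)) :=
  memLp_finsetSum _ fun i _ => hu.2.2.2 i i

namespace IsLimitSolution

variable {C₀ T : ℝ} {u : ℝ → D.H}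

/-- The `L²` norm of `u³` is at most a constant times `M² ‖u‖_{H²}`, and the `H²` norm is square
integrable in time. -/
theorem memLp_limitForce (hD : D.Admissible) (hu : D.IsLimitSolution C₀ T u) :
    MemLp (fun t => limitForce C₀ (u t)) 2 (volume.restrict (Icc 0 T)) := by
  obtain ⟨M, hM1, hM⟩ := hu.1.exists_h1Norm_le
  obtain ⟨C, hC0, hC⟩ := exists_norm_cube_le hD
  have hu2 := hu.2.1.2.1
  have hcube : MemLp (fun t => cube (u t)) 2 (volume.restrict (Icc 0 T)) := by
    refine MemLp.of_le_mul hu.2.1.memLp_h2Norm (c := C * M ^ 2)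
      (aestronglyMeasurable_cube hD hu2.1 hu.2.1.1) ?_
    filter_upwards [hu.2.1.1, ae_restrict_mem measurableSet_Icc] with t ht htT
    rw [Real.norm_of_nonneg (h2Norm_nonneg _), mul_assoc]
    have := hM t htT
    have h1 := h1Norm_nonneg (u t)
    have h2 := h2Norm_nonneg (u t)
    refine (hC _ ht).2.trans ?_
    gcongr
  exact (hu2.sub hcube).sub (hu2.const_smul (3 * C₀) :)

theorem inner_sub_eq (hD : D.Admissible) (hu : D.IsLimitSolution C₀ T u) {w : D.H} (hw : w ∈ D.H1)
    {t : ℝ} (ht : t ∈ Icc 0 T) : inner ℝ (u t - u 0) w =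
      ∫ s in (0 : ℝ)..t, (- D.gradInner (u s) w + inner ℝ (limitForce C₀ (u s)) w) := by
  have hsub : Ioc 0 t ⊆ Icc 0 T := fun s hs => ⟨hs.1.le, hs.2.trans ht.2⟩
  obtain ⟨_, h2, h3, h4⟩ := hu.2.2 w hw
  have e : ∫ s in (0 : ℝ)..t, ∫ x, (cubic (u s x) - 3 * C₀ * u s x) * w x ∂D.μ
      = ∫ s in (0 : ℝ)..t, inner ℝ (limitForce C₀ (u s)) w := by
    refine intervalIntegral.integral_congr_ae_restrict ?_
    rw [uIoc_of_le ht.1]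
    filter_upwards [ae_restrict_of_ae_restrict_of_subset hsub hu.2.1.1] with s hs
    exact integral_limitForce hD C₀ hs w
  have i2 : IntervalIntegrable (fun s => inner ℝ (limitForce C₀ (u s)) w) volume 0 t := by
    rw [intervalIntegrable_iff_integrableOn_Ioc_of_le ht.1]
    have := isFiniteMeasure_μ hD
    refine IntegrableOn.mono_set ?_ hsub
    exact (((hu.memLp_limitForce hD).integrable (by norm_num)).inner_const w)
  have i1 : IntervalIntegrable (fun s => - D.gradInner (u s) w) volume 0 t := by
    rw [intervalIntegrable_iff_integrableOn_Ioc_of_le ht.1]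
    exact IntegrableOn.mono_set h2 hsub
  rw [intervalIntegral.integral_add i1 i2, inner_sub_left, h4 t ht, e]; ring

/-- A weak solution satisfies the Neumann boundary condition at almost all times. -/
theorem ae_mem_V (hD : D.Admissible) (hT : 0 ≤ T) (hu : D.IsLimitSolution C₀ T u) :
    ∀ᵐ t ∂(volume.restrict (Icc 0 T)), u t ∈ D.V := by
  set F := fun s => D.lap (u s) + limitForce C₀ (u s) with hF
  have iF : IntegrableOn F (Icc 0 T) :=
    (hu.2.1.memLp_lap.add (hu.memLp_limitForce hD)).integrable (by norm_num)
  have iF' : ∀ t ∈ Icc 0 T, IntervalIntegrable F volume 0 t := fun t ht => by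
    rw [intervalIntegrable_iff_integrableOn_Ioc_of_le ht.1]
    exact iF.mono_set fun s hs => ⟨hs.1.le, hs.2.trans ht.2⟩
  -- Compactly supported test functions see no boundary, so Green's formula is available for them
  -- and the equation holds strongly in `L²`.
  have e1 : ∀ t ∈ Icc 0 T, u t - u 0 = ∫ s in (0 : ℝ)..t, F s := by
    intro t ht
    rw [← sub_eq_zero]
    refine eq_zero_of_inner_smooth hD fun φ h1 h2 h3 => ?_
    rw [inner_sub_left, hu.inner_sub_eq hD (toL2_mem_H1_of_smooth h1 h2 h3) ht,
      real_inner_comm _ (∫ s in (0 : ℝ)..t, F s), ← inner_intervalIntegral (iF' t ht), sub_eq_zero]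
    refine intervalIntegral.integral_congr_ae_restrict ?_
    rw [uIoc_of_le ht.1]
    filter_upwards [ae_restrict_of_ae_restrict_of_subset
      (fun s hs => ⟨hs.1.le, hs.2.trans ht.2⟩ : Ioc 0 t ⊆ Icc 0 T) hu.2.1.1] with s hs
    rw [gradInner_smooth hD h1 h2 h3 hs, neg_neg, ← inner_add_left]
    exact real_inner_comm _ _
  -- Comparing the strong equation with the weak one for arbitrary `w ∈ H¹` shows that the Green
  -- defect integrates to zero over every `[0,t]`, hence vanishes for almost every `t`.
  have e2 : ∀ w ∈ D.H1, ∀ᵐ t ∂(volume.restrict (Icc 0 T)),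
      D.gradInner (u t) w + inner ℝ (D.lap (u t)) w = 0 := by
    intro w hw
    have ig : IntegrableOn (fun t => D.gradInner (u t) w) (Icc 0 T) := by
      simpa using (hu.2.2 w hw).2.1.neg
    have il : IntegrableOn (fun t => inner ℝ (D.lap (u t)) w) (Icc 0 T) :=
      (hu.2.1.memLp_lap.integrable (by norm_num)).inner_const w
    have iN : IntegrableOn (fun t => inner ℝ (limitForce C₀ (u t)) w) (Icc 0 T) :=
      ((hu.memLp_limitForce hD).integrable (by norm_num)).inner_const w
    have toI : ∀ {f : ℝ → ℝ}, IntegrableOn f (Icc 0 T) → ∀ t ∈ Icc 0 T,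
        IntervalIntegrable f volume 0 t := fun hf t ht => by
      rw [intervalIntegrable_iff_integrableOn_Ioc_of_le ht.1]
      exact hf.mono_set fun s hs => ⟨hs.1.le, hs.2.trans ht.2⟩
    refine ae_eq_zero_of_intervalIntegral_eq_zero hT (ig.add il) fun t ht => ?_
    have h1 := hu.inner_sub_eq hD hw ht
    rw [e1 t ht, real_inner_comm, ← inner_intervalIntegral (iF' t ht)] at h1
    have h2 : ∫ s in (0 : ℝ)..t, inner ℝ w (F s) = (∫ s in (0 : ℝ)..t, inner ℝ (D.lap (u s)) w)
        + ∫ s in (0 : ℝ)..t, inner ℝ (limitForce C₀ (u s)) w := by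
      rw [← intervalIntegral.integral_add (toI il t ht) (toI iN t ht)]
      congr 1; ext s
      rw [← inner_add_left]; exact real_inner_comm _ _
    have ig' : IntervalIntegrable (fun t => - D.gradInner (u t) w) volume 0 t := (toI ig t ht).neg
    rw [h2, intervalIntegral.integral_add ig' (toI iN t ht),
      intervalIntegral.integral_neg] at h1
    rw [intervalIntegral.integral_add (toI ig t ht) (toI il t ht)]
    linarith
  have := isFiniteMeasure_μ hD
  have : Fact ((2 : ℝ≥0∞) ≠ ⊤) := ⟨by simp⟩
  have h2c : SecondCountableTopology (Lp ℝ 2 D.μ) := inferInstance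
  -- The null set of times must not depend on `w`. Approximation by countably many `w` has to
  -- control the gradients as well, so density is taken in the graph `(w, ∂₀w, ∂₁w)`, a subset of a
  -- separable space.
  let ι : D.H → D.H × D.H × D.H := fun w => (w, D.weakPartial 0 w, D.weakPartial 1 w)
  obtain ⟨c, hcs, hcc, hcd⟩ := (TopologicalSpace.IsSeparable.of_separableSpace
    (ι '' D.H1)).exists_countable_dense_subset
  have e3 : ∀ᵐ t ∂(volume.restrict (Icc 0 T)), ∀ p ∈ c,
      (inner ℝ (D.weakPartial 0 (u t)) p.2.1 + inner ℝ (D.weakPartial 1 (u t)) p.2.2)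
        + inner ℝ (D.lap (u t)) p.1 = 0 := by
    refine (ae_ball_iff hcc).2 fun p hp => ?_
    obtain ⟨w, hw, rfl⟩ := hcs hp
    filter_upwards [e2 w hw] with t ht
    rw [gradInner, Fin.sum_univ_two] at ht
    exact ht
  filter_upwards [e3, hu.2.1.1] with t ht h2
  refine ⟨h2, fun w hw => ?_⟩
  have hcl : IsClosed {p : D.H × D.H × D.H | (inner ℝ (D.weakPartial 0 (u t)) p.2.1
      + inner ℝ (D.weakPartial 1 (u t)) p.2.2) + inner ℝ (D.lap (u t)) p.1 = 0} :=
    isClosed_eq (by fun_prop) continuous_const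
  have := hcl.closure_subset_iff.2 (fun p hp => ht p hp) (hcd (mem_image_of_mem ι hw))
  rw [gradInner, Fin.sum_univ_two]
  exact eq_neg_of_add_eq_zero_left this

end IsLimitSolution

end Setting

/-! ### The energy inequality for the difference -/

theorem integral_sub_of_integrableOn {T s t : ℝ} {a b : ℝ → ℝ} (ha : IntegrableOn a (Icc 0 T))
    (hb : IntegrableOn b (Icc 0 T)) (hs : s ∈ Icc 0 T) (ht : t ∈ Icc 0 T) :
    ∫ r in s..t, (a r - b r) = ((∫ r in (0 : ℝ)..t, a r) - ∫ r in (0 : ℝ)..s, a r)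
      - ((∫ r in (0 : ℝ)..t, b r) - ∫ r in (0 : ℝ)..s, b r) := by
  have toI : ∀ {f : ℝ → ℝ}, IntegrableOn f (Icc 0 T) → ∀ t ∈ Icc 0 T,
      IntervalIntegrable f volume 0 t := fun hf t ht => by
    rw [intervalIntegrable_iff_integrableOn_Ioc_of_le ht.1]
    exact hf.mono_set fun s hs => ⟨hs.1.le, hs.2.trans ht.2⟩
  rw [intervalIntegral.integral_interval_sub_left (toI ha t ht) (toI ha s hs),
    intervalIntegral.integral_interval_sub_left (toI hb t ht) (toI hb s hs),
    intervalIntegral.integral_sub ((toI ha s hs).symm.trans (toI ha t ht))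
    ((toI hb s hs).symm.trans (toI hb t ht))]

theorem continuous_cubic : Continuous cubic := by unfold cubic; fun_prop

namespace Setting

variable {D : Setting}

/-- The time derivative of `‖v - u‖² / 2`, where `N` is the nonlinearity in the equation of `v`. -/
def energyRate (C₀ ε : ℝ) (v u N : D.H) : ℝ :=
  inner ℝ (N - limitForce C₀ u) (v - u) - D.gradInner (v - u) (v - u)
    - ε ^ 2 * inner ℝ (D.lap v) (D.lap (v - u))

namespace IsRegularizedSolution

variable {C₀ ε T : ℝ} {u : ℝ → D.H} {z y : ℝ → Plane → ℝ}

theorem isC0Path (hz : D.IsC0Path T z) (hy : D.IsRegularizedSolution ε T z y) :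
    D.IsC0Path T y := by
  have := hy.1.comp₂ hz (φ := fun a b => a + b) (by fun_prop)
  simpa using this

/-- The energy inequality for the difference of the two solutions. -/
theorem energy_le (hD : D.Admissible) (hu : D.IsLimitSolution C₀ T u)
    (hz : D.IsC0Path T z) (hy : D.IsRegularizedSolution ε T z y) :
    let v := fun t => toL2 D.μ (fun x => y t x - z t x)
    let E := fun t => energyRate C₀ ε (v t) (u t) (toL2 D.μ fun x => cubic (y t x))
    IntegrableOn E (Icc 0 T) ∧ ContinuousOn (fun t => v t - u t) (Icc 0 T) ∧
    (∀ᵐ t ∂(volume.restrict (Icc 0 T)), v t ∈ D.V ∧ u t ∈ D.V) ∧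
    ∀ τ ∈ Icc 0 T, ‖v τ - u τ‖ ^ 2 - ‖v 0 - u 0‖ ^ 2 ≤ 2 * ∫ t in (0 : ℝ)..τ, E t := by
  intro v E
  -- For negative `T` the time interval is empty and every claim is vacuous.
  rcases lt_or_ge T 0 with hT | hT
  · simp [Icc_eq_empty (not_le.2 hT)]
  set ν := volume.restrict (Icc 0 T) with hν
  have hyc := hy.isC0Path hz
  have hNc : D.IsC0Path T (fun t x => cubic (y t x)) := hyc.comp continuous_cubic
  set Nv := fun t => toL2 D.μ fun x => cubic (y t x) with hNv
  set d := fun t => v t - u t with hd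
  have mNv : MemLp Nv 2 ν := by
    obtain ⟨C, hC⟩ := isCompact_Icc.exists_bound_of_continuousOn (hNc.continuousOn_toL2 hD)
    exact MemLp.of_bound ((hNc.continuousOn_toL2 hD).aestronglyMeasurable measurableSet_Icc) C
      (by filter_upwards [ae_restrict_mem measurableSet_Icc] with t ht using hC t ht)
  have mNu := hu.memLp_limitForce hD
  have dc : ContinuousOn d (Icc 0 T) := (hy.1.continuousOn_toL2 hD).sub hu.1.2.1
  have hV : ∀ᵐ t ∂ν, v t ∈ D.V ∧ u t ∈ D.V := by
    filter_upwards [hy.2.1.1, hu.ae_mem_V hD hT] with t h1 h2 using ⟨h1, h2⟩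
  have md : MemLp d 2 ν := hy.2.1.2.1.sub hu.2.1.2.1
  have mp : ∀ i, MemLp (fun t => D.weakPartial i (d t)) 2 ν := by
    intro i
    refine ((hy.2.1.2.2.1 i).sub (hu.2.1.2.2.1 i)).ae_eq ?_
    filter_upwards [hV] with t ht
    exact (weakPartial_sub hD ht.1.1.1 ht.2.1.1 i).symm
  have ml : MemLp (fun t => D.lap (d t)) 2 ν := by
    refine (hy.2.1.2.2.2.sub hu.2.1.memLp_lap).ae_eq ?_
    filter_upwards [hV] with t ht
    exact (lap_sub hD ht.1.1 ht.2.1).symm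
  -- The four pairs `(A j, B j)` encode the difference of nonlinearities, the two components of the
  -- gradient form, and the bi-Laplacian, the last applied to `v` only since the limiting equation
  -- has no fourth order term.
  let A : Fin 4 → ℝ → D.H := ![fun t => Nv t - limitForce C₀ (u t),
    fun t => - D.weakPartial 0 (d t), fun t => - D.weakPartial 1 (d t),
    fun t => (-ε ^ 2) • D.lap (v t)]
  let B : Fin 4 → ℝ → D.H := ![d, fun t => D.weakPartial 0 (d t), fun t => D.weakPartial 1 (d t),
    fun t => D.lap (d t)]
  have mA : ∀ j, MemLp (A j) 2 ν := by
    intro j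
    fin_cases j
    · exact mNv.sub mNu
    · exact (mp 0).neg
    · exact (mp 1).neg
    · exact hy.2.1.2.2.2.const_smul (-ε ^ 2)
  have mB : ∀ j, MemLp (B j) 2 ν := by
    intro j
    fin_cases j
    · exact md
    · exact mp 0
    · exact mp 1
    · exact ml
  have hsum : ∀ r t, ∑ j, inner ℝ (A j r) (B j t) = inner ℝ (Nv r - limitForce C₀ (u r)) (d t)
      - D.gradInner (d r) (d t) - ε ^ 2 * inner ℝ (D.lap (v r)) (D.lap (d t)) := by
    intro r t
    simp only [Fin.sum_univ_four, A, B, gradInner, Fin.sum_univ_two, Matrix.cons_val, inner_neg_left,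
      inner_smul_left, map_neg, map_pow, conj_trivial]
    ring
  have hE : E = fun t => ∑ j, inner ℝ (A j t) (B j t) := by
    ext t; rw [hsum]; rfl
  have iE : IntegrableOn E (Icc 0 T) := by
    rw [hE]
    exact integrable_finsetSum _ fun j _ => integrable_inner_of_memLp_two (mA j) (mB j)
  refine ⟨iE, dc, hV, fun τ hτ => ?_⟩
  rw [hE]
  refine norm_sq_sub_le_integral dc mA mB ?_ hτ
  have toI : ∀ {f : ℝ → ℝ}, IntegrableOn f (Icc 0 T) → ∀ t ∈ Icc 0 T,
      IntervalIntegrable f volume 0 t := fun hf t ht => by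
    rw [intervalIntegrable_iff_integrableOn_Ioc_of_le ht.1]
    exact hf.mono_set fun s hs => ⟨hs.1.le, hs.2.trans ht.2⟩
  filter_upwards [hV, ae_restrict_mem measurableSet_Icc] with t ht htT s hs
  have hsT : s ∈ Icc 0 T := ⟨hs.1, hs.2.trans htT.2⟩
  have hdV : d t ∈ D.V := sub_mem_V hD ht.1 ht.2
  -- The test function is frozen at time `t` while the equations are integrated over `[s,t]`; `d t ∈
  -- V` makes it admissible for both of them.
  obtain ⟨w, hw⟩ : ∃ w, w = d t := ⟨_, rfl⟩
  have hB : ∀ r, ∑ j, inner ℝ (A j r) (B j t) = inner ℝ (Nv r - limitForce C₀ (u r)) w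
      - D.gradInner (d r) w - ε ^ 2 * inner ℝ (D.lap (v r)) (D.lap w) := fun r => by
    rw [hw]; exact hsum r t
  rw [← hw] at hdV ⊢
  simp only [hB]
  let a := fun r => D.formA ε (v r) w + inner ℝ (Nv r) w
  let b := fun r => - D.gradInner (u r) w + inner ℝ (limitForce C₀ (u r)) w
  obtain ⟨-, i1, i2, hid⟩ := hy.2.2 w hdV
  have eN : ∀ r ∈ Icc 0 T, ∫ x, cubic (y r x) * w x ∂D.μ = inner ℝ (Nv r) w := fun r hr =>
    (inner_toL2 (hNc.memLp hD hr) w).symm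
  have iNv : IntegrableOn (fun r => inner ℝ (Nv r) w) (Icc 0 T) :=
    (mNv.integrable (by norm_num)).inner_const w
  have iNu : IntegrableOn (fun r => inner ℝ (limitForce C₀ (u r)) w) (Icc 0 T) :=
    (mNu.integrable (by norm_num)).inner_const w
  have ia : IntegrableOn a (Icc 0 T) := i1.add iNv
  have ib : IntegrableOn b (Icc 0 T) := (hu.2.2 w hdV.1.1).2.1.add iNu
  have ev : ∀ t ∈ Icc 0 T, inner ℝ (v t - v 0) w = ∫ r in (0 : ℝ)..t, a r := by
    intro t ht
    rw [intervalIntegral.integral_add (toI i1 t ht) (toI iNv t ht), inner_sub_left, hid t ht]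
    have : ∫ s in (0 : ℝ)..t, ∫ x, cubic (y s x) * w x ∂D.μ
        = ∫ s in (0 : ℝ)..t, inner ℝ (Nv s) w := by
      refine intervalIntegral.integral_congr fun r hr => ?_
      rw [uIcc_of_le ht.1] at hr
      exact eN r ⟨hr.1, hr.2.trans ht.2⟩
    rw [this]; ring
  have eu : ∀ t ∈ Icc 0 T, inner ℝ (u t - u 0) w = ∫ r in (0 : ℝ)..t, b r :=
    fun t ht => hu.inner_sub_eq hD hdV.1.1 ht
  have e1 : inner ℝ (d t - d s) w = ∫ r in s..t, (a r - b r) := by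
    have h1 := ev t htT
    have h2 := ev s hsT
    have h3 := eu t htT
    have h4 := eu s hsT
    have key := integral_sub_of_integrableOn ia ib hsT htT
    rw [← h1, ← h2, ← h3, ← h4] at key
    rw [key, hd]
    simp only [inner_sub_left]; ring
  rw [← hw] at e1
  rw [e1]
  refine intervalIntegral.integral_congr_ae_restrict ?_
  rw [uIoc_of_le hs.2]
  filter_upwards [ae_restrict_of_ae_restrict_of_subset
    (fun r hr => ⟨hs.1.trans hr.1.le, hr.2.trans htT.2⟩ : Ioc s t ⊆ Icc 0 T) hV] with r hr
  simp only [a, b, formA, hd]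
  rw [gradInner_sub_left hD hr.1.1.1 hr.2.1.1, inner_sub_left (Nv r)]
  ring

end IsRegularizedSolution

end Setting

/-! ### Estimates of the nonlinear terms -/

namespace Setting

variable {D : Setting}

theorem mul_of_bounded {u : D.H} {b : ℝ} (hu : ∀ᵐ x ∂D.μ, |u x| ≤ b) (g : D.H) :
    mul u g =ᵐ[D.μ] (fun x => u x * g x) ∧ ‖mul u g‖ ≤ b * ‖g‖ := by
  have hle : ∀ᵐ x ∂D.μ, ‖u x * g x‖ ≤ b * ‖g x‖ := by
    filter_upwards [hu] with x hx
    rw [norm_mul]; gcongr; exact hx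
  have hm : MemLp (fun x => u x * g x) 2 D.μ :=
    (Lp.memLp g).of_le_mul ((Lp.aestronglyMeasurable u).mul (Lp.aestronglyMeasurable g)) hle
  refine ⟨coeFn_toL2 hm, ?_⟩
  refine Lp.norm_le_mul_norm_of_ae_le_mul ?_
  filter_upwards [coeFn_toL2 hm, hle] with x h1 h2
  rw [mul, h1]; exact h2

/-- Bounds in `H¹` for `u d` and `u² d`, where `u ∈ H²` and `d ∈ H¹`. -/
theorem exists_h1Norm_mul_le (hD : D.Admissible) {M : ℝ} (hM : 1 ≤ M) : ∃ K : ℝ, 1 ≤ K ∧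
    ∀ u ∈ D.H2, D.h1Norm u ≤ M → ∀ b : ℝ, 0 ≤ b → b ^ 3 = K * (1 + D.h2Norm u) → ∀ d ∈ D.H1,
      ((mul u d =ᵐ[D.μ] fun x => u x * d x) ∧
        (mul u (mul u d) =ᵐ[D.μ] fun x => u x * (u x * d x))) ∧
      (mul u d ∈ D.H1 ∧ mul u (mul u d) ∈ D.H1) ∧
      D.h1Norm (mul u d) ^ 2 ≤ K * b ^ 5 * D.h1Norm d ^ 2 ∧
      D.h1Norm (mul u (mul u d)) ^ 2 ≤ K * b ^ 5 * D.h1Norm d ^ 2 := by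
  obtain ⟨C₁, hC10, hC1⟩ := exists_cube_bound hD
  obtain ⟨C, hC0, hC⟩ := exists_mul_bound hD
  -- The summand `C₁ M²` makes `b` a pointwise bound for `|u|`; the rest covers the squared `H¹`
  -- norm of `u² d`, where `16 = 2 · 8` and `5 = 1 + 2 · 2` count the function and its two partial
  -- derivatives.
  refine ⟨C₁ * M ^ 2 + 16 * (C ^ 2 * M) + 5, ?_, fun u hu huM b hb0 hb d hd => ?_⟩
  · have : 0 ≤ C₁ * M ^ 2 + 16 * (C ^ 2 * M) := by positivity
    linarith
  set K := C₁ * M ^ 2 + 16 * (C ^ 2 * M) + 5 with hK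
  have n1 : 0 ≤ C₁ * M ^ 2 := by positivity
  have n2 : 0 ≤ C ^ 2 * M := by positivity
  have hK1 : 1 ≤ K := by linarith
  have hh2 := h2Norm_nonneg u
  have hh1 := h1Norm_nonneg u
  have hh := h1Norm_nonneg d
  set h := D.h1Norm d with hhd
  have hb3 : 1 + D.h2Norm u ≤ b ^ 3 := by
    rw [hb]; exact le_mul_of_one_le_left (by positivity) hK1
  have hb1 : 1 ≤ b := by
    by_contra hlt
    push Not at hlt
    have := pow_le_one₀ (n := 3) hb0 hlt.le
    have h3 : b ^ 3 < 1 := pow_lt_one₀ hb0 hlt (by norm_num)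
    linarith
  have hub : ∀ᵐ x ∂D.μ, |u x| ≤ b := by
    filter_upwards [hC1 u hu] with x hx
    refine le_of_pow_le_pow_left₀ (n := 3) (by norm_num) hb0 (hx.trans ?_)
    rw [hb]
    calc C₁ * (D.h1Norm u ^ 2 * D.h2Norm u) ≤ C₁ * (M ^ 2 * (1 + D.h2Norm u)) := by
          gcongr; linarith
      _ = C₁ * M ^ 2 * (1 + D.h2Norm u) := by ring
      _ ≤ K * (1 + D.h2Norm u) := by gcongr; linarith
  have B := fun g => mul_of_bounded hub g
  -- the gradient of the product
  set m := fun i => mul (D.weakPartial i u) d with hm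
  have mc : ∀ i, m i =ᵐ[D.μ] fun x => D.weakPartial i u x * d x :=
    fun i => (hC _ (hu.2 i) d hd).1
  -- Ladyzhenskaya: the factor `‖∂u‖` is bounded by `M`, and `‖∂u‖_{H¹}` costs `b³`. In the gradient
  -- of `u² d` the extra factor `u` adds `b²`, which is where the exponent `5` comes from.
  have mb : ∀ i, ‖m i‖ ^ 2 ≤ C ^ 2 * M * b ^ 3 * h ^ 2 := by
    intro i
    have h1 := norm_weakPartial_le_h1Norm u i
    have h2 := h1Norm_weakPartial_le u i
    have h3 := norm_le_h1Norm d
    calc _ ≤ C ^ 2 * ((‖D.weakPartial i u‖ * D.h1Norm (D.weakPartial i u)) * (‖d‖ * h)) :=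
          (hC _ (hu.2 i) d hd).2
      _ ≤ C ^ 2 * ((M * b ^ 3) * (h * h)) := by
          have := h1Norm_nonneg (D.weakPartial i u)
          gcongr
          · exact h1.trans huM
          · exact h2.trans (by linarith)
      _ = _ := by ring
  have w1 : ∀ i, D.IsWeakPartial i (mul u d) (m i + mul u (D.weakPartial i d)) := by
    intro i
    refine isWeakPartial_mul hD hu.1 hd ?_
    filter_upwards [Lp.coeFn_add (m i) (mul u (D.weakPartial i d)), mc i,
      (B (D.weakPartial i d)).1] with x h1 h2 h3
    rw [h1, Pi.add_apply, h2, h3]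
  have hud : mul u d ∈ D.H1 := fun i => ⟨_, w1 i⟩
  set q := fun i => (2 : ℝ) • mul u (m i) + mul u (mul u (D.weakPartial i d)) with hq
  have w2 : ∀ i, D.IsWeakPartial i (mul u (mul u d)) (q i) := by
    intro i
    refine isWeakPartial_mul hD hu.1 hud ?_
    rw [(w1 i).weakPartial_eq hD]
    filter_upwards [Lp.coeFn_add ((2 : ℝ) • mul u (m i)) (mul u (mul u (D.weakPartial i d))),
      Lp.coeFn_smul (2 : ℝ) (mul u (m i)), (B (m i)).1, (B (mul u (D.weakPartial i d))).1,
      Lp.coeFn_add (m i) (mul u (D.weakPartial i d)), mc i, (B d).1] with x h1 h2 h3 h4 h5 h6 h7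
    simp only [hq, h1, h2, h3, h4, h5, h6, h7, Pi.add_apply, Pi.smul_apply, smul_eq_mul]
    ring
  have huud : mul u (mul u d) ∈ D.H1 := fun i => ⟨_, w2 i⟩
  have c1 : mul u (mul u d) =ᵐ[D.μ] fun x => u x * (u x * d x) := by
    filter_upwards [(B (mul u d)).1, (B d).1] with x h1 h2
    rw [h1, h2]
  refine ⟨⟨(B d).1, c1⟩, ⟨hud, huud⟩, ?_, ?_⟩
  · have p35 : b ^ 3 ≤ b ^ 5 := pow_le_pow_right₀ hb1 (by norm_num)
    have p25 : b ^ 2 ≤ b ^ 5 := pow_le_pow_right₀ hb1 (by norm_num)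
    have a0 : ‖mul u d‖ ^ 2 ≤ b ^ 5 * h ^ 2 := by
      calc _ ≤ (b * h) ^ 2 := by
            gcongr; exact (B d).2.trans (by gcongr; exact norm_le_h1Norm d)
        _ = b ^ 2 * h ^ 2 := by ring
        _ ≤ _ := by gcongr
    have a1 : ∀ i, ‖m i + mul u (D.weakPartial i d)‖ ^ 2 ≤ (2 * (C ^ 2 * M) + 2) * b ^ 5 * h ^ 2 := by
      intro i
      have e1 : ‖mul u (D.weakPartial i d)‖ ≤ b * h :=
        (B _).2.trans (by gcongr; exact norm_weakPartial_le_h1Norm d i)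
      calc _ ≤ (‖m i‖ + ‖mul u (D.weakPartial i d)‖) ^ 2 := by gcongr; exact norm_add_le _ _
        _ ≤ 2 * ‖m i‖ ^ 2 + 2 * ‖mul u (D.weakPartial i d)‖ ^ 2 := by
            nlinarith [sq_nonneg (‖m i‖ - ‖mul u (D.weakPartial i d)‖)]
        _ ≤ 2 * (C ^ 2 * M * b ^ 3 * h ^ 2) + 2 * (b * h) ^ 2 := by
            gcongr; exact mb i
        _ = 2 * (C ^ 2 * M) * b ^ 3 * h ^ 2 + 2 * b ^ 2 * h ^ 2 := by ring
        _ ≤ 2 * (C ^ 2 * M) * b ^ 5 * h ^ 2 + 2 * b ^ 5 * h ^ 2 := by gcongr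
        _ = _ := by ring
    rw [h1Norm_sq, gradInner_self, Fin.sum_univ_two, (w1 0).weakPartial_eq hD,
      (w1 1).weakPartial_eq hD]
    have hX : 0 ≤ b ^ 5 * h ^ 2 := by positivity
    have := a1 0
    have := a1 1
    calc _ ≤ b ^ 5 * h ^ 2 + ((2 * (C ^ 2 * M) + 2) * b ^ 5 * h ^ 2
          + (2 * (C ^ 2 * M) + 2) * b ^ 5 * h ^ 2) := by gcongr
      _ = (4 * (C ^ 2 * M) + 5) * (b ^ 5 * h ^ 2) := by ring
      _ ≤ K * (b ^ 5 * h ^ 2) := by gcongr; linarith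
      _ = _ := by ring
  · have p45 : b ^ 4 ≤ b ^ 5 := pow_le_pow_right₀ hb1 (by norm_num)
    have e0 : ∀ g : D.H, ‖mul u (mul u g)‖ ≤ b ^ 2 * ‖g‖ := fun g => by
      refine (B _).2.trans ?_
      rw [sq, mul_assoc]
      exact mul_le_mul_of_nonneg_left (B g).2 hb0
    have a0 : ‖mul u (mul u d)‖ ^ 2 ≤ b ^ 5 * h ^ 2 := by
      calc _ ≤ (b ^ 2 * h) ^ 2 := by
            gcongr; exact (e0 d).trans (by gcongr; exact norm_le_h1Norm d)
        _ = b ^ 4 * h ^ 2 := by ring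
        _ ≤ _ := by gcongr
    have a1 : ∀ i, ‖q i‖ ^ 2 ≤ (8 * (C ^ 2 * M) + 2) * b ^ 5 * h ^ 2 := by
      intro i
      have e1 : ‖mul u (mul u (D.weakPartial i d))‖ ≤ b ^ 2 * h :=
        (e0 _).trans (by gcongr; exact norm_weakPartial_le_h1Norm d i)
      have e2 : ‖(2 : ℝ) • mul u (m i)‖ ≤ 2 * (b * ‖m i‖) := by
        rw [norm_smul, Real.norm_of_nonneg zero_le_two]
        gcongr; exact (B _).2
      calc _ ≤ (‖(2 : ℝ) • mul u (m i)‖ + ‖mul u (mul u (D.weakPartial i d))‖) ^ 2 := by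
            gcongr; exact norm_add_le _ _
        _ ≤ (2 * (b * ‖m i‖) + b ^ 2 * h) ^ 2 := by gcongr
        _ ≤ 8 * b ^ 2 * ‖m i‖ ^ 2 + 2 * (b ^ 2 * h) ^ 2 := by
            nlinarith [sq_nonneg (2 * (b * ‖m i‖) - b ^ 2 * h)]
        _ ≤ 8 * b ^ 2 * (C ^ 2 * M * b ^ 3 * h ^ 2) + 2 * (b ^ 2 * h) ^ 2 := by
            gcongr; exact mb i
        _ = 8 * (C ^ 2 * M) * b ^ 5 * h ^ 2 + 2 * b ^ 4 * h ^ 2 := by ring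
        _ ≤ 8 * (C ^ 2 * M) * b ^ 5 * h ^ 2 + 2 * b ^ 5 * h ^ 2 := by gcongr
        _ = _ := by ring
    rw [h1Norm_sq, gradInner_self, Fin.sum_univ_two, (w2 0).weakPartial_eq hD,
      (w2 1).weakPartial_eq hD]
    calc _ ≤ b ^ 5 * h ^ 2 + ((8 * (C ^ 2 * M) + 2) * b ^ 5 * h ^ 2
          + (8 * (C ^ 2 * M) + 2) * b ^ 5 * h ^ 2) := by gcongr <;> apply a1
      _ = (16 * (C ^ 2 * M) + 5) * (b ^ 5 * h ^ 2) := by ring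
      _ ≤ K * (b ^ 5 * h ^ 2) := by gcongr; linarith
      _ = _ := by ring

/-- The nonlinear terms, tested against the difference of the solutions. -/
theorem inner_sub_limitForce_le (hD : D.Admissible) (C₀ : ℝ) {u e₁ e₂ : D.H} (hu : u ∈ D.H2)
    {y z : Plane → ℝ} (hy : MemLp y 2 D.μ) (hz : MemLp z 2 D.μ)
    (hN : MemLp (fun x => cubic (y x)) 2 D.μ) (hz2 : MemLp (fun x => z x ^ 2 - C₀) 2 D.μ)
    (hz3 : MemLp (fun x => z x ^ 3) 2 D.μ)
    (hd : toL2 D.μ (fun x => y x - z x) - u ∈ D.H1)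
    (he₁ : e₁ ∈ D.H1) (he₂ : e₂ ∈ D.H1)
    (h₁ : e₁ =ᵐ[D.μ] fun x => u x * (toL2 D.μ (fun x => y x - z x) - u) x)
    (h₂ : e₂ =ᵐ[D.μ] fun x => u x * (u x * (toL2 D.μ (fun x => y x - z x) - u) x)) :
    inner ℝ (toL2 D.μ (fun x => cubic (y x)) - limitForce C₀ u)
        (toL2 D.μ (fun x => y x - z x) - u) ≤
      ‖toL2 D.μ (fun x => y x - z x) - u‖ ^ 2
      + ((D.hNegNorm z).toReal + (D.hNegNorm fun x => z x ^ 3).toReal)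
        * D.h1Norm (toL2 D.μ (fun x => y x - z x) - u)
      + 3 * ((D.hNegNorm fun x => z x ^ 2 - C₀).toReal * D.h1Norm e₁)
      + 3 * ((D.hNegNorm z).toReal * D.h1Norm e₂) := by
  have hyz : MemLp (fun x => y x - z x) 2 D.μ := hy.sub hz
  set d := toL2 D.μ (fun x => y x - z x) - u with hdd
  have dc : d =ᵐ[D.μ] fun x => y x - z x - u x := by
    filter_upwards [Lp.coeFn_sub (toL2 D.μ (fun x => y x - z x)) u, coeFn_toL2 hyz] with x h1 h2
    rw [hdd, h1, Pi.sub_apply, h2]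
  have I := fun {w : Plane → ℝ} (hw : MemLp w 2 D.μ) (φ : D.H) =>
    integrable_mul_of_memLp_two hw (Lp.memLp φ)
  have i1 : Integrable (fun x => d x * d x) D.μ := integrable_mul_Lp d d
  have i2 := I hz d
  have i3 := I hz3 d
  have i4 := (I hz2 e₁).const_mul 3
  have i5 := (I hz e₂).const_mul 3
  have key : inner ℝ (toL2 D.μ (fun x => cubic (y x)) - limitForce C₀ u) d ≤
      ∫ x, ((((d x * d x + z x * d x) - z x ^ 3 * d x) - 3 * ((z x ^ 2 - C₀) * e₁ x))
        - 3 * (z x * e₂ x)) ∂D.μ := by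
    rw [L2.inner_def]
    refine integral_mono_ae (L2.integrable_inner _ _) ((((i1.add i2).sub i3).sub i4).sub i5) ?_
    filter_upwards [Lp.coeFn_sub (toL2 D.μ (fun x => cubic (y x))) (limitForce C₀ u),
      coeFn_toL2 hN, coeFn_limitForce hD C₀ hu, dc, h₁, h₂] with x a1 a2 a3 a4 a5 a6
    simp only [a1, a2, a3, a5, a6, Pi.sub_apply, RCLike.inner_apply, conj_trivial]
    have hyx : y x = d x + (u x + z x) := by rw [a4]; ring
    rw [hyx, cubic, cubic]
    -- The quadratic form `d² + 3 d w + 3 w²` with `w = u + z` has negative discriminant. This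
    -- dissipative part of the cube is discarded; the rest of the expansion is linear in `d`, apart
    -- from `d²`.
    have : 0 ≤ d x ^ 2 * (d x ^ 2 + 3 * d x * (u x + z x) + 3 * (u x + z x) ^ 2) := by
      refine mul_nonneg (sq_nonneg _) ?_
      nlinarith [sq_nonneg (d x + 3 / 2 * (u x + z x)), sq_nonneg (u x + z x)]
    nlinarith [this]
  have e : ∫ x, ((((d x * d x + z x * d x) - z x ^ 3 * d x) - 3 * ((z x ^ 2 - C₀) * e₁ x))
        - 3 * (z x * e₂ x)) ∂D.μ = ‖d‖ ^ 2 + (∫ x, z x * d x ∂D.μ) - (∫ x, z x ^ 3 * d x ∂D.μ)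
        - 3 * (∫ x, (z x ^ 2 - C₀) * e₁ x ∂D.μ) - 3 * ∫ x, z x * e₂ x ∂D.μ := by
    have j2 : Integrable (fun x => d x * d x + z x * d x) D.μ := i1.add i2
    have j3 : Integrable (fun x => d x * d x + z x * d x - z x ^ 3 * d x) D.μ := j2.sub i3
    have j4 : Integrable (fun x => d x * d x + z x * d x - z x ^ 3 * d x
      - 3 * ((z x ^ 2 - C₀) * e₁ x)) D.μ := j3.sub i4
    rw [integral_sub j4 i5, integral_sub j3 i4, integral_sub j2 i3, integral_add i1 i2,
      integral_const_mul, integral_const_mul]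
    congr 4
    rw [← real_inner_self_eq_norm_sq, L2.inner_def]
    simp [sq]
  rw [e] at key
  have b1 := abs_le.1 (abs_integral_mul_le_hNegNorm hD hz hd)
  have b2 := abs_le.1 (abs_integral_mul_le_hNegNorm hD hz3 hd)
  have b3 := abs_le.1 (abs_integral_mul_le_hNegNorm hD hz2 he₁)
  have b4 := abs_le.1 (abs_integral_mul_le_hNegNorm hD hz he₂)
  linarith [b1.2, b2.1, b3.1, b4.1]

/-- Young's inequality, with the weight `1/8` chosen so that all cross terms together use only half
of `‖d‖²_{H¹}`. -/
theorem mul_le_of_sq_le {a x h K : ℝ} (hK : 0 ≤ K)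
    (hx2 : x ^ 2 ≤ K * h ^ 2) : 3 * (a * x) ≤ h ^ 2 / 8 + 18 * K * a ^ 2 := by
  refine abs_le_of_sq_le_sq' (b := h ^ 2 / 8 + 18 * K * a ^ 2) ?_ (by positivity) |>.2
  have h1 : a ^ 2 * x ^ 2 ≤ a ^ 2 * (K * h ^ 2) := mul_le_mul_of_nonneg_left hx2 (sq_nonneg a)
  nlinarith [sq_nonneg (h ^ 2 / 8 - 18 * K * a ^ 2)]

theorem norm_lap_sq_le (u : D.H) : ‖D.lap u‖ ^ 2 ≤ 4 * D.h2Norm u ^ 2 := by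
  have h0 := norm_weakPartial_weakPartial_le u 0 0
  have h1 := norm_weakPartial_weakPartial_le u 1 1
  have : ‖D.lap u‖ ≤ 2 * D.h2Norm u := by
    rw [lap, Fin.sum_univ_two]
    linarith [norm_add_le (D.weakPartial 0 (D.weakPartial 0 u)) (D.weakPartial 1 (D.weakPartial 1 u))]
  calc _ ≤ (2 * D.h2Norm u) ^ 2 := by gcongr
    _ = _ := by ring

/-- The gradient of `d` is absorbed by the dissipation, so the bound contains only `‖d‖²`, the
squared dual norms with weight `b⁵`, and an `ε²` term depending on `u` alone. -/
theorem exists_energyRate_le (hD : D.Admissible) (C₀ : ℝ) {M : ℝ} (hM : 1 ≤ M) : ∃ K : ℝ, 1 ≤ K ∧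
    ∀ u ∈ D.V, D.h1Norm u ≤ M → ∀ b : ℝ, 0 ≤ b → b ^ 3 = K * (1 + D.h2Norm u) →
    ∀ (ε : ℝ) (y z : Plane → ℝ), MemLp y 2 D.μ → MemLp z 2 D.μ →
      MemLp (fun x => cubic (y x)) 2 D.μ → MemLp (fun x => z x ^ 2 - C₀) 2 D.μ →
      MemLp (fun x => z x ^ 3) 2 D.μ → toL2 D.μ (fun x => y x - z x) ∈ D.V →
      energyRate C₀ ε (toL2 D.μ (fun x => y x - z x)) u (toL2 D.μ (fun x => cubic (y x))) ≤
        3 / 2 * ‖toL2 D.μ (fun x => y x - z x) - u‖ ^ 2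
        + 20 * K * b ^ 5 * ((D.hNegNorm z).toReal ^ 2
          + (D.hNegNorm fun x => z x ^ 2 - C₀).toReal ^ 2)
        + 2 * (D.hNegNorm fun x => z x ^ 3).toReal ^ 2 + ε ^ 2 * D.h2Norm u ^ 2 := by
  obtain ⟨K, hK1, hK⟩ := exists_h1Norm_mul_le hD hM
  refine ⟨K, hK1, fun u hu huM b hb0 hb ε y z hy hz hN hz2 hz3 hv => ?_⟩
  set v := toL2 D.μ (fun x => y x - z x) with hvd
  have hd : v - u ∈ D.V := sub_mem_V hD hv hu
  obtain ⟨⟨c1, c2⟩, ⟨m1, m2⟩, b1, b2⟩ := hK u hu.1 huM b hb0 hb (v - u) hd.1.1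
  have main := inner_sub_limitForce_le hD C₀ hu.1 hy hz hN hz2 hz3 hd.1.1 m1 m2 c1 c2
  rw [← hvd] at main
  have hh := h1Norm_nonneg (v - u)
  have hsq := h1Norm_sq (v - u)
  have hg := gradInner_self_nonneg (v - u)
  set h := D.h1Norm (v - u) with hhd
  set ζ₁ := (D.hNegNorm z).toReal
  set ζ₂ := (D.hNegNorm fun x => z x ^ 2 - C₀).toReal
  set ζ₃ := (D.hNegNorm fun x => z x ^ 3).toReal
  have hb1 : 1 ≤ b ^ 5 := by
    have h3 : 1 ≤ b ^ 3 := by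
      rw [hb]; nlinarith [h2Norm_nonneg u]
    have : 1 ≤ b := by
      by_contra hlt
      push Not at hlt
      have := pow_lt_one₀ hb0 hlt (n := 3) (by norm_num)
      linarith
    exact one_le_pow₀ this
  have hKb : 0 ≤ K * b ^ 5 := by positivity
  have hKb1 : 1 ≤ K * b ^ 5 := one_le_mul_of_one_le_of_one_le hK1 hb1
  have y1 := mul_le_of_sq_le (a := ζ₂) hKb b1
  have y2 := mul_le_of_sq_le (a := ζ₁) hKb b2
  have y3 : (ζ₁ + ζ₃) * h ≤ h ^ 2 / 4 + 2 * ζ₁ ^ 2 + 2 * ζ₃ ^ 2 := by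
    nlinarith [sq_nonneg (h / 4 - ζ₁), sq_nonneg (h / 4 - ζ₃)]
  -- Completing the square: `-‖Δv‖² + ⟨Δv, Δu⟩ ≤ ‖Δu‖² / 4`, so no bound on `Δv` is needed.
  have hl : - (ε ^ 2 * inner ℝ (D.lap v) (D.lap (v - u))) ≤ ε ^ 2 * D.h2Norm u ^ 2 := by
    rw [← mul_neg]
    refine mul_le_mul_of_nonneg_left ?_ (sq_nonneg ε)
    rw [lap_sub hD hv.1 hu.1, inner_sub_right, real_inner_self_eq_norm_sq]
    nlinarith [real_inner_le_norm (D.lap v) (D.lap u), norm_lap_sq_le u,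
      sq_nonneg (‖D.lap v‖ - ‖D.lap u‖ / 2)]
  have hζ : 2 * ζ₁ ^ 2 ≤ 2 * (K * b ^ 5) * ζ₁ ^ 2 := by nlinarith [sq_nonneg ζ₁]
  have hζ2 : 0 ≤ K * b ^ 5 * ζ₂ ^ 2 := by positivity
  -- The cross terms cost `1/8 + 1/8 + 1/4 = 1/2` of `h²`, the squared `H¹` norm of the difference.
  -- The dissipation covers their gradient part, and the `L²` part raises the coefficient `1` to
  -- `3/2`. The constant `20` is `18 + 2`.
  rw [energyRate]
  linarith [main, y1, y2, y3, hl, hζ, hζ2, hsq, hg]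

end Setting

/-! ### Gronwall, Hölder in time and the pathwise bound -/

/-- Gronwall's inequality in integral form. -/
theorem le_mul_exp_of_le_integral {T G c : ℝ} (hc : 0 ≤ c) {f : ℝ → ℝ}
    (hf : ContinuousOn f (Icc 0 T))
    (h : ∀ t ∈ Icc 0 T, f t ≤ G + c * ∫ s in (0 : ℝ)..t, f s) {t : ℝ} (ht : t ∈ Icc 0 T) :
    f t ≤ G * Real.exp (c * t) := by
  have hT : 0 ≤ T := ht.1.trans ht.2
  set g : ℝ → ℝ := fun t => f (projIcc 0 T hT t) with hg
  have gc : Continuous g := hf.domRestrict.comp continuous_projIcc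
  have gf : ∀ t ∈ Icc 0 T, g t = f t := fun t ht => by simp only [hg]; rw [projIcc_of_mem hT ht]
  have gi : ∀ t ∈ Icc 0 T, ∫ s in (0 : ℝ)..t, f s = ∫ s in (0 : ℝ)..t, g s := fun t ht => by
    refine intervalIntegral.integral_congr fun s hs => ?_
    rw [uIcc_of_le ht.1] at hs
    exact (gf s ⟨hs.1, hs.2.trans ht.2⟩).symm
  -- The right-hand side of the hypothesis, multiplied by the integrating factor, is nonincreasing.
  -- This needs no sign of `f` or `G`.
  set F : ℝ → ℝ := fun t => (G + c * ∫ s in (0 : ℝ)..t, g s) * Real.exp (-(c * t)) with hF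
  have dF : ∀ t, HasDerivAt F (c * g t * Real.exp (-(c * t)) + (G + c * ∫ s in (0 : ℝ)..t, g s)
      * (Real.exp (-(c * t)) * (-(c * 1)))) t := by
    intro t
    have h1 : HasDerivAt (fun t => G + c * ∫ s in (0 : ℝ)..t, g s) (c * g t) t :=
      ((gc.integral_hasStrictDerivAt 0 t).hasDerivAt.const_mul c).const_add G
    exact h1.mul ((((hasDerivAt_id t).const_mul c).neg).exp)
  have hanti : AntitoneOn F (Icc 0 T) := by
    refine antitoneOn_of_deriv_nonpos (convex_Icc 0 T)
      (fun t _ => (dF t).continuousAt.continuousWithinAt)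
      (fun t _ => (dF t).differentiableAt.differentiableWithinAt) fun t ht => ?_
    rw [interior_Icc] at ht
    have ht' := Ioo_subset_Icc_self ht
    have h1 := h t ht'
    rw [gi t ht', ← gf t ht'] at h1
    rw [(dF t).deriv]
    have h2 := mul_le_mul_of_nonneg_left h1 (mul_nonneg hc (Real.exp_pos (-(c * t))).le)
    linarith
  have h1 := hanti (left_mem_Icc.2 hT) ht ht.1
  have h2 : F 0 = G := by simp [hF]
  rw [h2] at h1
  have h3 := h t ht
  rw [gi t ht] at h3
  refine h3.trans ?_
  have h4 := mul_le_mul_of_nonneg_right h1 (Real.exp_pos (c * t)).le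
  rwa [hF, mul_assoc, ← Real.exp_add, neg_add_cancel, Real.exp_zero, mul_one] at h4

theorem integral_le_toReal_lintegral {α : Type*} [MeasurableSpace α] {ν : Measure α} {g : α → ℝ}
    (hg : Integrable g ν) : ∫ x, g x ∂ν ≤ (∫⁻ x, ENNReal.ofReal (g x) ∂ν).toReal := by
  rw [integral_eq_lintegral_pos_part_sub_lintegral_neg_part hg]
  linarith [ENNReal.toReal_nonneg (a := ∫⁻ x, ENNReal.ofReal (-g x) ∂ν)]

/-- Hölder's inequality, for a weight all of whose relevant powers are controlled by the sixth. -/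
theorem lintegral_pow_mul_sq_le {α : Type*} [MeasurableSpace α] {ν : Measure α} {β ζ : α → ℝ≥0∞}
    (hβ : AEMeasurable β ν) (hζ : AEMeasurable ζ ν) (h1 : ∀ x, 1 ≤ β x) {p : ℝ} (hp : 12 ≤ p) :
    ∫⁻ x, β x ^ 5 * ζ x ^ 2 ∂ν ≤
      (1 + ∫⁻ x, β x ^ 6 ∂ν) * ((∫⁻ x, ζ x ^ p ∂ν) ^ (1 / p)) ^ 2 := by
  have hpq := Real.HolderConjugate.conjExponent (p := p / 2) (by linarith)
  have hq : Real.conjExponent (p / 2) = p / (p - 2) := by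
    rw [Real.conjExponent]; field_simp
  set q := Real.conjExponent (p / 2) with hqd
  have hq0 : 0 < q := hpq.symm.pos
  have hq1 : 1 ≤ q := hpq.symm.lt.le
  -- The conjugate exponent of `p/2` is `p/(p-2)`, and five times it is at most `6` exactly when `p
  -- ≥ 12`: this decides the threshold.
  have hq5 : 5 * q ≤ 6 := by
    rw [hq, ← mul_div_assoc, div_le_iff₀ (by linarith)]; linarith
  have H := ENNReal.lintegral_mul_le_Lp_mul_Lq ν hpq.symm (hβ.pow_const 5) (hζ.pow_const 2)
  refine H.trans ?_
  gcongr ?_ * ?_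
  · have h2 : ∫⁻ x, (β x ^ 5) ^ q ∂ν ≤ ∫⁻ x, β x ^ 6 ∂ν := by
      refine lintegral_mono fun x => ?_
      rw [← ENNReal.rpow_natCast, ← ENNReal.rpow_natCast, ← ENNReal.rpow_mul]
      exact ENNReal.rpow_le_rpow_of_exponent_le (h1 x) (by push_cast; exact hq5)
    -- Adding `1` makes the base at least `1`, so that the exponent `1/q ≤ 1` can be raised to `1`
    -- and the constant does not depend on `p`.
    calc _ ≤ (1 + ∫⁻ x, β x ^ 6 ∂ν) ^ (1 / q) :=
          ENNReal.rpow_le_rpow (h2.trans le_add_self) (by positivity)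
      _ ≤ (1 + ∫⁻ x, β x ^ 6 ∂ν) ^ (1 : ℝ) :=
          ENNReal.rpow_le_rpow_of_exponent_le le_self_add (by rw [div_le_one hq0]; exact hq1)
      _ = _ := ENNReal.rpow_one _
  · have e : ∀ x, (ζ x ^ 2) ^ (p / 2) = ζ x ^ p := by
      intro x
      rw [← ENNReal.rpow_natCast, ← ENNReal.rpow_mul]
      congr 1; push_cast; ring
    simp_rw [e]
    rw [← ENNReal.rpow_natCast, ← ENNReal.rpow_mul]
    refine le_of_eq ?_
    congr 1; push_cast; field_simp

namespace Setting

variable {D : Setting}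

/-- The error estimate for a single path. -/
theorem exists_pathwise_bound (hD : D.Admissible) {C₀ T p : ℝ} (hT : 0 < T) {u : ℝ → D.H}
    (hu : D.IsLimitSolution C₀ T u) (hp : 12 ≤ p) : ∃ L : ℝ, 0 < L ∧
    ∀ ε : ℝ, 0 < ε → ε < 1 → ∀ γ : ℝ, ε ≤ γ → ∀ z y : ℝ → Plane → ℝ,
      D.IsC0Path T z → D.IsRegularizedSolution ε T z y →
      ‖toL2 D.μ (fun x => y 0 x - z 0 x) - u 0‖ ^ 2 ≤ γ →
      D.lpNegSq p T (fun t x => z t x ^ 2 - C₀) ≤ ENNReal.ofReal γ →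
      D.lpNegSq p T z ≤ ENNReal.ofReal γ →
      D.lpNegSq 2 T (fun t x => z t x ^ 3) ≤ ENNReal.ofReal γ →
      ∀ t ∈ Icc 0 T, ‖toL2 D.μ (fun x => y t x - z t x) - u t‖ ^ 2 ≤ L * γ := by
  obtain ⟨M, hM1, hM⟩ := hu.1.exists_h1Norm_le
  obtain ⟨K, hK1, hK⟩ := exists_energyRate_le hD C₀ hM1
  set ν := volume.restrict (Icc 0 T) with hν
  have hY := hu.2.1.memLp_h2Norm
  set b : ℝ → ℝ := fun t => (K * (1 + D.h2Norm (u t))) ^ (1 / 3 : ℝ) with hb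
  have hψ : ∀ t, 1 ≤ K * (1 + D.h2Norm (u t)) := fun t =>
    one_le_mul_of_one_le_of_one_le hK1 (by linarith [h2Norm_nonneg (u t)])
  have hb1 : ∀ t, 1 ≤ b t := fun t => Real.one_le_rpow (hψ t) (by norm_num)
  have hb0 : ∀ t, 0 ≤ b t := fun t => zero_le_one.trans (hb1 t)
  have hb3 : ∀ t, b t ^ 3 = K * (1 + D.h2Norm (u t)) := by
    intro t
    rw [hb, ← Real.rpow_natCast, ← Real.rpow_mul (zero_le_one.trans (hψ t))]
    norm_num
  set β : ℝ → ℝ≥0∞ := fun t => ENNReal.ofReal (b t) with hβ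
  have mβ : AEMeasurable β ν :=
    ((((hY.1.aemeasurable.const_add 1).const_mul K).pow_const _).ennreal_ofReal)
  have hβ1 : ∀ t, 1 ≤ β t := fun t => by
    rw [hβ, ← ENNReal.ofReal_one]; exact ENNReal.ofReal_le_ofReal (hb1 t)
  have : IsFiniteMeasure ν := ⟨by simp [hν]⟩
  -- `b⁶` is `K² (1 + ‖u‖_{H²})²`, integrable precisely because `u ∈ L²([0,T]; H²)`.
  have hB6 : ∫⁻ t, β t ^ 6 ∂ν ≠ ⊤ := by
    have e : ∀ t, β t ^ 6 = ENNReal.ofReal ((K * (1 + D.h2Norm (u t))) ^ 2) := by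
      intro t
      rw [hβ, ← ENNReal.ofReal_pow (hb0 t), ← hb3 t]; congr 1; ring
    simp_rw [e]
    have hm : MemLp (fun t => K * (1 + D.h2Norm (u t))) 2 ν :=
      ((memLp_const (1 : ℝ)).add hY).const_mul K
    exact hm.integrable_sq.lintegral_lt_top.ne
  have hY2 : ∫⁻ t, ENNReal.ofReal (D.h2Norm (u t) ^ 2) ∂ν ≠ ⊤ :=
    hY.integrable_sq.lintegral_lt_top.ne
  set B := (1 + ∫⁻ t, β t ^ 6 ∂ν).toReal with hB
  set Y := (∫⁻ t, ENNReal.ofReal (D.h2Norm (u t) ^ 2) ∂ν).toReal with hYd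
  have hB0 : 0 ≤ B := ENNReal.toReal_nonneg
  have hY0 : 0 ≤ Y := ENNReal.toReal_nonneg
  -- One `B` each for `Z` and `Z² - C₀`, the `2` for `Z³`, and `Y` for the fourth order term.
  set L₁ := 20 * K * (B + B) + 2 + Y with hL₁
  have hL₁0 : 0 ≤ L₁ := by positivity
  refine ⟨(1 + 2 * L₁) * Real.exp (3 * T), by positivity,
    fun ε hε hε1 γ hγ z y hz hy h0 hz2 hz1 hz3 => ?_⟩
  have hγ0 : 0 ≤ γ := hε.le.trans hγ
  obtain ⟨iE, dc, hV, hen⟩ := hy.energy_le hD hu hz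
  have hyc := hy.isC0Path hz
  have cN : D.IsC0Path T (fun t x => cubic (y t x)) := hyc.comp continuous_cubic
  have c2 : D.IsC0Path T (fun t x => z t x ^ 2 - C₀) :=
    hz.comp (φ := fun r => r ^ 2 - C₀) (by fun_prop)
  have c3 : D.IsC0Path T (fun t x => z t x ^ 3) := hz.comp (φ := fun r => r ^ 3) (by fun_prop)
  set E := fun t => energyRate C₀ ε (toL2 D.μ (fun x => y t x - z t x)) (u t)
    (toL2 D.μ fun x => cubic (y t x)) with hE
  set d := fun t => toL2 D.μ (fun x => y t x - z t x) - u t with hd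
  set ζ₁ := fun t => D.hNegNorm (z t) with hζ₁
  set ζ₂ := fun t => D.hNegNorm (fun x => z t x ^ 2 - C₀) with hζ₂
  set ζ₃ := fun t => D.hNegNorm (fun x => z t x ^ 3) with hζ₃
  have m1 : AEMeasurable ζ₁ ν := hz.aemeasurable_hNegNorm hD hT.le
  have m2 : AEMeasurable ζ₂ ν := c2.aemeasurable_hNegNorm hD hT.le
  have m3 : AEMeasurable ζ₃ ν := c3.aemeasurable_hNegNorm hD hT.le
  set R : ℝ → ℝ≥0∞ := fun t => ENNReal.ofReal (20 * K) * (β t ^ 5 * ζ₁ t ^ 2 + β t ^ 5 * ζ₂ t ^ 2)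
    + 2 * ζ₃ t ^ 2 + ENNReal.ofReal γ * ENNReal.ofReal (D.h2Norm (u t) ^ 2) with hR
  -- Here `ε < 1` enters: `ε² ≤ ε ≤ γ`.
  have hεγ : ε ^ 2 ≤ γ := by nlinarith
  have hER : ∀ᵐ t ∂ν, ENNReal.ofReal (E t - 3 / 2 * ‖d t‖ ^ 2) ≤ R t := by
    filter_upwards [hV, ae_restrict_mem measurableSet_Icc] with t ht htT
    have key := hK (u t) ht.2 (hM t htT) (b t) (hb0 t) (hb3 t) ε (y t) (z t) (hyc.memLp hD htT)
      (hz.memLp hD htT) (cN.memLp hD htT) (c2.memLp hD htT) (c3.memLp hD htT) ht.1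
    have f1 : ENNReal.ofReal ((ζ₁ t).toReal ^ 2) = ζ₁ t ^ 2 := by
      rw [ENNReal.ofReal_pow ENNReal.toReal_nonneg,
        ENNReal.ofReal_toReal (hNegNorm_ne_top (hz.memLp hD htT))]
    have f2 : ENNReal.ofReal ((ζ₂ t).toReal ^ 2) = ζ₂ t ^ 2 := by
      rw [ENNReal.ofReal_pow ENNReal.toReal_nonneg,
        ENNReal.ofReal_toReal (hNegNorm_ne_top (c2.memLp hD htT))]
    have f3 : ENNReal.ofReal ((ζ₃ t).toReal ^ 2) = ζ₃ t ^ 2 := by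
      rw [ENNReal.ofReal_pow ENNReal.toReal_nonneg,
        ENNReal.ofReal_toReal (hNegNorm_ne_top (c3.memLp hD htT))]
    have hle : E t - 3 / 2 * ‖d t‖ ^ 2 ≤ 20 * K * (b t ^ 5 * (ζ₁ t).toReal ^ 2
        + b t ^ 5 * (ζ₂ t).toReal ^ 2) + 2 * (ζ₃ t).toReal ^ 2 + γ * D.h2Norm (u t) ^ 2 := by
      have h5 := mul_le_mul_of_nonneg_right hεγ (sq_nonneg (D.h2Norm (u t)))
      simp only [hE, hd, hζ₁, hζ₂, hζ₃]
      linarith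
    have p1 : 0 ≤ b t ^ 5 * (ζ₁ t).toReal ^ 2 := by have := hb0 t; positivity
    have p2 : 0 ≤ b t ^ 5 * (ζ₂ t).toReal ^ 2 := by have := hb0 t; positivity
    refine (ENNReal.ofReal_le_ofReal hle).trans (le_of_eq ?_)
    rw [ENNReal.ofReal_add (by positivity) (by positivity),
      ENNReal.ofReal_add (by positivity) (by positivity), ENNReal.ofReal_mul (p := 20 * K)
      (by positivity), ENNReal.ofReal_add p1 p2, ENNReal.ofReal_mul (pow_nonneg (hb0 t) 5),
      ENNReal.ofReal_mul (pow_nonneg (hb0 t) 5), f1, f2, ENNReal.ofReal_mul zero_le_two, f3,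
      ENNReal.ofReal_mul hγ0, ENNReal.ofReal_pow (hb0 t)]
    simp [hR, hβ]
  have hRint : ∫⁻ t, R t ∂ν ≤ ENNReal.ofReal (L₁ * γ) := by
    have n1 : AEMeasurable (fun t => β t ^ 5 * ζ₁ t ^ 2) ν := (mβ.pow_const 5).mul (m1.pow_const 2)
    have n2 : AEMeasurable (fun t => β t ^ 5 * ζ₂ t ^ 2) ν := (mβ.pow_const 5).mul (m2.pow_const 2)
    have n12 : AEMeasurable (fun t => ENNReal.ofReal (20 * K) *
        (β t ^ 5 * ζ₁ t ^ 2 + β t ^ 5 * ζ₂ t ^ 2)) ν := (n1.add n2).const_mul _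
    have n3 : AEMeasurable (fun t => 2 * ζ₃ t ^ 2) ν := (m3.pow_const 2).const_mul _
    have n123 : AEMeasurable (fun t => ENNReal.ofReal (20 * K) *
        (β t ^ 5 * ζ₁ t ^ 2 + β t ^ 5 * ζ₂ t ^ 2) + 2 * ζ₃ t ^ 2) ν := n12.add n3
    rw [hR, lintegral_add_left' n123, lintegral_add_left' n12,
      lintegral_const_mul' _ _ ENNReal.ofReal_ne_top, lintegral_add_left' n1,
      lintegral_const_mul' _ _ (by simp), lintegral_const_mul' _ _ ENNReal.ofReal_ne_top]
    have hBe : 1 + ∫⁻ t, β t ^ 6 ∂ν = ENNReal.ofReal B :=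
      (ENNReal.ofReal_toReal (by simp [hB6])).symm
    have hYe : ∫⁻ t, ENNReal.ofReal (D.h2Norm (u t) ^ 2) ∂ν = ENNReal.ofReal Y :=
      (ENNReal.ofReal_toReal hY2).symm
    have q1 : ∫⁻ t, β t ^ 5 * ζ₁ t ^ 2 ∂ν ≤ ENNReal.ofReal B * ENNReal.ofReal γ := by
      refine (lintegral_pow_mul_sq_le mβ m1 hβ1 hp).trans ?_
      rw [hBe]
      exact mul_le_mul_right hz1 _
    have q2 : ∫⁻ t, β t ^ 5 * ζ₂ t ^ 2 ∂ν ≤ ENNReal.ofReal B * ENNReal.ofReal γ := by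
      refine (lintegral_pow_mul_sq_le mβ m2 hβ1 hp).trans ?_
      rw [hBe]
      exact mul_le_mul_right hz2 _
    -- The cube is paired with `d` alone, without the weight `b⁵`, so integrability in time of order
    -- `2` is enough for it.
    have q3 : ∫⁻ t, ζ₃ t ^ 2 ∂ν ≤ ENNReal.ofReal γ := by
      have h := hz3
      rw [lpNegSq, ← ENNReal.rpow_natCast, ← ENNReal.rpow_mul] at h
      norm_num at h
      exact h
    rw [hYe]
    calc _ ≤ ENNReal.ofReal (20 * K) * (ENNReal.ofReal B * ENNReal.ofReal γ
          + ENNReal.ofReal B * ENNReal.ofReal γ) + ENNReal.ofReal 2 * ENNReal.ofReal γ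
          + ENNReal.ofReal γ * ENNReal.ofReal Y := by
          rw [ENNReal.ofReal_ofNat]
          gcongr
      _ = _ := by
          rw [← ENNReal.ofReal_mul hB0, ← ENNReal.ofReal_add (by positivity) (by positivity),
            ← ENNReal.ofReal_mul (by positivity), ← ENNReal.ofReal_mul (by positivity),
            ← ENNReal.ofReal_mul (by positivity), ← ENNReal.ofReal_add (by positivity)
            (by positivity), ← ENNReal.ofReal_add (by positivity) (by positivity)]
          congr 1
          rw [hL₁]; ring
  have dn : ContinuousOn (fun t => ‖d t‖ ^ 2) (Icc 0 T) := dc.norm.pow 2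
  have idn : IntegrableOn (fun t => ‖d t‖ ^ 2) (Icc 0 T) := dn.integrableOn_Icc
  -- The initial error contributes `γ`; the factor `2` of the energy inequality gives `2 L₁` and
  -- turns `3/2` into `3`.
  have hstep : ∀ τ ∈ Icc 0 T, ‖d τ‖ ^ 2 ≤ (1 + 2 * L₁) * γ + 3 * ∫ t in (0 : ℝ)..τ, ‖d t‖ ^ 2 := by
    intro τ hτ
    have hsub : Ioc 0 τ ⊆ Icc 0 T := fun s hs => ⟨hs.1.le, hs.2.trans hτ.2⟩
    have toI : ∀ {f : ℝ → ℝ}, IntegrableOn f (Icc 0 T) → IntervalIntegrable f volume 0 τ :=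
      fun hf => (intervalIntegrable_iff_integrableOn_Ioc_of_le hτ.1).2 (hf.mono_set hsub)
    have idc : IntegrableOn (fun t => 3 / 2 * ‖d t‖ ^ 2) (Icc 0 T) := idn.const_mul _
    have h1 : ∫ t in (0 : ℝ)..τ, (E t - 3 / 2 * ‖d t‖ ^ 2) ≤ L₁ * γ := by
      rw [intervalIntegral.integral_of_le hτ.1]
      refine (integral_le_toReal_lintegral ((iE.sub idc).mono_set hsub)).trans ?_
      refine ENNReal.toReal_le_of_le_ofReal (by positivity) ?_
      calc _ ≤ ∫⁻ t, ENNReal.ofReal (E t - 3 / 2 * ‖d t‖ ^ 2) ∂ν := lintegral_mono_set hsub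
        _ ≤ ∫⁻ t, R t ∂ν := lintegral_mono_ae hER
        _ ≤ _ := hRint
    rw [intervalIntegral.integral_sub (toI iE) (toI idc), intervalIntegral.integral_const_mul] at h1
    have h2 := hen τ hτ
    simp only [hd] at h1 ⊢
    linarith
  intro t ht
  refine (le_mul_exp_of_le_integral (by norm_num) dn hstep ht).trans ?_
  have h1 : Real.exp (3 * t) ≤ Real.exp (3 * T) := by
    apply Real.exp_le_exp.2; linarith [ht.2]
  calc _ ≤ (1 + 2 * L₁) * γ * Real.exp (3 * T) := by gcongr
    _ = _ := by ring

end Setting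

/-! ### The stochastic convolution at time zero -/

namespace Setting

variable {D : Setting}

theorem l2Sq_eq {w : Plane → ℝ} {h : D.H} (hw : ∀ᵐ x ∂D.μ, ‖w x‖ = ‖h x‖) :
    D.l2Sq w = ENNReal.ofReal (‖h‖ ^ 2) := by
  rw [l2Sq, eLpNorm_congr_norm_ae hw, ENNReal.ofReal_pow (norm_nonneg _), ofReal_norm,
    Lp.enorm_def]

/-- The stochastic convolution vanishes at time zero. -/
theorem IsStochasticConvolution.ae_toL2_zero (hD : D.Admissible) {Ω : Type*} [MeasurableSpace Ω]
    {P : Measure Ω} {W : D.WhiteNoise P} {ε σ T : ℝ} {Z : ℝ → Ω → Plane → ℝ} (hT : 0 ≤ T)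
    (hZ : D.IsStochasticConvolution W ε σ T Z) : ∀ᵐ a ∂P, toL2 D.μ (Z 0 a) = 0 := by
  obtain ⟨S, -, hS⟩ := hZ
  have := isFiniteMeasure_μ hD
  have : Fact ((2 : ℝ≥0∞) ≠ ⊤) := ⟨by simp⟩
  have h2c : SecondCountableTopology (Lp ℝ 2 D.μ) := inferInstance
  have key : ∀ h : D.H, ∀ᵐ a ∂P, inner ℝ (toL2 D.μ (Z 0 a)) h = 0 := by
    intro h
    -- At time zero the integrand is supported on the null set `{0}`, so its class is zero and the
    -- Wiener integral vanishes.
    have h0 : toL2 (volume.restrict (Ici 0)) (indicator (Icc (0 : ℝ) 0)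
        (fun s => ContinuousLinearMap.adjoint (S (0 - s)) h)) = 0 := by
      have e : indicator (Icc (0 : ℝ) 0) (fun s => ContinuousLinearMap.adjoint (S (0 - s)) h)
          =ᵐ[volume.restrict (Ici 0)] fun _ => 0 := by
        refine ae_restrict_of_ae ?_
        filter_upwards [Measure.ae_ne volume (0 : ℝ)] with s hs
        refine indicator_of_notMem (fun h => hs ?_) _
        rwa [Icc_self] at h
      rw [toL2_congr e, toL2, dif_pos (MemLp.zero' (ε := D.H))]
      exact MemLp.toLp_zero _
    filter_upwards [hS 0 (left_mem_Icc.2 hT) h, Lp.coeFn_zero ℝ 2 P] with a h1 h2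
    rw [h1, h0, map_zero, h2]; simp
  -- A countable dense family of `h` gives one null set for all `h`, by continuity of the inner
  -- product.
  have hall := ae_all_iff.2 fun n => key (TopologicalSpace.denseSeq (Lp ℝ 2 D.μ) n)
  filter_upwards [hall] with a ha
  have hc : (fun h : D.H => inner ℝ (toL2 D.μ (Z 0 a)) h) = fun _ => 0 := by
    refine Continuous.ext_on (TopologicalSpace.denseRange_denseSeq (Lp ℝ 2 D.μ)) (by fun_prop)
      continuous_const ?_
    rintro _ ⟨n, rfl⟩
    exact ha n
  exact inner_self_eq_zero.1 (congrFun hc (toL2 D.μ (Z 0 a)))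

end Setting

end RegAC

end

/-! ### The union bound -/

theorem mainTheorem6 (D : RegAC.Setting) (hD : D.Admissible) (C₀ : ℝ) :
    ∃ ε₀ : ℝ, 0 < ε₀ ∧ ∃ p₀ : ℝ, 2 < p₀ ∧
      ∀ T : ℝ, 0 < T → ∀ u : ℝ → D.H, D.IsLimitSolution C₀ T u → ∀ p : ℝ, p₀ ≤ p →
        ∃ K : ℝ, 0 < K ∧
          ∀ ε : ℝ, 0 < ε → ε < ε₀ → ∀ γ : ℝ, ε ≤ γ →
            ∀ (Ω : Type*) [MeasurableSpace Ω] (P : MeasureTheory.Measure Ω)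
              [MeasureTheory.IsProbabilityMeasure P] (W : D.WhiteNoise P) (σ : ℝ)
              (Z uε : ℝ → Ω → RegAC.Plane → ℝ),
              D.IsStochasticConvolution W ε σ T Z →
              (∀ᵐ ω ∂P, D.IsC0Path T (fun t => Z t ω)) →
              (∀ᵐ ω ∂P, D.IsRegularizedSolution ε T (fun t => Z t ω) (fun t => uε t ω)) →
              P {ω | ENNReal.ofReal (K * γ) <
                  ⨆ t ∈ Set.Icc 0 T, D.l2Sq (fun x => uε t ω x - u t x - Z t ω x)} ≤
                P {ω | ENNReal.ofReal γ < D.l2Sq (fun x => u 0 x - uε 0 ω x)} +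
                P {ω | ENNReal.ofReal γ <
                  D.lpNegSq p T (fun t x => Z t ω x ^ 2 - C₀)} +
                P {ω | ENNReal.ofReal γ < D.lpNegSq p T (fun t => Z t ω)} +
                P {ω | ENNReal.ofReal γ <
                  D.lpNegSq 2 T (fun t x => Z t ω x ^ 3)} := by
  -- `ε₀ = 1` serves to obtain `ε² ≤ γ`, and `p₀ = 12` is the Hölder threshold for the weight `b⁵`.
  refine ⟨1, one_pos, 12, by norm_num, fun T hT u hu p hp => ?_⟩
  obtain ⟨L, hL, key⟩ := RegAC.Setting.exists_pathwise_bound hD hT hu hp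
  refine ⟨L, hL, fun ε hε hε1 γ hγ Ω _ P _ W σ Z uε hZ hZc hsol => ?_⟩
  have hγ0 : 0 ≤ γ := hε.le.trans hγ
  -- Subadditivity of `P` reduces the claim to an inclusion of events up to a null set. Neither step
  -- asks for measurability of the events.
  refine (measure_mono_ae ?_).trans ((measure_union_le _ _).trans (add_le_add_left
    ((measure_union_le _ _).trans (add_le_add_left (measure_union_le _ _) _)) _))
  filter_upwards [hZc, hsol, hZ.ae_toL2_zero hD hT.le] with ω hz hy h0 hbad
  by_contra hno
  obtain ⟨hno, h4⟩ := not_or.1 hno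
  obtain ⟨hno, h3⟩ := not_or.1 hno
  obtain ⟨h1, h2⟩ := not_or.1 hno
  simp only [Set.mem_ofPred_eq, not_lt] at h1 h2 h3 h4 hbad
  have mem0 : (0 : ℝ) ∈ Set.Icc 0 T := Set.left_mem_Icc.2 hT.le
  have hd : ∀ t ∈ Set.Icc 0 T, RegAC.toL2 D.μ (fun x => uε t ω x - Z t ω x) - u t
      =ᵐ[D.μ] fun x => uε t ω x - u t x - Z t ω x := by
    intro t ht
    filter_upwards [Lp.coeFn_sub (RegAC.toL2 D.μ (fun x => uε t ω x - Z t ω x)) (u t),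
      RegAC.coeFn_toL2 (hy.1.memLp hD ht)] with x a1 a2
    rw [a1, Pi.sub_apply, a2]; ring
  -- The event concerns `u(0) - u_ε(0)`, while the energy estimate starts from `u_ε(0) - Z(0) -
  -- u(0)`; the two agree in norm because `Z(0) = 0` almost everywhere in space.
  have hd0 : ‖RegAC.toL2 D.μ (fun x => uε 0 ω x - Z 0 ω x) - u 0‖ ^ 2 ≤ γ := by
    have e := RegAC.Setting.l2Sq_eq (D := D) (w := fun x => u 0 x - uε 0 ω x)
      (h := RegAC.toL2 D.μ (fun x => uε 0 ω x - Z 0 ω x) - u 0) (by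
        have hZ0 := RegAC.coeFn_toL2 (hz.memLp hD mem0)
        rw [h0] at hZ0
        filter_upwards [hd 0 mem0, hZ0, Lp.coeFn_zero ℝ 2 D.μ] with x b1 b2 b3
        rw [b1, ← b2, b3, Pi.zero_apply, sub_zero, norm_sub_rev])
    rw [e] at h1
    exact (ENNReal.ofReal_le_ofReal_iff hγ0).1 h1
  refine absurd hbad (not_lt.2 (iSup₂_le fun t ht => ?_))
  rw [RegAC.Setting.l2Sq_eq (h := RegAC.toL2 D.μ (fun x => uε t ω x - Z t ω x) - u t) (by
    filter_upwards [hd t ht] with x hx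
    rw [hx])]
  exact ENNReal.ofReal_le_ofReal
    (key ε hε hε1 γ hγ _ _ hz hy hd0 h2 h3 h4 t ht)
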